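/- Work over $\mathbb{C}$. Let $V_6 = Q\cap F\subset\mathbb{P}^5$ be a prime Fano threefold of genus $4$ in its anticanonical embedding, that is, a smooth complete intersection threefold of a quadric $Q$ and a cubic $F$. An *elliptic quartic* on $V_6$ is a (possibly singular) curve $C\subset V_6$, contained in $V_6$ as a closed subscheme, which is a complete intersection of two quadrics in some 3-space $\mathbb{P}^3\subset\mathbb{P}^5$. (1) On every such $V_6$ there exist elliptic quartics. More precisely, there exist a 3-space $\mathbb{P}^3\subset\mathbb{P}^5$ such that $\mathbb{P}^3\cap V_6$ is a curve (a complete intersection of a quadric and a cubic in $\mathbb{P}^3$), a (possibly singular) conic $K\subset \mathbb{P}^3\cap V_6$, and an elliptic quartic $C\subset \mathbb{P}^3\cap V_6$, such that $C$ and $K$ are linked (residual to each other) in $\mathbb{P}^3\cap V_6$; that is, writing $J$, $I_K$, $I_C$ for the homogeneous ideals of $\mathbb{P}^3\cap V_6$, $K$, $C$, one has $(J:I_K)=I_C$ and $(J:I_C)=I_K$. (2) If $V_6$ is general, then the general elliptic quartic on $V_6$ is smooth: there is a dense Zariski open subset $U$ of the vector space of pairs $(q,f)$ of a quadratic and a cubic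 form in six variables such that for every $(q,f)\in U$ the intersection $V_6=\{q=f=0\}$ is a smooth complete intersection threefold and the family of all elliptic quartics on $V_6$, with its Zariski topology, contains a dense open subset consisting of smooth curves. -/

import Mathlib

open MvPolynomial

noncomputable section

namespace FanoQuartics

/-- The homogeneous coordinate ring of `ℙ⁵` over `ℂ`. Closed subschemes of `ℙ⁵` are described by
their homogeneous ideals; inclusion `X ⊆ Y` of subschemes is `I_Y ≤ I_X`, and the intersection of
`X` and `Y` is cut out by `I_X ⊔ I_Y`. -/
abbrev CoordRing : Type := MvPolynomial (Fin 6) ℂ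

/-- The vector space of forms of degree `d` on `ℙ⁵` (including the zero form). -/
abbrev Forms (d : ℕ) : Type := homogeneousSubmodule (Fin 6) ℂ d

/-- `I` is the ideal of a complete intersection in `ℙ⁵` of hypersurfaces of the degrees listed in
`ds`: it is generated by a regular sequence of forms of these degrees. -/
def IsCompleteIntersection (ds : List ℕ) (I : Ideal CoordRing) : Prop :=
  ∃ fs : List CoordRing, List.Forall₂ (fun f d => f.IsHomogeneous d) fs ds ∧
    RingTheory.Sequence.IsRegular CoordRing fs ∧ I = Ideal.ofList fs

/-- The gradient of a polynomial at a point of `ℂ⁶`. -/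
def gradientAt (p : CoordRing) (x : Fin 6 → ℂ) : Fin 6 → ℂ := fun i => eval x (pderiv i p)

/-- Jacobian criterion: the subscheme of `ℙ⁵` cut out by the homogeneous ideal `I` is smooth of
codimension `c`, that is, the Jacobian matrix of `I` has rank `c` at each of its points. -/
def IsSmoothOfCodim (I : Ideal CoordRing) (c : ℕ) : Prop :=
  ∀ x : Fin 6 → ℂ, x ≠ 0 → (∀ p ∈ I, eval x p = 0) →
    Module.finrank ℂ (Submodule.span ℂ {v : Fin 6 → ℂ | ∃ p ∈ I, v = gradientAt p x}) = c

/-- The ideal of the intersection `V = Q ∩ F` of the hypersurfaces `q = 0` and `f = 0`. -/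
def intersectionIdeal (q f : CoordRing) : Ideal CoordRing := Ideal.span {q, f}

/-- A projective 3-space `ℙ³ ⊆ ℙ⁵`. -/
def IsThreeSpace (I : Ideal CoordRing) : Prop := IsCompleteIntersection [1, 1] I

/-- A (possibly singular) conic in `ℙ⁵`: a quadric curve in a plane. -/
def IsConic (I : Ideal CoordRing) : Prop := IsCompleteIntersection [1, 1, 1, 2] I

/-- A (possibly singular) elliptic quartic in `ℙ⁵`: a curve that is the complete intersection of
two quadrics in a `ℙ³`. -/
def IsEllipticQuartic (I : Ideal CoordRing) : Prop := IsCompleteIntersection [1, 1, 2, 2] I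

/-- The subschemes with ideals `I` and `I'` are linked (residual to each other) in the subscheme
with ideal `J`. -/
def AreLinkedIn (J I I' : Ideal CoordRing) : Prop :=
  J ≤ I ∧ J ≤ I' ∧ Submodule.colon J (I : Set CoordRing) = I' ∧
    Submodule.colon J (I' : Set CoordRing) = I

/-- The Zariski topology on a finite dimensional complex vector space: a basis of open sets is
given by the non-vanishing loci of polynomial functions. -/
abbrev zariskiTopology (W : Type*) [AddCommGroup W] [Module ℂ W] : TopologicalSpace W :=
  TopologicalSpace.generateFrom
    {U : Set W | ∃ p ∈ Algebra.adjoin ℂ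
      (Set.range fun (l : Module.Dual ℂ W) (w : W) => l w), U = {w | p w ≠ 0}}

/-- The elliptic quartics contained (as subschemes) in the subscheme of `ℙ⁵` with ideal `I`. -/
def EllipticQuarticsOn (I : Ideal CoordRing) : Type :=
  {E : Ideal CoordRing // IsEllipticQuartic E ∧ I ≤ E}

/-- Equations of elliptic quartics on the subscheme with ideal `I`: quadruples of two linear and
two quadratic forms that present such a curve as a complete intersection. -/
def quarticEquations (I : Ideal CoordRing) : Set (Forms 1 × Forms 1 × Forms 2 × Forms 2) :=
  {t | RingTheory.Sequence.IsRegular CoordRing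
      [(t.1 : CoordRing), (t.2.1 : CoordRing), (t.2.2.1 : CoordRing), (t.2.2.2 : CoordRing)] ∧
    I ≤ Ideal.ofList
      [(t.1 : CoordRing), (t.2.1 : CoordRing), (t.2.2.1 : CoordRing), (t.2.2.2 : CoordRing)]}

/-- The elliptic quartic with given equations. -/
def quarticOfEquations (I : Ideal CoordRing) (t : quarticEquations I) : EllipticQuarticsOn I :=
  ⟨Ideal.ofList [(t.1.1 : CoordRing), (t.1.2.1 : CoordRing), (t.1.2.2.1 : CoordRing),
      (t.1.2.2.2 : CoordRing)],
    ⟨_, List.Forall₂.cons t.1.1.2 (List.Forall₂.cons t.1.2.1.2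
      (List.Forall₂.cons t.1.2.2.1.2 (List.Forall₂.cons t.1.2.2.2.2 List.Forall₂.nil))),
      t.2.1, rfl⟩, t.2.2⟩

/-- The Zariski topology on the family of elliptic quartics on a subscheme of `ℙ⁵`: the quotient
topology from the locally closed set of their equations in a vector space. (Two systems of
equations give the same curve if and only if they differ by an element of a connected algebraic
group acting on the set of equations.) -/
instance (I : Ideal CoordRing) : TopologicalSpace (EllipticQuarticsOn I) :=
  TopologicalSpace.coinduced (quarticOfEquations I)
    (TopologicalSpace.induced Subtype.val
      (zariskiTopology (Forms 1 × Forms 1 × Forms 2 × Forms 2)))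

end FanoQuartics

end

noncomputable section

namespace FanoQuartics

/-! Existence. It suffices to find a plane on which f = h q with h linear and q ≠ 0, for the conic
cut there by Q lies on F. In a 3-space containing the plane, with the plane given by y = 0, this
reads f = h' q + y g with g a quadric. So the section of V has equations q = y g = 0, the conic is q
= y = 0 and the residual quartic is q = g = 0. If q is irreducible on the 3-space, its ideal is
prime there and the colon ideals follow by cancellation (`areLinked_sup_span_mul`). Such a 3-space
exists because smoothness of V allows Q at most one singular point, so that q has rank at least 3 on
a suitable 3-space through the plane (`exists_nondegenerate_triple`).

The plane is the projection from (0:…:0:1) of a plane lying in the cubic f − x₆ q of ℙ⁶. Planes of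
ℙ⁶ meeting a fixed plane depend on 10 parameters, as many as a ternary cubic has coefficients, so
every cubic should contain one. `exists_plane_in_cubic` proves this by perturbing the cubic until
the coefficient map becomes dominant, and passing to a limit in a compact set of frames. If q
vanished on the projected plane, V would contain a line through a point of the fixed plane. The
fixed plane is therefore taken to meet no line of V (`exists_plane_without_lines`). This is possible
because the lines of V sweep out at most a surface: the normal bundle of a line has rank 2 and
degree 4 − 5 = −1, so it cannot have two generically independent sections
(`no_independent_linear_sections`). A generic plane is one with coordinates independent over the
coefficients of q and f, and derivations of ℂ play the role of tangent vectors to the family of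
lines.

Generic smoothness. Equations of a quartic, together with the coefficients expressing a quadric and
a cubic through them, form a vector space with a polynomial map `combination` to pairs (q, f). The
fibre over (q, f) contains all equations of elliptic quartics on V. Smoothness of the quartic is an
open condition by elimination (`exists_polyFun_of_smooth`) and holds somewhere. By generic freeness,
a nonzero polynomial is a nonzerodivisor on the general fibre, so its nonvanishing locus is dense
there (`exists_generic_fiber_dense`). No irreducibility of the fibre is needed. -/

/-! ### Common zeros of few polynomials. -/

theorem vanishingIdeal_height_eq {n : ℕ} (x y : Fin n → ℂ) :
    (vanishingIdeal ℂ {x} : Ideal (MvPolynomial (Fin n) ℂ)).height =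
      (vanishingIdeal ℂ {y} : Ideal (MvPolynomial (Fin n) ℂ)).height := by
  let φ : (Fin n → ℂ) → MvPolynomial (Fin n) ℂ →ₐ[ℂ] MvPolynomial (Fin n) ℂ :=
    fun v => aeval (fun i => X i + C (v i))
  have hφ : ∀ v, (φ v).comp (φ (-v)) = AlgHom.id ℂ _ := by
    intro v; ext i; simp [φ]
  have hφ' : ∀ v, (φ (-v)).comp (φ v) = AlgHom.id ℂ _ := by
    intro v; simpa using hφ (-v)
  let e : MvPolynomial (Fin n) ℂ ≃ₐ[ℂ] MvPolynomial (Fin n) ℂ :=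
    AlgEquiv.ofAlgHom (φ (x - y)) (φ (-(x - y))) (hφ _) (hφ' _)
  have h : (vanishingIdeal ℂ {x} : Ideal (MvPolynomial (Fin n) ℂ)).map e.toRingEquiv =
      vanishingIdeal ℂ {y} := by
    ext p
    rw [Ideal.mem_map_of_equiv]
    constructor
    · rintro ⟨q, hq, rfl⟩
      rw [mem_vanishingIdeal_singleton_iff] at hq ⊢
      have : (aeval y).comp (φ (x - y)) = (aeval x : MvPolynomial (Fin n) ℂ →ₐ[ℂ] ℂ) := by
        ext i; simp [φ]
      rw [← hq, ← this]; rfl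
    · intro hp
      refine ⟨φ (-(x - y)) p, ?_, ?_⟩
      · rw [mem_vanishingIdeal_singleton_iff] at hp ⊢
        have : (aeval x).comp (φ (-(x - y))) = (aeval y : MvPolynomial (Fin n) ℂ →ₐ[ℂ] ℂ) := by
          ext i; simp [φ]
        rw [← hp, ← this]; rfl
      · exact DFunLike.congr_fun (hφ (x - y)) p
  rw [← h]
  exact (e.toRingEquiv.height_map _).symm

/-- Fewer polynomials without constant term than variables have a common zero besides the
origin. -/
theorem exists_ne_zero_common_zero {m n : ℕ} (hmn : m < n) (f : Fin m → MvPolynomial (Fin n) ℂ)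
    (hf : ∀ i, eval 0 (f i) = 0) : ∃ x : Fin n → ℂ, x ≠ 0 ∧ ∀ i, eval x (f i) = 0 := by
  by_contra! hcon
  set I : Ideal (MvPolynomial (Fin n) ℂ) := Ideal.span (Set.range f) with hI
  have hz : zeroLocus ℂ I = {0} := by
    ext x
    rw [hI, zeroLocus_span]
    simp only [Set.mem_ofPred_eq, Set.forall_mem_range, Set.mem_singleton_iff]
    constructor
    · intro h
      by_contra hx
      obtain ⟨i, hi⟩ := hcon x hx
      exact hi (h i)
    · rintro rfl i
      exact hf i
  have hr : I.radical = vanishingIdeal ℂ {(0 : Fin n → ℂ)} := by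
    rw [← vanishingIdeal_zeroLocus_eq_radical (K := ℂ), hz]
  have hmax : (vanishingIdeal ℂ {(0 : Fin n → ℂ)} : Ideal (MvPolynomial (Fin n) ℂ)).IsMaximal :=
    isMaximal_iff_eq_vanishingIdeal_singleton.2 ⟨0, rfl⟩
  -- If the origin is the only common zero, its maximal ideal is minimal over an ideal with `m`
  -- generators, so Krull's theorem bounds its height by `m`. Translations carry the bound to every
  -- maximal ideal, against dimension `n`.
  have hmin : vanishingIdeal ℂ {(0 : Fin n → ℂ)} ∈ I.minimalPrimes := by
    rw [← Ideal.radical_minimalPrimes, hr]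
    have := hmax.isPrime
    rw [Ideal.minimalPrimes_eq_subsingleton_self]; rfl
  have hle : (vanishingIdeal ℂ {(0 : Fin n → ℂ)} : Ideal (MvPolynomial (Fin n) ℂ)).height ≤ m := by
    refine (Ideal.height_le_card_of_mem_minimalPrimes_span (Set.finite_range f) hmin).trans ?_
    rw [← Set.image_univ]
    exact_mod_cast (Set.ncard_image_le).trans (by simp [Set.ncard_univ])
  have hdim : ringKrullDim (MvPolynomial (Fin n) ℂ) ≤ (m : ℕ) := by
    rw [ringKrullDim_le_iff_isMaximal_height_le]
    intro M hM
    obtain ⟨x, rfl⟩ := isMaximal_iff_eq_vanishingIdeal_singleton.1 hM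
    rw [vanishingIdeal_height_eq x 0]
    exact_mod_cast hle
  rw [MvPolynomial.ringKrullDim_of_isNoetherianRing] at hdim
  simp at hdim
  have : n ≤ m := by exact_mod_cast hdim
  omega

/-! ### Generic freeness through division with remainder. -/

section NormalForm

variable {A : Type*} [CommRing A] {n : ℕ}

/-- Generic normal form modulo an ideal of a polynomial ring over a domain: after inverting one
nonzero scalar `g`, the quotient is free on the monomials outside the set `S` of leading
exponents. -/
theorem exists_generic_normal_form [IsDomain A] (I : Ideal (MvPolynomial (Fin n) A)) :
    ∃ (g : A) (S : Set (Fin n →₀ ℕ)), g ≠ 0 ∧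
      (∀ p : MvPolynomial (Fin n) A, ∃ (k : ℕ) (r : MvPolynomial (Fin n) A),
        C g ^ k * p - r ∈ I ∧ ∀ d ∈ r.support, d ∉ S) ∧
      (∀ r ∈ I, (∀ d ∈ r.support, d ∉ S) → r = 0) ∧
      ((∀ a : A, C a ∈ I → a = 0) → (0 : Fin n →₀ ℕ) ∉ S) := by
  classical
  let m : MonomialOrder (Fin n) := MonomialOrder.lex
  let S : Set (Fin n →₀ ℕ) := {d | ∃ p ∈ I, p ≠ 0 ∧ m.degree p = d}
  -- Dickson's lemma: there are finitely many minimal leading exponents, so a single scalar, the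
  -- product of the corresponding leading coefficients, permits every division step.
  obtain ⟨T, hTS, hTfin, hT⟩ : ∃ T : Set (Fin n →₀ ℕ), T ⊆ S ∧ T.Finite ∧
      ∀ d ∈ S, ∃ e ∈ T, e ≤ d := by
    refine ⟨{d | Minimal (· ∈ S) d}, fun d hd => hd.1, ?_, ?_⟩
    · exact (setOfPred_minimal_antichain _).finite_of_partiallyWellOrderedOn
        ((Set.isPWO_of_wellQuasiOrderedLE S).mono fun d hd => hd.1)
    · intro d hd
      obtain ⟨e, he, hm⟩ := exists_minimal_le_of_wellFoundedLT (· ∈ S) d hd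
      exact ⟨e, hm, he⟩
  have hTS' : ∀ d ∈ T, ∃ p, p ∈ I ∧ p ≠ 0 ∧ m.degree p = d := hTS
  choose! P hPI hP0 hPd using hTS'
  let g : A := ∏ d ∈ hTfin.toFinset, m.leadingCoeff (P d)
  refine ⟨g, S, ?_, ?_, ?_, ?_⟩
  · refine Finset.prod_ne_zero_iff.2 fun d hd => ?_
    rw [MonomialOrder.leadingCoeff_ne_zero_iff]
    exact hP0 d (by simpa using hd)
  · intro p
    induction hp : m.toSyn (m.degree p) using WellFoundedLT.induction generalizing p with
    | ind b ih =>
    subst hp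
    by_cases hp0 : p = 0
    · exact ⟨0, 0, by simp [hp0], by simp⟩
    by_cases hdS : m.degree p ∈ S
    · obtain ⟨e, heT, hed⟩ := hT _ hdS
      obtain ⟨u, hu⟩ : m.leadingCoeff (P e) ∣ g := Finset.dvd_prod_of_mem _ (by simpa using heT)
      set q := C g * p - monomial (m.degree p - e) (u * m.leadingCoeff p) * P e with hq
      have hsub : monomial (m.degree p - e) (u * m.leadingCoeff p) * P e ∈ I :=
        I.mul_mem_left _ (hPI e heT)
      by_cases hq0 : q = 0
      · exact ⟨1, 0, by rw [pow_one, sub_zero, sub_eq_zero.1 hq0]; exact hsub, by simp⟩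
      have hdeg : m.toSyn (m.degree q) ≤ m.toSyn (m.degree p) := by
        refine (m.degree_sub_le).trans (sup_le ?_ ?_)
        · refine (m.degree_mul_le).trans ?_
          rw [m.degree_C, zero_add]
        · refine (m.degree_mul_le).trans ?_
          rw [map_add]
          refine (add_le_add_left (m.degree_monomial_le _) _).trans ?_
          rw [← map_add, hPd e heT, tsub_add_cancel_of_le hed]
      have hcoeff : q.coeff (m.degree p) = 0 := by
        rw [hq, coeff_sub, coeff_C_mul]
        have h1 : (monomial (m.degree p - e) (u * m.leadingCoeff p) * P e).coeff (m.degree p) =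
            u * m.leadingCoeff p * m.leadingCoeff (P e) := by
          have h2 := coeff_monomial_mul e (m.degree p - e) (u * m.leadingCoeff p) (P e)
          rw [tsub_add_cancel_of_le hed] at h2
          rw [h2, MonomialOrder.leadingCoeff, MonomialOrder.leadingCoeff, hPd e heT]
        rw [h1, hu, MonomialOrder.leadingCoeff, MonomialOrder.leadingCoeff]
        ring
      have hlt : m.toSyn (m.degree q) < m.toSyn (m.degree p) := by
        refine lt_of_le_of_ne hdeg fun h => ?_
        have h2 := m.toSyn.injective h
        rw [← h2] at hcoeff
        exact hq0 (m.coeff_degree_eq_zero_iff.1 hcoeff)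
      obtain ⟨k, r, hr, hrS⟩ := ih _ hlt q rfl
      refine ⟨k + 1, r, ?_, hrS⟩
      have : C g ^ (k + 1) * p - r = (C g ^ k * q - r) +
          C g ^ k * (monomial (m.degree p - e) (u * m.leadingCoeff p) * P e) := by
        rw [hq]; ring
      rw [this]
      exact I.add_mem hr (I.mul_mem_left _ hsub)
    -- A leading term outside `S` is already in normal form; it is set aside, to be rescaled by the
    -- power of `g` that the remaining terms require.
    · set q := p - monomial (m.degree p) (m.leadingCoeff p) with hq
      by_cases hq0 : q = 0
      · refine ⟨0, p, by simp, ?_⟩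
        intro d hd
        rw [sub_eq_zero.1 hq0] at hd
        have := support_monomial_subset hd
        rw [Finset.mem_singleton] at this
        rwa [this]
      have hdeg : m.toSyn (m.degree q) ≤ m.toSyn (m.degree p) :=
        (m.degree_sub_le).trans (sup_le le_rfl (m.degree_monomial_le _))
      have hcoeff : q.coeff (m.degree p) = 0 := by
        rw [hq, coeff_sub, coeff_monomial, if_pos rfl, MonomialOrder.leadingCoeff, sub_self]
      have hlt : m.toSyn (m.degree q) < m.toSyn (m.degree p) := by
        refine lt_of_le_of_ne hdeg fun h => ?_
        have h2 := m.toSyn.injective h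
        rw [← h2] at hcoeff
        exact hq0 (m.coeff_degree_eq_zero_iff.1 hcoeff)
      obtain ⟨k, r, hr, hrS⟩ := ih _ hlt q rfl
      refine ⟨k, r + C g ^ k * monomial (m.degree p) (m.leadingCoeff p), ?_, ?_⟩
      · have : C g ^ k * p - (r + C g ^ k * monomial (m.degree p) (m.leadingCoeff p)) =
            C g ^ k * q - r := by rw [hq]; ring
        rwa [this]
      · intro d hd
        rcases Finset.mem_union.1 (support_add hd) with h | h
        · exact hrS d h
        · rw [← C_pow, C_mul_monomial] at h
          have := support_monomial_subset h
          rw [Finset.mem_singleton] at this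
          rwa [this]
  · intro r hr hrS
    by_contra h0
    exact hrS _ (m.degree_mem_support h0) ⟨r, hr, h0, rfl⟩
  · rintro hC ⟨p, hp, hp0, hd⟩
    have := m.eq_C_of_degree_eq_zero hd
    rw [this] at hp
    exact hp0 (by rw [this, hC _ hp, C_0])

/-- The normal forms of finitely many polynomials, with a common denominator. -/
theorem exists_uniform_normal_form {I : Ideal (MvPolynomial (Fin n) A)} {g : A}
    {S : Set (Fin n →₀ ℕ)}
    (h : ∀ p : MvPolynomial (Fin n) A, ∃ (k : ℕ) (r : MvPolynomial (Fin n) A),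
      C g ^ k * p - r ∈ I ∧ ∀ d ∈ r.support, d ∉ S)
    {ι : Type*} [Fintype ι] (p : ι → MvPolynomial (Fin n) A) :
    ∃ (k : ℕ) (r : ι → MvPolynomial (Fin n) A),
      ∀ i, C g ^ k * p i - r i ∈ I ∧ ∀ d ∈ (r i).support, d ∉ S := by
  classical
  choose k r hr hS using fun i => h (p i)
  refine ⟨∑ i, k i, fun i => C g ^ (∑ j, k j - k i) * r i, fun i => ⟨?_, fun d hd => ?_⟩⟩
  · have hk : k i ≤ ∑ j, k j := Finset.single_le_sum (fun _ _ => Nat.zero_le _) (Finset.mem_univ i)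
    have : C g ^ (∑ j, k j) * p i - C g ^ (∑ j, k j - k i) * r i =
        C g ^ (∑ j, k j - k i) * (C g ^ k i * p i - r i) := by
      rw [mul_sub, ← mul_assoc, ← pow_add, Nat.sub_add_cancel hk]
    rw [this]
    exact I.mul_mem_left _ (hr i)
  · refine hS i d ?_
    rw [mem_support_iff] at hd ⊢
    dsimp only at hd
    rw [← C_pow, coeff_C_mul] at hd
    exact right_ne_zero_of_mul hd

end NormalForm

/-! ### General fibres of polynomial maps. -/

section Fibers

variable {b n : ℕ} (Φ : Fin b → MvPolynomial (Fin n) ℂ)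

/-- The ideal generated by the equations of the fibre of a polynomial map over a point. -/
def fiberIdeal (y : Fin b → ℂ) : Ideal (MvPolynomial (Fin n) ℂ) :=
  Ideal.span (Set.range fun j => Φ j - C (y j))

theorem mem_zeroLocus_fiberIdeal {y : Fin b → ℂ} {x : Fin n → ℂ} :
    x ∈ zeroLocus ℂ (fiberIdeal Φ y) ↔ ∀ j, eval x (Φ j) = y j := by
  rw [fiberIdeal, zeroLocus_span]
  simp [sub_eq_zero]

theorem aeval_sub_C_mem_fiberIdeal (y : Fin b → ℂ) (g : MvPolynomial (Fin b) ℂ) :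
    aeval Φ g - C (eval y g) ∈ fiberIdeal Φ y := by
  rw [← Ideal.Quotient.eq]
  induction g using MvPolynomial.induction_on with
  | C a => simp
  | add p q hp hq => simp only [map_add, hp, hq]
  | mul_X p i hp =>
    have : Ideal.Quotient.mk (fiberIdeal Φ y) (Φ i) = Ideal.Quotient.mk _ (C (y i)) :=
      Ideal.Quotient.eq.2 (Ideal.subset_span ⟨i, rfl⟩)
    simp only [map_mul, hp, aeval_X, eval_X, this]

/-- Modulo the fibre ideal, functions pulled back from the target are constants, so one that is
nonzero at `y` is a unit. This removes the denominators left by normal forms. -/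
theorem mem_fiberIdeal_of_pow_mul_mem {y : Fin b → ℂ} {g : MvPolynomial (Fin b) ℂ}
    (hg : eval y g ≠ 0) {k : ℕ} {p : MvPolynomial (Fin n) ℂ}
    (h : aeval Φ g ^ k * p ∈ fiberIdeal Φ y) : p ∈ fiberIdeal Φ y := by
  have h1 := aeval_sub_C_mem_fiberIdeal Φ y g
  rw [← Ideal.Quotient.eq] at h1
  rw [← Ideal.Quotient.eq_zero_iff_mem, map_mul, map_pow, h1, ← map_pow, ← C_pow, ← map_mul,
    Ideal.Quotient.eq_zero_iff_mem] at h
  have h2 := (fiberIdeal Φ y).mul_mem_left (C ((eval y g ^ k)⁻¹)) h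
  rwa [← mul_assoc, ← C_mul, inv_mul_cancel₀ (pow_ne_zero _ hg), C_1, one_mul] at h2

theorem mem_fiberIdeal_iff {y : Fin b → ℂ} {p : MvPolynomial (Fin n) ℂ} :
    p ∈ fiberIdeal Φ y ↔ ∃ c : Fin b → MvPolynomial (Fin n) ℂ, p = ∑ j, (Φ j - C (y j)) * c j := by
  rw [fiberIdeal, Ideal.mem_span_range_iff_exists_fun]
  constructor
  · rintro ⟨c, hc⟩
    exact ⟨c, by rw [← hc]; exact Finset.sum_congr rfl fun j _ => mul_comm _ _⟩
  · rintro ⟨c, hc⟩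
    exact ⟨c, by rw [hc]; exact Finset.sum_congr rfl fun j _ => mul_comm _ _⟩

/-- The polynomial ring over the coordinate ring of the target, mapped to that of the source. -/
def relativeEval : MvPolynomial (Fin n) (MvPolynomial (Fin b) ℂ) →+* MvPolynomial (Fin n) ℂ :=
  eval₂Hom (aeval Φ : MvPolynomial (Fin b) ℂ →ₐ[ℂ] MvPolynomial (Fin n) ℂ).toRingHom X

theorem relativeEval_C (a : MvPolynomial (Fin b) ℂ) : relativeEval Φ (C a) = aeval Φ a := by
  simp [relativeEval]

theorem relativeEval_surjective : Function.Surjective (relativeEval Φ) := by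
  intro p
  refine ⟨map C p, ?_⟩
  rw [relativeEval, coe_eval₂Hom, eval₂_map]
  have : ((aeval Φ : MvPolynomial (Fin b) ℂ →ₐ[ℂ] MvPolynomial (Fin n) ℂ).toRingHom.comp
      (C : ℂ →+* MvPolynomial (Fin b) ℂ)) = C := by
    ext; simp
  rw [this, eval₂_eta]

/-- A nonzero polynomial `s` is a nonzero divisor on the generic fibre of a polynomial map. -/
theorem exists_mem_fiberIdeal_of_mul_mem {s : MvPolynomial (Fin n) ℂ} (hs : s ≠ 0) :
    ∃ g : MvPolynomial (Fin b) ℂ, g ≠ 0 ∧ ∀ y, eval y g ≠ 0 → ∀ p, s * p ∈ fiberIdeal Φ y →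
      p ∈ fiberIdeal Φ y := by
  -- Generic freeness of the hypersurface s = 0 over the target kills the Tor that obstructs
  -- cancelling `s`. Concretely, the coefficients in s p = Σ (Φ j − y j) c j are replaced by normal
  -- forms modulo `s`. By uniqueness their part of the relation vanishes identically, and the rest
  -- is divisible by `s`.
  obtain ⟨g, S, hg0, hnf, hind, -⟩ :=
    exists_generic_normal_form ((Ideal.span {s}).comap (relativeEval Φ))
  refine ⟨g, hg0, fun y hy p hp => ?_⟩
  obtain ⟨c, hc⟩ := (mem_fiberIdeal_iff Φ).1 hp
  choose c' hc' using fun j => relativeEval_surjective Φ (c j)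
  obtain ⟨k, r, hr⟩ := exists_uniform_normal_form hnf c'
  have hd : ∀ j, ∃ d, aeval Φ g ^ k * c j = relativeEval Φ (r j) + s * d := by
    intro j
    have := (hr j).1
    rw [Ideal.mem_comap, Ideal.mem_span_singleton, map_sub, map_mul, map_pow, relativeEval_C,
      hc'] at this
    obtain ⟨d, hd⟩ := this
    exact ⟨d, by rw [← hd]; ring⟩
  choose d hd using hd
  have hsum : ∑ j, C (X j - C (y j)) * r j = 0 := by
    apply hind
    · rw [Ideal.mem_comap, Ideal.mem_span_singleton]
      refine ⟨aeval Φ g ^ k * p - ∑ j, (Φ j - C (y j)) * d j, ?_⟩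
      have h1 : s * (aeval Φ g ^ k * p) = ∑ j, (Φ j - C (y j)) * (aeval Φ g ^ k * c j) := by
        rw [mul_left_comm, hc, Finset.mul_sum]
        exact Finset.sum_congr rfl fun j _ => by ring
      rw [mul_sub, h1, Finset.mul_sum, map_sum, ← Finset.sum_sub_distrib]
      refine Finset.sum_congr rfl fun j _ => ?_
      rw [hd, map_mul, relativeEval_C, map_sub, aeval_X, aeval_C]
      rw [algebraMap_eq]
      ring
    · classical
      intro e he
      obtain ⟨j, -, hj⟩ := Finset.mem_biUnion.1 (support_sum he)
      refine (hr j).2 e ?_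
      rw [mem_support_iff] at hj ⊢
      rw [coeff_C_mul] at hj
      exact right_ne_zero_of_mul hj
  have hkey : s * (aeval Φ g ^ k * p - ∑ j, (Φ j - C (y j)) * d j) = 0 := by
    have h2 := congrArg (relativeEval Φ) hsum
    rw [map_sum, map_zero] at h2
    have h1 : s * (aeval Φ g ^ k * p) = ∑ j, (Φ j - C (y j)) * (aeval Φ g ^ k * c j) := by
      rw [mul_left_comm, hc, Finset.mul_sum]
      exact Finset.sum_congr rfl fun j _ => by ring
    rw [mul_sub, h1, Finset.mul_sum, ← Finset.sum_sub_distrib, ← h2]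
    refine Finset.sum_congr rfl fun j _ => ?_
    rw [hd, map_mul, relativeEval_C, map_sub, aeval_X, aeval_C]
    rw [algebraMap_eq]
    ring
  have h3 := sub_eq_zero.1 ((mul_eq_zero.1 hkey).resolve_left hs)
  exact mem_fiberIdeal_of_pow_mul_mem Φ hy (k := k) ((mem_fiberIdeal_iff Φ).2 ⟨d, h3⟩)

/-- The nonvanishing locus of a nonzero polynomial is dense in the generic fibre of a polynomial
map. -/
theorem exists_generic_fiber_dense {s : MvPolynomial (Fin n) ℂ} (hs : s ≠ 0) :
    ∃ g : MvPolynomial (Fin b) ℂ, g ≠ 0 ∧ ∀ y, eval y g ≠ 0 → ∀ p x, (∀ j, eval x (Φ j) = y j) →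
      eval x p ≠ 0 → ∃ x', (∀ j, eval x' (Φ j) = y j) ∧ eval x' p ≠ 0 ∧ eval x' s ≠ 0 := by
  obtain ⟨g, hg0, hg⟩ := exists_mem_fiberIdeal_of_mul_mem Φ hs
  refine ⟨g, hg0, fun y hy p x hx hxp => ?_⟩
  by_contra! hcon
  -- If `s` vanished wherever `p` does not, the Nullstellensatz would put a power of `s * p` in the
  -- fibre ideal. Cancelling `s` leaves a power of `p`, which is nonzero at `x`.
  have hmem : s * p ∈ (fiberIdeal Φ y).radical := by
    rw [← vanishingIdeal_zeroLocus_eq_radical (K := ℂ)]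
    intro x' hx'
    rw [mem_zeroLocus_fiberIdeal] at hx'
    have : eval x' s * eval x' p = 0 := by
      by_cases h : eval x' p = 0
      · rw [h, mul_zero]
      · rw [hcon x' hx' h, zero_mul]
    simpa [aeval_eq_eval] using this
  obtain ⟨k, hk⟩ := hmem
  have hpow : ∀ j q, s ^ j * q ∈ fiberIdeal Φ y → q ∈ fiberIdeal Φ y := by
    intro j
    induction j with
    | zero => intro q hq; simpa using hq
    | succ j ih =>
      intro q hq
      exact hg y hy _ (ih _ (by rwa [pow_succ, mul_assoc] at hq))
  rw [mul_pow] at hk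
  have h1 := (mem_zeroLocus_fiberIdeal Φ).2 hx _ (hpow k _ hk)
  rw [map_pow] at h1
  exact hxp (by simpa [aeval_eq_eval] using eq_zero_of_pow_eq_zero h1)

/-- A dominant polynomial map is surjective over a nonempty principal open set. -/
theorem exists_surjOn_of_injective_aeval (hΦ : Function.Injective (aeval (R := ℂ) Φ)) :
    ∃ g : MvPolynomial (Fin b) ℂ, g ≠ 0 ∧ ∀ y, eval y g ≠ 0 → ∃ x, ∀ j, eval x (Φ j) = y j := by
  -- Dominance puts 1 among the monomials of the normal forms. Over a point with empty fibre, 1 lies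
  -- in the ideal of the Φ j − y j, and the constant coefficient of the normalized relation,
  -- evaluated at `y`, gives g(y)^k = 0.
  obtain ⟨g, S, hg0, hnf, hind, h0⟩ :=
    exists_generic_normal_form (RingHom.ker (relativeEval Φ))
  have h0S : (0 : Fin n →₀ ℕ) ∉ S := by
    refine h0 fun a ha => hΦ ?_
    rw [RingHom.mem_ker, relativeEval_C] at ha
    rw [ha, map_zero]
  refine ⟨g, hg0, fun y hy => ?_⟩
  by_contra! hcon
  have hone : (1 : MvPolynomial (Fin n) ℂ) ∈ fiberIdeal Φ y := by
    rw [← Ideal.eq_top_iff_one, ← Ideal.radical_eq_top,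
      ← vanishingIdeal_zeroLocus_eq_radical (K := ℂ), Ideal.eq_top_iff_one]
    intro x hx
    rw [mem_zeroLocus_fiberIdeal] at hx
    obtain ⟨j, hj⟩ := hcon x
    exact absurd (hx j) hj
  obtain ⟨c, hc⟩ := (mem_fiberIdeal_iff Φ).1 hone
  choose c' hc' using fun j => relativeEval_surjective Φ (c j)
  obtain ⟨k, r, hr⟩ := exists_uniform_normal_form hnf c'
  have hz : C (g ^ k) - ∑ j, C (X j - C (y j)) * r j = 0 := by
    apply hind
    · rw [RingHom.mem_ker, map_sub, map_sum, relativeEval_C, map_pow, sub_eq_zero]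
      conv_lhs => rw [← mul_one (aeval Φ g ^ k), hc, Finset.mul_sum]
      refine Finset.sum_congr rfl fun j _ => ?_
      have := (hr j).1
      rw [RingHom.mem_ker, map_sub, map_mul, map_pow, relativeEval_C, hc', sub_eq_zero] at this
      rw [map_mul, ← this, relativeEval_C, map_sub, aeval_X, aeval_C, algebraMap_eq]
      ring
    · classical
      intro e he
      rcases Finset.mem_union.1 (support_sub _ _ _ he) with h | h
      · have h1 : e = 0 := by
          by_contra hne
          rw [mem_support_iff, coeff_C, if_neg (Ne.symm hne)] at h
          exact h rfl
        rwa [h1]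
      · obtain ⟨j, -, hj⟩ := Finset.mem_biUnion.1 (support_sum h)
        refine (hr j).2 e ?_
        rw [mem_support_iff] at hj ⊢
        rw [coeff_C_mul] at hj
        exact right_ne_zero_of_mul hj
  have hcoeff := congrArg (fun q => eval y (constantCoeff q)) hz
  simp only [map_sub, map_sum, map_mul, constantCoeff_C, eval_X, eval_C, sub_self, zero_mul,
    Finset.sum_const_zero, sub_zero, map_zero, map_pow] at hcoeff
  exact hy (eq_zero_of_pow_eq_zero hcoeff)

theorem pderiv_aeval_eq_sum (i : Fin n) (G : MvPolynomial (Fin b) ℂ) :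
    pderiv i (aeval Φ G) = ∑ j, aeval Φ (pderiv j G) * pderiv i (Φ j) := by
  induction G using MvPolynomial.induction_on with
  | C a => simp [algebraMap_eq]
  | add p q hp hq => simp only [map_add, hp, hq, add_mul, Finset.sum_add_distrib]
  | mul_X p k hp =>
    rw [map_mul, aeval_X, pderiv_mul, hp]
    simp only [pderiv_mul, pderiv_X, map_add, map_mul, aeval_X, add_mul, Finset.sum_add_distrib]
    congr 1
    · rw [Finset.sum_mul]
      exact Finset.sum_congr rfl fun j _ => by ring
    · rw [Finset.sum_eq_single k]
      · simp
      · intro j _ hj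
        simp [hj.symm]
      · simp

/-- A polynomial map between affine spaces of the same dimension is dominant if its Jacobian
determinant does not vanish at the origin. -/
theorem injective_aeval_of_det_ne_zero (Φ : Fin n → MvPolynomial (Fin n) ℂ)
    (h : (Matrix.of fun i j => eval 0 (pderiv i (Φ j))).det ≠ 0) :
    Function.Injective (aeval (R := ℂ) Φ) := by
  let J : Matrix (Fin n) (Fin n) (MvPolynomial (Fin n) ℂ) := Matrix.of fun i j => pderiv i (Φ j)
  have hJ : J.det ≠ 0 := by
    intro h0
    apply h
    have h1 : (Matrix.of fun i j => eval 0 (pderiv i (Φ j))) = (eval (0 : Fin n → ℂ)).mapMatrix J :=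
      rfl
    rw [h1, ← RingHom.map_det, h0, map_zero]
  rw [injective_iff_map_eq_zero]
  -- Induction on the degree of a relation G(Φ) = 0. By the chain rule the Jacobian matrix kills the
  -- vector of (∂ⱼG)(Φ); its determinant is a nonzero polynomial, so each ∂ⱼG is a relation of lower
  -- degree. In characteristic zero `G` is then constant.
  suffices H : ∀ (N : ℕ) (G : MvPolynomial (Fin n) ℂ), (∀ d, coeff d G ≠ 0 → d.degree < N) →
      aeval Φ G = 0 → G = 0 by
    intro G hG
    refine H (G.totalDegree + 1) G (fun d hd => ?_) hG
    exact Nat.lt_succ_of_le (le_totalDegree (mem_support_iff.2 hd))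
  intro N
  induction N with
  | zero =>
    intro G hd _
    ext d
    by_contra hne
    exact absurd (hd d (by simpa using hne)) (by omega)
  | succ N ih =>
    intro G hd hG
    have hp : ∀ j, pderiv j G = 0 := by
      have h0 : ∀ j, aeval Φ (pderiv j G) = 0 := by
        refine congrFun (Matrix.eq_zero_of_mulVec_eq_zero (M := J)
          (v := fun j => aeval Φ (pderiv j G)) hJ ?_)
        ext1 i
        have h1 := pderiv_aeval_eq_sum Φ i G
        rw [hG, map_zero] at h1
        simp only [Matrix.mulVec, dotProduct, J, Matrix.of_apply, Pi.zero_apply]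
        rw [h1]
        exact Finset.sum_congr rfl fun j _ => mul_comm _ _
      intro j
      refine ih _ (fun d hdj => ?_) (h0 j)
      rw [coeff_pderiv] at hdj
      have := hd _ (left_ne_zero_of_mul hdj)
      rw [map_add, Finsupp.degree_single] at this
      omega
    have hC : G = C (coeff 0 G) := by
      ext d
      rw [coeff_C]
      split_ifs with h0
      · rw [h0]
      · obtain ⟨j, hj⟩ : ∃ j, d j ≠ 0 := by
          by_contra! hcon
          exact h0 (Finsupp.ext fun j => (hcon j).symm)
        have h1 := coeff_pderiv (i := j) G (d - Finsupp.single j 1)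
        rw [hp j, coeff_zero, tsub_add_cancel_of_le
          (Finsupp.single_le_iff.2 (Nat.one_le_iff_ne_zero.2 hj))] at h1
        exact (mul_eq_zero.1 h1.symm).resolve_right (Nat.cast_add_one_ne_zero _)
    rw [hC, aeval_C, algebraMap_eq, C_eq_zero] at hG
    rw [hC, hG, C_0]

/-- A polynomial map between affine spaces of the same dimension whose Jacobian determinant does
not vanish at the origin takes values arbitrarily close to `0`. -/
theorem exists_small_value_of_det_ne_zero (Φ : Fin n → MvPolynomial (Fin n) ℂ)
    (h : (Matrix.of fun i j => eval 0 (pderiv i (Φ j))).det ≠ 0) {δ : ℝ} (hδ : 0 < δ) :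
    ∃ x : Fin n → ℂ, ∀ j, ‖eval x (Φ j)‖ < δ := by
  obtain ⟨g, hg0, hg⟩ := exists_surjOn_of_injective_aeval Φ (injective_aeval_of_det_ne_zero Φ h)
  -- A nonzero polynomial cannot vanish on a whole polydisc.
  obtain ⟨y, hy, hyg⟩ : ∃ y ∈ Set.pi .univ (fun _ : Fin n => Metric.ball (0 : ℂ) δ),
      eval y g ≠ 0 := by
    by_contra! hcon
    refine hg0 (MvPolynomial.funext_set (s := fun _ => Metric.ball (0 : ℂ) δ) ?_ fun x hx => ?_)
    · exact fun _ => (infinite_of_mem_nhds 0 (Metric.ball_mem_nhds 0 hδ))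
    · rw [hcon x hx, map_zero]
  obtain ⟨x, hx⟩ := hg y hyg
  refine ⟨x, fun j => ?_⟩
  rw [hx j]
  simpa using hy j trivial

end Fibers

/-! ### Planes in cubic hypersurfaces of ℙ⁶. -/

/-- A basis of the ternary cubic forms, evaluated at a point. -/
def ternaryCubics (x y z : ℂ) : Fin 10 → ℂ :=
  ![x ^ 3, x ^ 2 * y, x ^ 2 * z, x * y * z, y ^ 2 * z, y * z ^ 2, y ^ 3 + x * y * z,
    x * z ^ 2 + y ^ 2 * z, x * y ^ 2 + y * z ^ 2, z ^ 3 + x * y * z]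

section Expansion

variable {σ A : Type*} [CommRing A] [Algebra ℂ A]

theorem aeval_linear_combination {l : MvPolynomial σ ℂ} (hl : l ∈ homogeneousSubmodule σ ℂ 1)
    (P U W : σ → A) (x y z : ℂ) :
    aeval (fun i => x • P i + y • U i + z • W i) l =
      x • aeval P l + y • aeval U l + z • aeval W l := by
  rw [homogeneousSubmodule_one_eq_span_X] at hl
  induction hl using Submodule.span_induction with
  | mem l h => obtain ⟨i, rfl⟩ := h; simp
  | zero => simp
  | add p q _ _ hp hq => simp only [map_add, hp, hq, smul_add]; abel
  | smul c p _ hp => simp only [map_smul, hp, smul_add, smul_comm c]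

/-- Expansion of the restriction of `F` to a plane. With `A` the polynomial ring in the parameters
of the plane, the `Ψ j` form a polynomial map from planes to ternary cubics. -/
theorem exists_ternary_cubic_expansion {F : MvPolynomial σ ℂ} (hF : F.IsHomogeneous 3)
    (P U W : σ → A) : ∃ Ψ : Fin 10 → A, ∀ x y z : ℂ,
      aeval (fun i => x • P i + y • U i + z • W i) F = ∑ j, ternaryCubics x y z j • Ψ j := by
  have hF' : F ∈ (homogeneousSubmodule σ ℂ 1) ^ 3 := by
    rw [homogeneousSubmodule_one_pow]; exact hF
  rw [pow_succ, pow_two] at hF'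
  clear hF
  induction hF' using Submodule.mul_induction_on' with
  | mem_mul_mem m hm l hl =>
    induction hm using Submodule.mul_induction_on' with
    | mem_mul_mem p hp q hq =>
      -- These are the monomial coefficients of a product of three linear forms, with those of xyz,
      -- y²z and yz² corrected for the mixed elements of the basis.
      refine ⟨![aeval P p * aeval P q * aeval P l,
        aeval P p * aeval P q * aeval U l + aeval P p * aeval U q * aeval P l +
          aeval U p * aeval P q * aeval P l,
        aeval P p * aeval P q * aeval W l + aeval P p * aeval W q * aeval P l +
          aeval W p * aeval P q * aeval P l,
        (aeval P p * aeval U q * aeval W l + aeval P p * aeval W q * aeval U l +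
          aeval U p * aeval P q * aeval W l + aeval U p * aeval W q * aeval P l +
          aeval W p * aeval P q * aeval U l + aeval W p * aeval U q * aeval P l) -
          aeval U p * aeval U q * aeval U l - aeval W p * aeval W q * aeval W l,
        (aeval U p * aeval U q * aeval W l + aeval U p * aeval W q * aeval U l +
          aeval W p * aeval U q * aeval U l) -
          (aeval P p * aeval W q * aeval W l + aeval W p * aeval P q * aeval W l +
          aeval W p * aeval W q * aeval P l),
        (aeval U p * aeval W q * aeval W l + aeval W p * aeval U q * aeval W l +
          aeval W p * aeval W q * aeval U l) -
          (aeval P p * aeval U q * aeval U l + aeval U p * aeval P q * aeval U l +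
          aeval U p * aeval U q * aeval P l),
        aeval U p * aeval U q * aeval U l,
        aeval P p * aeval W q * aeval W l + aeval W p * aeval P q * aeval W l +
          aeval W p * aeval W q * aeval P l,
        aeval P p * aeval U q * aeval U l + aeval U p * aeval P q * aeval U l +
          aeval U p * aeval U q * aeval P l,
        aeval W p * aeval W q * aeval W l], fun x y z => ?_⟩
      rw [map_mul, map_mul, aeval_linear_combination hp, aeval_linear_combination hq,
        aeval_linear_combination hl]
      simp only [ternaryCubics, Fin.sum_univ_succ, Algebra.smul_def, map_add, map_mul, map_pow,
        Matrix.cons_val_zero, Matrix.cons_val_succ, Fin.sum_univ_zero]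
      ring
    | add p _ q _ hp hq =>
      obtain ⟨Ψ₁, h₁⟩ := hp
      obtain ⟨Ψ₂, h₂⟩ := hq
      refine ⟨Ψ₁ + Ψ₂, fun x y z => ?_⟩
      simp only [add_mul, map_add, h₁, h₂, Pi.add_apply, smul_add, Finset.sum_add_distrib]
  | add p _ q _ hp hq =>
    obtain ⟨Ψ₁, h₁⟩ := hp
    obtain ⟨Ψ₂, h₂⟩ := hq
    refine ⟨Ψ₁ + Ψ₂, fun x y z => ?_⟩
    simp only [map_add, h₁, h₂, Pi.add_apply, smul_add, Finset.sum_add_distrib]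

end Expansion

/-- A cubic form in seven variables that contains the plane spanned by the basis vectors of
indices `0`, `3` and `4`. -/
def modelCubic (v : Fin 7 → ℂ) : ℂ :=
  v 1 * v 0 ^ 2 + v 2 * (v 3 * v 4) + v 5 * (v 3 ^ 2 + v 0 * v 4) + v 6 * (v 4 ^ 2 + v 0 * v 3)

/-- Three vectors spanning a plane near the one contained in the model cubic. -/
def planeFrame {A : Type*} [Zero A] [One A] (a : Fin 10 → A) : Fin 3 → Fin 7 → A :=
  ![![1, a 0, a 3, 0, 0, 0, 0], ![0, a 1, a 4, 1, 0, a 6, a 8], ![0, a 2, a 5, 0, 1, a 7, a 9]]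

/-- The model makes the coefficient map the identity: the products of x² and yz with x, y, z, and of
y² + xz and z² + xy with y, z, form a basis of the ternary cubics. The quadrics multiplied only by y
and z account for the zero entries 5 and 6 of the first frame vector, which stays in the span of the
first three basis vectors. -/
theorem modelCubic_planeFrame (a : Fin 10 → ℂ) (x y z : ℂ) :
    modelCubic (x • planeFrame a 0 + y • planeFrame a 1 + z • planeFrame a 2) =
      ∑ j, ternaryCubics x y z j * a j := by
  simp [modelCubic, planeFrame, ternaryCubics, Fin.sum_univ_succ]
  ring

/-- Only the finitely many eigenvalues of −M have to be avoided. -/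
theorem exists_det_add_scalar_ne_zero {n : ℕ} (M : Matrix (Fin n) (Fin n) ℂ) {δ : ℝ} (hδ : 0 < δ) :
    ∃ ε : ℂ, ‖ε‖ < δ ∧ (M + Matrix.scalar (Fin n) ε).det ≠ 0 := by
  have hne : (-M).charpoly ≠ 0 := (Matrix.charpoly_monic _).ne_zero
  have hinf : (Metric.ball (0 : ℂ) δ).Infinite :=
    infinite_of_mem_nhds 0 (Metric.ball_mem_nhds 0 hδ)
  obtain ⟨ε, hε, hr⟩ := hinf.exists_notMem_finset (-M).charpoly.roots.toFinset
  refine ⟨ε, by simpa using hε, fun h => hr ?_⟩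
  rw [Multiset.mem_toFinset, Polynomial.mem_roots hne, Polynomial.IsRoot, Matrix.eval_charpoly,
    sub_neg_eq_add, add_comm]
  exact h

/-- A small perturbation of any cubic form in seven variables contains a plane that meets the span
of the first three basis vectors. -/
theorem exists_plane_in_perturbation {F : MvPolynomial (Fin 7) ℂ} (hF : F.IsHomogeneous 3)
    {δ : ℝ} (hδ : 0 < δ) :
    ∃ (ε : ℂ) (c a : Fin 10 → ℂ), ‖ε‖ < δ ∧ (∀ j, ‖c j‖ < δ) ∧ ∀ x y z : ℂ,
      eval (x • planeFrame a 0 + y • planeFrame a 1 + z • planeFrame a 2) F +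
        ε * modelCubic (x • planeFrame a 0 + y • planeFrame a 1 + z • planeFrame a 2) =
        ∑ j, ternaryCubics x y z j * c j := by
  obtain ⟨Ψ, hΨ⟩ := exists_ternary_cubic_expansion hF
    (planeFrame (fun j => (X j : MvPolynomial (Fin 10) ℂ)) 0)
    (planeFrame (fun j => (X j : MvPolynomial (Fin 10) ℂ)) 1)
    (planeFrame (fun j => (X j : MvPolynomial (Fin 10) ℂ)) 2)
  -- For the perturbed cubic the coefficient map is Ψ + ε·id, with derivative at 0 the Jacobian of Ψ
  -- plus a scalar matrix. A small ε makes it invertible, whatever the cubic.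
  obtain ⟨ε, hε, hdet⟩ := exists_det_add_scalar_ne_zero
    (Matrix.of fun i j => eval 0 (pderiv i (Ψ j))) hδ
  obtain ⟨a, ha⟩ := exists_small_value_of_det_ne_zero (fun j => Ψ j + C ε * X j) (by
    convert hdet using 2
    ext i j
    by_cases h : i = j
    · subst h; simp
    · simp [h, Ne.symm h, Pi.single_apply]) hδ
  refine ⟨ε, fun j => eval a (Ψ j + C ε * X j), a, hε, ha, fun x y z => ?_⟩
  have h1 := congrArg (eval a) (hΨ x y z)
  have hframe : ∀ k i, eval a (planeFrame (fun j => (X j : MvPolynomial (Fin 10) ℂ)) k i) =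
      planeFrame a k i := by
    intro k i
    fin_cases k <;> fin_cases i <;> simp [planeFrame]
  have h2 : eval a (aeval (fun i => x • planeFrame (fun j => (X j : MvPolynomial (Fin 10) ℂ)) 0 i +
      y • planeFrame (fun j => (X j : MvPolynomial (Fin 10) ℂ)) 1 i +
      z • planeFrame (fun j => (X j : MvPolynomial (Fin 10) ℂ)) 2 i) F) =
      eval (x • planeFrame a 0 + y • planeFrame a 1 + z • planeFrame a 2) F := by
    have : ((aeval a : MvPolynomial (Fin 10) ℂ →ₐ[ℂ] ℂ).comp
        (aeval (fun i => x • planeFrame (fun j => (X j : MvPolynomial (Fin 10) ℂ)) 0 i +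
      y • planeFrame (fun j => (X j : MvPolynomial (Fin 10) ℂ)) 1 i +
      z • planeFrame (fun j => (X j : MvPolynomial (Fin 10) ℂ)) 2 i))) =
      aeval (x • planeFrame a 0 + y • planeFrame a 1 + z • planeFrame a 2) := by
      ext i
      simp [aeval_eq_eval, smul_eval, hframe]
    exact DFunLike.congr_fun this F
  rw [← h2, h1, modelCubic_planeFrame, map_sum, Finset.mul_sum, ← Finset.sum_add_distrib]
  refine Finset.sum_congr rfl fun j _ => ?_
  simp only [smul_eval, map_add, map_mul, eval_C, eval_X]
  ring

theorem linearIndependent_planeFrame (a : Fin 10 → ℂ) : LinearIndependent ℂ (planeFrame a) := by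
  rw [Fintype.linearIndependent_iff]
  intro g hg
  have h0 := congrFun hg 0
  have h3 := congrFun hg 3
  have h4 := congrFun hg 4
  simp [planeFrame, Fin.sum_univ_succ] at h0 h3 h4
  intro i
  fin_cases i
  · exact h0
  · exact h3
  · exact h4

open EuclideanSpace in
/-- An orthonormal basis of the plane spanned by a plane frame. -/
theorem exists_orthonormal_planeFrame (a : Fin 10 → ℂ) :
    ∃ e : Fin 3 → EuclideanSpace ℂ (Fin 7), Orthonormal ℂ e ∧
      (∀ i : Fin 7, 3 ≤ i → e 0 i = 0) ∧
      ∀ t : Fin 3 → ℂ, ∃ x y z : ℂ, (fun i => (∑ k, t k • e k) i) =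
        x • planeFrame a 0 + y • planeFrame a 1 + z • planeFrame a 2 := by
  let f : Fin 3 → EuclideanSpace ℂ (Fin 7) := fun k => WithLp.toLp 2 (planeFrame a k)
  have hf : LinearIndependent ℂ f :=
    (linearIndependent_planeFrame a).map' (WithLp.linearEquiv 2 ℂ (Fin 7 → ℂ)).symm.toLinearMap
      (LinearEquiv.ker _)
  refine ⟨InnerProductSpace.gramSchmidtNormed ℂ f,
    InnerProductSpace.gramSchmidtNormed_orthonormal hf, fun i hi => ?_, fun t => ?_⟩
  -- Gram–Schmidt only rescales the first vector, so the incidence with the fixed plane survives.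
  · have h0 : InnerProductSpace.gramSchmidt ℂ f 0 = f 0 := InnerProductSpace.gramSchmidt_bot ℂ f
    rw [InnerProductSpace.gramSchmidtNormed, h0]
    have : planeFrame a 0 i = 0 := by
      fin_cases i <;> simp [planeFrame] at hi ⊢
    simp [f, this]
  · have hmem : ∑ k, t k • InnerProductSpace.gramSchmidtNormed ℂ f k ∈
        Submodule.span ℂ (Set.range f) := by
      rw [← InnerProductSpace.span_gramSchmidt, ← InnerProductSpace.span_gramSchmidtNormed_range]
      exact Submodule.sum_mem _ fun k _ => Submodule.smul_mem _ _ (Submodule.subset_span ⟨k, rfl⟩)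
    obtain ⟨c, hc⟩ := (Submodule.mem_span_range_iff_exists_fun ℂ).1 hmem
    refine ⟨c 0, c 1, c 2, ?_⟩
    ext i
    rw [← hc]
    simp [Fin.sum_univ_succ, f]
    ring

/-- Every cubic hypersurface in `ℙ⁶` contains a plane that meets the span of the first three basis
vectors. -/
theorem exists_plane_in_cubic {F : MvPolynomial (Fin 7) ℂ} (hF : F.IsHomogeneous 3) :
    ∃ e : Fin 3 → Fin 7 → ℂ, LinearIndependent ℂ e ∧ (∀ i : Fin 7, 3 ≤ i → e 0 i = 0) ∧
      ∀ t : Fin 3 → ℂ, eval (∑ k, t k • e k) F = 0 := by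
  -- The frame parameters may be unbounded as the perturbation shrinks, so compactness is applied to
  -- orthonormal frames of the planes. Coordinates 0, 3, 4 recover the x, y, z of a combination of
  -- frame vectors.
  have key : ∀ n : ℕ, ∃ (ε : ℂ) (c : Fin 10 → ℂ) (e : Fin 3 → EuclideanSpace ℂ (Fin 7)),
      ‖ε‖ < 1 / ((n : ℝ) + 1) ∧ (∀ j, ‖c j‖ < 1 / ((n : ℝ) + 1)) ∧ Orthonormal ℂ e ∧
      (∀ i : Fin 7, 3 ≤ i → e 0 i = 0) ∧ ∀ t : Fin 3 → ℂ,
        eval (∑ k, t k • e k).ofLp F + ε * modelCubic (∑ k, t k • e k).ofLp =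
        ∑ j, ternaryCubics ((∑ k, t k • e k).ofLp 0) ((∑ k, t k • e k).ofLp 3)
          ((∑ k, t k • e k).ofLp 4) j * c j := by
    intro n
    obtain ⟨ε, c, a, hε, hc, hF'⟩ := exists_plane_in_perturbation hF
      (Nat.one_div_pos_of_nat (α := ℝ) (n := n))
    obtain ⟨e, he, he0, hspan⟩ := exists_orthonormal_planeFrame a
    refine ⟨ε, c, e, hε, hc, he, he0, fun t => ?_⟩
    obtain ⟨x, y, z, hxyz⟩ := hspan t
    have h1 := hF' x y z
    have h2 : (∑ k, t k • e k).ofLp =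
        x • planeFrame a 0 + y • planeFrame a 1 + z • planeFrame a 2 := hxyz
    rw [h2, h1]
    simp [planeFrame]
  choose ε c e hε hc he he0 hF' using key
  have hmem : ∀ n, e n ∈ Set.pi Set.univ
      (fun _ : Fin 3 => Metric.closedBall (0 : EuclideanSpace ℂ (Fin 7)) 1) := by
    intro n k _
    rw [mem_closedBall_zero_iff, (he n).1 k]
  obtain ⟨e', -, φ, hφ, hlim⟩ := (isCompact_univ_pi fun _ : Fin 3 =>
    isCompact_closedBall (0 : EuclideanSpace ℂ (Fin 7)) 1).tendsto_subseq hmem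
  have hlimk : ∀ k, Filter.Tendsto (fun n => e (φ n) k) Filter.atTop (nhds (e' k)) :=
    fun k => (continuous_apply k).continuousAt.tendsto.comp hlim
  have hlimi : ∀ k i, Filter.Tendsto (fun n => (e (φ n) k).ofLp i) Filter.atTop
      (nhds ((e' k).ofLp i)) := fun k i =>
    ((EuclideanSpace.proj (𝕜 := ℂ) i).continuous.tendsto (e' k)).comp (hlimk k)
  have hsmall : Filter.Tendsto (fun n => 1 / ((φ n : ℝ) + 1)) Filter.atTop (nhds 0) :=
    tendsto_one_div_add_atTop_nhds_zero_nat.comp hφ.tendsto_atTop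
  have hεlim : Filter.Tendsto (fun n => ε (φ n)) Filter.atTop (nhds 0) :=
    squeeze_zero_norm (fun n => (hε _).le) hsmall
  have hclim : ∀ j, Filter.Tendsto (fun n => c (φ n) j) Filter.atTop (nhds 0) := fun j =>
    squeeze_zero_norm (fun n => (hc _ j).le) hsmall
  have horth : Orthonormal ℂ e' := by
    rw [orthonormal_iff_ite]
    intro i j
    have h1 : Filter.Tendsto (fun n => inner ℂ (e (φ n) i) (e (φ n) j)) Filter.atTop
        (nhds (inner ℂ (e' i) (e' j))) := (hlimk i).inner (hlimk j)
    refine tendsto_nhds_unique h1 ?_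
    simp_rw [fun n => (orthonormal_iff_ite.1 (he (φ n))) i j]
    exact tendsto_const_nhds
  refine ⟨fun k => (e' k).ofLp, ?_, fun i hi => ?_, fun t => ?_⟩
  · exact horth.linearIndependent.map' (WithLp.linearEquiv 2 ℂ (Fin 7 → ℂ)).toLinearMap
      (LinearEquiv.ker _)
  · refine tendsto_nhds_unique (hlimi 0 i) ?_
    simp_rw [fun n => he0 (φ n) i hi]
    exact tendsto_const_nhds
  · have hv : Filter.Tendsto (fun n => (∑ k, t k • e (φ n) k).ofLp) Filter.atTop
        (nhds (∑ k, t k • (e' k).ofLp)) := by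
      rw [tendsto_pi_nhds]
      intro i
      have : Filter.Tendsto (fun n => ∑ k, t k * (e (φ n) k).ofLp i) Filter.atTop
          (nhds (∑ k, t k * (e' k).ofLp i)) :=
        tendsto_finsetSum _ fun k _ => (hlimi k i).const_mul _
      simpa using this
    have hL : Filter.Tendsto (fun n => eval (∑ k, t k • e (φ n) k).ofLp F +
        ε (φ n) * modelCubic (∑ k, t k • e (φ n) k).ofLp) Filter.atTop
        (nhds (eval (∑ k, t k • (e' k).ofLp) F + 0 * modelCubic (∑ k, t k • (e' k).ofLp))) := by
      refine (((MvPolynomial.continuous_eval F).tendsto _).comp hv).add (hεlim.mul ?_)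
      have hcont : Continuous modelCubic := by unfold modelCubic; fun_prop
      exact (hcont.tendsto _).comp hv
    have hR : Filter.Tendsto (fun n => ∑ j, ternaryCubics ((∑ k, t k • e (φ n) k).ofLp 0)
        ((∑ k, t k • e (φ n) k).ofLp 3) ((∑ k, t k • e (φ n) k).ofLp 4) j * c (φ n) j)
        Filter.atTop (nhds (∑ j, ternaryCubics ((∑ k, t k • (e' k).ofLp) 0)
        ((∑ k, t k • (e' k).ofLp) 3) ((∑ k, t k • (e' k).ofLp) 4) j * 0)) := by
      refine tendsto_finsetSum _ fun j _ => Filter.Tendsto.mul ?_ (hclim j)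
      have hcont : Continuous fun v : Fin 7 → ℂ => ternaryCubics (v 0) (v 3) (v 4) j := by
        unfold ternaryCubics
        fin_cases j <;> simp <;> fun_prop
      exact (hcont.tendsto _).comp hv
    simp_rw [fun n => hF' (φ n) t] at hL
    have := tendsto_nhds_unique hL hR
    simpa using this

/-! ### Derivations of ℂ as tangent vectors. -/

section Derivations

open TensorProduct

/-- A derivation extends uniquely along a formally étale algebra. -/
theorem exists_derivation_extension {k S T : Type*} [CommRing k] [CommRing S] [CommRing T]
    [Algebra k S] [Algebra k T] [Algebra S T] [IsScalarTower k S T] [Algebra.FormallyEtale S T]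
    (d : Derivation k S T) : ∃ D : Derivation k T T, ∀ s, D (algebraMap S T s) = d s := by
  let f : T ⊗[S] Ω[S⁄k] →ₗ[T] T := LinearMap.liftBaseChange T d.liftKaehlerDifferential
  let e := KaehlerDifferential.tensorKaehlerEquivOfFormallyEtale k S T
  refine ⟨(f ∘ₗ e.symm.toLinearMap).compDer (KaehlerDifferential.D k T), fun s => ?_⟩
  change f (e.symm (KaehlerDifferential.D k T (algebraMap S T s))) = d s
  rw [KaehlerDifferential.tensorKaehlerEquivOfFormallyEtale_symm_D_algebraMap]
  simp [f]

/-- A domain in characteristic zero that is algebraic over the polynomial ring on a transcendence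
basis has derivations dual to that basis. -/
theorem exists_derivation_of_isTranscendenceBasis {k K ι : Type*} [Field k] [Field K] [CharZero k]
    [Algebra k K] {v : ι → K} (hv : IsTranscendenceBasis k v) (w : ι → K) :
    ∃ D : Derivation k K K, ∀ i, D (v i) = w i := by
  -- In characteristic zero `K` is separable algebraic, hence formally étale, over the fraction
  -- field of the polynomial ring on the transcendence basis. That fraction field is formally étale
  -- over the polynomial ring, so a derivation prescribed on the variables extends.
  let _ : Algebra (MvPolynomial ι k) K := (aeval v : MvPolynomial ι k →ₐ[k] K).toRingHom.toAlgebra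
  have hmap : ∀ p : MvPolynomial ι k, algebraMap (MvPolynomial ι k) K p = aeval v p := fun p => rfl
  have : IsScalarTower k (MvPolynomial ι k) K :=
    IsScalarTower.of_algebraMap_eq fun c => ((aeval v).commutes c).symm
  have hinj : Function.Injective (algebraMap (MvPolynomial ι k) K) := hv.1
  have : FaithfulSMul (MvPolynomial ι k) K := (faithfulSMul_iff_algebraMap_injective _ _).2 hinj
  let _ : Algebra (FractionRing (MvPolynomial ι k)) K := FractionRing.liftAlgebra _ K
  have : IsScalarTower (MvPolynomial ι k) (FractionRing (MvPolynomial ι k)) K :=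
    FractionRing.isScalarTower_liftAlgebra _ K
  have halg : Algebra.IsAlgebraic (MvPolynomial ι k) K := by
    refine ⟨fun x => ?_⟩
    have hx := hv.isAlgebraic.isAlgebraic x
    obtain ⟨p, hp0, hp⟩ := hx
    let e := hv.1.aevalEquiv
    refine ⟨p.map e.symm.toRingEquiv.toRingHom, ?_, ?_⟩
    · exact (Polynomial.map_ne_zero_iff e.symm.injective).2 hp0
    · have hcomp : (algebraMap (MvPolynomial ι k) K).comp e.symm.toRingEquiv.toRingHom =
          algebraMap (Algebra.adjoin k (Set.range v)) K := by
        refine RingHom.ext fun y => ?_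
        obtain ⟨p, rfl⟩ := e.surjective y
        rw [AlgebraicIndependent.algebraMap_aevalEquiv]
        exact congrArg (aeval v) (e.symm_apply_apply p)
      rw [Polynomial.aeval_def, Polynomial.eval₂_map, hcomp]
      exact hp
  have : Algebra.IsAlgebraic (FractionRing (MvPolynomial ι k)) K :=
    (IsFractionRing.comap_isAlgebraic_iff (A := MvPolynomial ι k)).1 halg
  have : CharZero (FractionRing (MvPolynomial ι k)) :=
    charZero_of_injective_algebraMap
      (R := k) (FaithfulSMul.algebraMap_injective k (FractionRing (MvPolynomial ι k)))
  have : Algebra.FormallyEtale (FractionRing (MvPolynomial ι k)) K :=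
    Algebra.FormallyEtale.of_isSeparable _ _
  have : Algebra.FormallyEtale (MvPolynomial ι k) (FractionRing (MvPolynomial ι k)) :=
    Algebra.FormallyEtale.of_isLocalization (nonZeroDivisors _)
  have : Algebra.FormallyEtale (MvPolynomial ι k) K :=
    Algebra.FormallyEtale.comp _ (FractionRing (MvPolynomial ι k)) _
  obtain ⟨D, hD⟩ := exists_derivation_extension (mkDerivation k w : Derivation k _ K)
  refine ⟨D, fun i => ?_⟩
  have := hD (X i)
  rwa [hmap, aeval_X, mkDerivation_X] at this

/-- Complex numbers that are independent over a given countable set of constants, with derivations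
of `ℂ` dual to them that vanish on the constants. -/
theorem exists_dual_derivations {s : Set ℂ} (hs : s.Countable) {ι : Type} [Finite ι]
    [DecidableEq ι] :
    ∃ (k : Subfield ℂ) (c : ι → ℂ) (D : ι → Derivation k ℂ ℂ), s ⊆ k ∧
      ∀ i j, D i (c j) = if i = j then 1 else 0 := by
  obtain ⟨B, hB⟩ := exists_isTranscendenceBasis (Subfield.closure s) ℂ
  have hk : Cardinal.mk (Subfield.closure s) ≤ Cardinal.aleph0 :=
    (Subfield.cardinalMk_closure_le_max s).trans (max_le (Cardinal.mk_le_aleph0_iff.2 hs) le_rfl)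
  -- The field generated by a countable set is countable, so a finite transcendence basis would make
  -- ℂ countable.
  have hBinf : Infinite B := by
    by_contra hfin
    rw [not_infinite_iff_finite] at hfin
    have h1 := IsAlgClosed.cardinal_le_max_transcendence_basis' _ hB
    have h2 : Cardinal.mk B ≤ Cardinal.aleph0 := Cardinal.mk_le_aleph0
    have h3 := h1.trans (max_le (max_le hk h2) le_rfl)
    rw [Cardinal.mk_complex] at h3
    exact absurd h3 (not_le.2 Cardinal.aleph0_lt_continuum)
  obtain ⟨n, ⟨e⟩⟩ := Finite.exists_equiv_fin ι
  let emb : ι → B := fun i => Infinite.natEmbedding B (e i)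
  have hemb : Function.Injective emb := fun i j h =>
    e.injective (Fin.val_injective ((Infinite.natEmbedding B).injective h))
  classical
  choose D hD using fun i => exists_derivation_of_isTranscendenceBasis hB
    (fun b => if emb i = b then (1 : ℂ) else 0)
  refine ⟨Subfield.closure s, fun i => emb i, D, Subfield.subset_closure, fun i j => ?_⟩
  rw [hD]
  simp [hemb.eq_iff]

/-- A derivation that is trivial on the coefficients moves only the point. An algebraic condition on
a point is thus differentiated as if the point varied in a family. -/
theorem derivation_eval {σ : Type*} [Fintype σ] {k : Subfield ℂ} (D : Derivation k ℂ ℂ)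
    {p : MvPolynomial σ ℂ} (hp : ∀ m, coeff m p ∈ k) (x : σ → ℂ) :
    D (eval x p) = ∑ i, eval x (pderiv i p) * D (x i) := by
  classical
  obtain ⟨p, rfl⟩ : ∃ p₀ : MvPolynomial σ k, map (algebraMap k ℂ) p₀ = p := by
    have : p ∈ Set.range (map (σ := σ) (algebraMap k ℂ)) := by
      rw [mem_range_map_iff_coeffs_subset]
      intro c hc
      obtain ⟨m, -, rfl⟩ := mem_coeffs_iff.1 hc
      exact ⟨⟨_, hp m⟩, rfl⟩
    exact this
  clear hp
  induction p using MvPolynomial.induction_on with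
  | C a =>
    have : D (algebraMap k ℂ a) = 0 := D.map_algebraMap a
    simp [this]
  | add p q hp hq => simp only [map_add, hp, hq, add_mul, Finset.sum_add_distrib]
  | mul_X p j hp =>
    simp only [map_mul, map_X, eval_X, Derivation.leibniz, hp, pderiv_X, map_add, smul_eq_mul,
      add_mul, Finset.sum_add_distrib]
    congr 1
    · rw [Finset.sum_eq_single j]
      · simp
      · intro i _ hi
        simp [hi.symm]
      · simp
    · rw [Finset.mul_sum]
      exact Finset.sum_congr rfl fun i _ => by ring

end Derivations

/-! ### The Jacobian criterion on generators. -/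

section Smoothness

theorem gradientAt_mem_span {c : ℕ} {fs : Fin c → CoordRing} {x : Fin 6 → ℂ}
    (hx : ∀ i, eval x (fs i) = 0) {p : CoordRing} (hp : p ∈ Ideal.span (Set.range fs)) :
    gradientAt p x ∈ Submodule.span ℂ (Set.range fun i => gradientAt (fs i) x) := by
  obtain ⟨a, rfl⟩ := (Ideal.mem_span_range_iff_exists_fun).1 hp
  rw [Submodule.mem_span_range_iff_exists_fun]
  refine ⟨fun i => eval x (a i), ?_⟩
  ext j
  simp [gradientAt, hx]

/-- Smoothness in terms of the gradients of generators of the ideal. -/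
theorem isSmoothOfCodim_span_range_iff {c : ℕ} (fs : Fin c → CoordRing) :
    IsSmoothOfCodim (Ideal.span (Set.range fs)) c ↔ ∀ x : Fin 6 → ℂ, x ≠ 0 →
      (∀ i, eval x (fs i) = 0) → LinearIndependent ℂ fun i => gradientAt (fs i) x := by
  have hzero : ∀ x : Fin 6 → ℂ, (∀ p ∈ Ideal.span (Set.range fs), eval x p = 0) ↔
      ∀ i, eval x (fs i) = 0 := by
    intro x
    constructor
    · exact fun h i => h _ (Ideal.subset_span ⟨i, rfl⟩)
    · intro h p hp
      obtain ⟨a, rfl⟩ := (Ideal.mem_span_range_iff_exists_fun).1 hp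
      simp [h]
  have hspan : ∀ x : Fin 6 → ℂ, (∀ i, eval x (fs i) = 0) →
      Submodule.span ℂ {v : Fin 6 → ℂ | ∃ p ∈ Ideal.span (Set.range fs), v = gradientAt p x} =
      Submodule.span ℂ (Set.range fun i => gradientAt (fs i) x) := by
    intro x hx
    apply le_antisymm
    · rw [Submodule.span_le]
      rintro _ ⟨p, hp, rfl⟩
      exact gradientAt_mem_span hx hp
    · rw [Submodule.span_le]
      rintro _ ⟨i, rfl⟩
      exact Submodule.subset_span ⟨fs i, Ideal.subset_span ⟨i, rfl⟩, rfl⟩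
  unfold IsSmoothOfCodim
  refine forall₂_congr fun x hx0 => ?_
  rw [hzero x]
  refine forall_congr' fun hx => ?_
  rw [hspan x hx, linearIndependent_iff_card_eq_finrank_span, Fintype.card_fin, eq_comm]
  rfl

/-- The Jacobian criterion for the intersection of two hypersurfaces. -/
theorem smooth_intersectionIdeal_iff {q f : CoordRing} :
    IsSmoothOfCodim (intersectionIdeal q f) 2 ↔ ∀ x : Fin 6 → ℂ, x ≠ 0 → eval x q = 0 →
      eval x f = 0 → ∀ a b : ℂ, a • gradientAt q x + b • gradientAt f x = 0 → a = 0 ∧ b = 0 := by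
  have h : intersectionIdeal q f = Ideal.span (Set.range ![q, f]) := by
    rw [intersectionIdeal, Matrix.range_cons, Matrix.range_cons, Matrix.range_empty,
      Set.union_empty, Set.singleton_union]
  rw [h, isSmoothOfCodim_span_range_iff]
  refine forall₂_congr fun x _ => ?_
  simp only [Fin.forall_fin_two, Matrix.cons_val_zero, Matrix.cons_val_one, and_imp]
  refine forall₂_congr fun _ _ => ?_
  have h2 : (fun i => gradientAt (![q, f] i) x) = ![gradientAt q x, gradientAt f x] := by
    ext i : 1
    fin_cases i <;> rfl
  rw [h2, LinearIndependent.pair_iff]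

end Smoothness

/-- Linearly independent vectors can be completed to a basis with the expected index set. -/
theorem exists_basis_extending {m n : ℕ} (h : m ≤ n) {v : Fin m → Fin n → ℂ}
    (hv : LinearIndependent ℂ v) :
    ∃ b : Module.Basis (Fin n) ℂ (Fin n → ℂ), ∀ i, b (Fin.castLE h i) = v i := by
  let b₀ := Module.Basis.sumExtend hv
  have : Finite (Fin m ⊕ Module.Basis.sumExtendIndex hv) := Module.Finite.finite_basis b₀
  have : Finite (Module.Basis.sumExtendIndex hv) :=
    Finite.of_injective (Sum.inr : _ → Fin m ⊕ Module.Basis.sumExtendIndex hv) Sum.inr_injective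
  have hcard : Nat.card (Module.Basis.sumExtendIndex hv) = n - m := by
    have h1 := Module.finrank_eq_nat_card_basis b₀
    rw [Nat.card_sum, Nat.card_fin, Module.finrank_fin_fun] at h1
    omega
  let e : Module.Basis.sumExtendIndex hv ≃ Fin (n - m) := Finite.equivFinOfCardEq hcard
  let e' : Fin m ⊕ Module.Basis.sumExtendIndex hv ≃ Fin n :=
    ((Equiv.refl _).sumCongr e).trans (finSumFinEquiv.trans (finCongr (by omega)))
  refine ⟨b₀.reindex e', fun i => ?_⟩
  have h2 : e'.symm (Fin.castLE h i) = Sum.inl i := by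
    rw [Equiv.symm_apply_eq]
    ext
    simp [e']
  rw [Module.Basis.reindex_apply, h2]
  simp only [b₀, Module.Basis.sumExtend, Module.Basis.coe_reindex, Function.comp_apply,
    Module.Basis.coe_extend]
  rfl

/-! ### Sections of the normal bundle of a line. -/

section Plucker

/-- Two linear forms and two quadratic forms on a pencil: the rank two kernel bundle of a nowhere
degenerate pair consisting of a linear and a quadratic family of functionals on a four-dimensional
space has no two sections of degree one that are generically independent. -/
theorem no_independent_linear_sections (a c : Fin 4 → Polynomial ℂ) (μ ν : Fin 4 → ℂ)
    (ha : ∀ k, (a k).natDegree ≤ 1) (hc : ∀ k, (c k).natDegree ≤ 2)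
    (ha₁ : a 0 * Polynomial.X + ∑ k, a k * Polynomial.C (μ k) = 0)
    (ha₂ : a 1 * Polynomial.X + ∑ k, a k * Polynomial.C (ν k) = 0)
    (hc₁ : c 0 * Polynomial.X + ∑ k, c k * Polynomial.C (μ k) = 0)
    (hc₂ : c 1 * Polynomial.X + ∑ k, c k * Polynomial.C (ν k) = 0)
    (hrank : ∀ s : ℂ, ∃ i j, (a i).eval s * (c j).eval s - (a j).eval s * (c i).eval s ≠ 0)
    (hlead : (a 2).coeff 1 * (c 3).coeff 2 - (a 3).coeff 1 * (c 2).coeff 2 ≠ 0) : False := by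
  -- The two sections X e₀ + μ and X e₁ + ν lie in the kernel of (a, c). `P` is their minor in
  -- coordinates 0 and 1, and `Ω` is the complementary minor of (a, c), of degree exactly 3. Plücker
  -- duality makes `Ω` divide `P` times every minor of (a, c); as these have no common zero, `Ω`
  -- divides `P`, which has degree 2.
  set Ω : Polynomial ℂ := a 2 * c 3 - a 3 * c 2 with hΩ
  set P : Polynomial ℂ :=
    (Polynomial.X + Polynomial.C (μ 0)) * (Polynomial.X + Polynomial.C (ν 1)) -
      Polynomial.C (μ 1) * Polynomial.C (ν 0) with hP
  have hΩ3 : Ω.coeff 3 ≠ 0 := by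
    have h1 : (a 2 * c 3).coeff 3 = (a 2).coeff 1 * (c 3).coeff 2 :=
      Polynomial.coeff_mul_add_eq_of_natDegree_le (ha 2) (hc 3)
    have h2 : (a 3 * c 2).coeff 3 = (a 3).coeff 1 * (c 2).coeff 2 :=
      Polynomial.coeff_mul_add_eq_of_natDegree_le (ha 3) (hc 2)
    rw [hΩ, Polynomial.coeff_sub, h1, h2]
    exact hlead
  have hPdeg : P.natDegree = 2 := by
    rw [hP]
    compute_degree!
  have hP0 : P ≠ 0 := by
    intro h
    rw [h] at hPdeg
    simp at hPdeg
  have hnd : ¬ Ω ∣ P := by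
    intro h
    have h1 := Polynomial.natDegree_le_of_dvd h hP0
    have h2 := Polynomial.le_natDegree_of_ne_zero hΩ3
    omega
  simp only [Fin.sum_univ_four] at ha₁ ha₂ hc₁ hc₂
  have key : ∀ i j, Ω ∣ P * (a i * c j - a j * c i) := by
    have h02 : Ω ∣ P * (a 0 * c 2 - a 2 * c 0) := by
      refine ⟨Polynomial.C (μ 3) * (Polynomial.X + Polynomial.C (ν 1)) -
        Polynomial.C (ν 3) * Polynomial.C (μ 1), ?_⟩
      rw [hΩ, hP]
      linear_combination (Polynomial.X + Polynomial.C (ν 1)) * (c 2 * ha₁ - a 2 * hc₁) -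
        Polynomial.C (μ 1) * (c 2 * ha₂ - a 2 * hc₂)
    have h12 : Ω ∣ P * (a 1 * c 2 - a 2 * c 1) := by
      refine ⟨Polynomial.C (ν 3) * (Polynomial.X + Polynomial.C (μ 0)) -
        Polynomial.C (μ 3) * Polynomial.C (ν 0), ?_⟩
      rw [hΩ, hP]
      linear_combination (Polynomial.X + Polynomial.C (μ 0)) * (c 2 * ha₂ - a 2 * hc₂) -
        Polynomial.C (ν 0) * (c 2 * ha₁ - a 2 * hc₁)
    have h03 : Ω ∣ P * (a 0 * c 3 - a 3 * c 0) := by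
      refine ⟨-(Polynomial.C (μ 2) * (Polynomial.X + Polynomial.C (ν 1)) -
        Polynomial.C (ν 2) * Polynomial.C (μ 1)), ?_⟩
      rw [hΩ, hP]
      linear_combination (Polynomial.X + Polynomial.C (ν 1)) * (c 3 * ha₁ - a 3 * hc₁) -
        Polynomial.C (μ 1) * (c 3 * ha₂ - a 3 * hc₂)
    have h13 : Ω ∣ P * (a 1 * c 3 - a 3 * c 1) := by
      refine ⟨-(Polynomial.C (ν 2) * (Polynomial.X + Polynomial.C (μ 0)) -
        Polynomial.C (μ 2) * Polynomial.C (ν 0)), ?_⟩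
      rw [hΩ, hP]
      linear_combination (Polynomial.X + Polynomial.C (μ 0)) * (c 3 * ha₂ - a 3 * hc₂) -
        Polynomial.C (ν 0) * (c 3 * ha₁ - a 3 * hc₁)
    have h23 : Ω ∣ P * (a 2 * c 3 - a 3 * c 2) := ⟨P, by rw [hΩ]; ring⟩
    have h01 : Ω ∣ P * (a 0 * c 1 - a 1 * c 0) := by
      refine ⟨Polynomial.C (μ 2) * Polynomial.C (ν 3) - Polynomial.C (μ 3) * Polynomial.C (ν 2), ?_⟩
      rw [hΩ, hP]
      linear_combination
        (c 0 * Polynomial.C (ν 0) + c 1 * (Polynomial.X + Polynomial.C (ν 1))) * ha₁ -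
        (a 2 * Polynomial.C (μ 2) + a 3 * Polynomial.C (μ 3)) * hc₂ -
        (c 0 * (Polynomial.X + Polynomial.C (μ 0)) + c 1 * Polynomial.C (μ 1)) * ha₂ +
        (a 2 * Polynomial.C (ν 2) + a 3 * Polynomial.C (ν 3)) * hc₁
    have hsymm : ∀ i j, Ω ∣ P * (a i * c j - a j * c i) → Ω ∣ P * (a j * c i - a i * c j) := by
      intro i j h
      have : P * (a j * c i - a i * c j) = -(P * (a i * c j - a j * c i)) := by ring
      rw [this]
      exact (dvd_neg).2 h
    have hdiag : ∀ i, Ω ∣ P * (a i * c i - a i * c i) := by intro i; simp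
    intro i j
    fin_cases i <;> fin_cases j
    · exact hdiag 0
    · exact h01
    · exact h02
    · exact h03
    · exact hsymm _ _ h01
    · exact hdiag 1
    · exact h12
    · exact h13
    · exact hsymm _ _ h02
    · exact hsymm _ _ h12
    · exact hdiag 2
    · exact h23
    · exact hsymm _ _ h03
    · exact hsymm _ _ h13
    · exact hsymm _ _ h23
    · exact hdiag 3
  -- This ideal contains all minors. If proper, it lies in the maximal ideal of a point `s` where
  -- all minors vanish, which the rank hypothesis forbids.
  let I : Ideal (Polynomial ℂ) := (Ideal.span {Ω}).colon {P}
  have hI : ∀ r, r ∈ I ↔ Ω ∣ P * r := by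
    intro r
    rw [Submodule.mem_colon_singleton, smul_eq_mul, Ideal.mem_span_singleton, mul_comm]
  by_cases htop : I = ⊤
  · have := (hI 1).1 (by rw [htop]; trivial)
    rw [mul_one] at this
    exact hnd this
  · obtain ⟨M, hM, hIM⟩ := Ideal.exists_le_maximal I htop
    obtain ⟨g, hg⟩ := (IsPrincipalIdealRing.principal M).principal
    have hg1 : ¬ IsUnit g := fun h => hM.ne_top (by
      rw [hg]; exact Ideal.span_singleton_eq_top.2 h)
    obtain ⟨s, hs⟩ : ∃ s, g.IsRoot s := by
      refine IsAlgClosed.exists_root g fun h0 => ?_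
      by_cases hg0 : g = 0
      · have hΩM : Ω ∈ M := hIM ((hI Ω).2 (Dvd.intro_left P rfl))
        rw [hg, hg0] at hΩM
        have : Ω = 0 := by simpa using hΩM
        rw [this] at hΩ3
        simp at hΩ3
      · exact hg1 (Polynomial.isUnit_iff_degree_eq_zero.2 h0)
    obtain ⟨i, j, hij⟩ := hrank s
    have hmem : a i * c j - a j * c i ∈ M := hIM ((hI _).2 (key i j))
    rw [hg] at hmem
    obtain ⟨r, hr⟩ := Ideal.mem_span_singleton'.1 hmem
    apply hij
    rw [← Polynomial.eval_mul, ← Polynomial.eval_mul, ← Polynomial.eval_sub, ← hr,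
      Polynomial.eval_mul, hs.eq_zero, mul_zero]

end Plucker

/-! ### Restriction to a line and first-order deformations. -/

section Lines

/-- Restriction of a polynomial to the affine line `s ↦ s z + y`. -/
def restrictToLine {n : ℕ} (z y : Fin n → ℂ) : MvPolynomial (Fin n) ℂ →ₐ[ℂ] Polynomial ℂ :=
  aeval fun j => Polynomial.C (z j) * Polynomial.X + Polynomial.C (y j)

theorem eval_restrictToLine {n : ℕ} (z y : Fin n → ℂ) (p : MvPolynomial (Fin n) ℂ) (s : ℂ) :
    (restrictToLine z y p).eval s = eval (s • z + y) p := by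
  have : (Polynomial.aeval s).comp (restrictToLine z y) =
      (aeval (s • z + y) : MvPolynomial (Fin n) ℂ →ₐ[ℂ] ℂ) := by
    ext j
    simp [restrictToLine]
    ring
  have h := DFunLike.congr_fun this p
  simpa [aeval_eq_eval, Polynomial.aeval_def] using h

/-- The coefficient in degree `d` is the value at `z`, the point at infinity of the affine line. -/
theorem restrictToLine_degree {n : ℕ} (z y : Fin n → ℂ) {d : ℕ} {p : MvPolynomial (Fin n) ℂ}
    (hp : p.IsHomogeneous d) :
    (restrictToLine z y p).natDegree ≤ d ∧ (restrictToLine z y p).coeff d = eval z p := by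
  have hlin : ∀ l ∈ homogeneousSubmodule (Fin n) ℂ 1, (restrictToLine z y l).natDegree ≤ 1 ∧
      (restrictToLine z y l).coeff 1 = eval z l := by
    intro l hl
    rw [homogeneousSubmodule_one_eq_span_X] at hl
    induction hl using Submodule.span_induction with
    | mem l h =>
      obtain ⟨i, rfl⟩ := h
      simp only [restrictToLine, aeval_X, eval_X]
      constructor
      · compute_degree
      · simp
    | zero => simp
    | add p q _ _ hp hq =>
      refine ⟨?_, ?_⟩
      · rw [map_add]
        exact Polynomial.natDegree_add_le_of_degree_le hp.1 hq.1
      · rw [map_add, map_add, Polynomial.coeff_add, hp.2, hq.2]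
    | smul c p _ hp =>
      refine ⟨?_, ?_⟩
      · rw [map_smul]
        exact (Polynomial.natDegree_smul_le c _).trans hp.1
      · rw [map_smul, Polynomial.coeff_smul, hp.2, smul_eval, smul_eq_mul]
  have hp' : p ∈ (homogeneousSubmodule (Fin n) ℂ 1) ^ d := by
    rw [homogeneousSubmodule_one_pow]; exact hp
  clear hp
  induction d generalizing p with
  | zero =>
    rw [pow_zero, Submodule.mem_one] at hp'
    obtain ⟨c, rfl⟩ := hp'
    simp [algebraMap_eq, restrictToLine]
  | succ d ih =>
    rw [pow_succ] at hp'
    induction hp' using Submodule.mul_induction_on' with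
    | mem_mul_mem m hm l hl =>
      obtain ⟨h1, h2⟩ := ih hm
      obtain ⟨h3, h4⟩ := hlin l hl
      refine ⟨?_, ?_⟩
      · rw [map_mul]
        exact Polynomial.natDegree_mul_le.trans (add_le_add h1 h3)
      · rw [map_mul, Polynomial.coeff_mul_add_eq_of_natDegree_le h1 h3, h2, h4, map_mul]
    | add p _ q _ hp hq =>
      refine ⟨?_, ?_⟩
      · rw [map_add]
        exact Polynomial.natDegree_add_le_of_degree_le hp.1 hq.1
      · rw [map_add, map_add, Polynomial.coeff_add, hp.2, hq.2]

/-- The differential along the line `s ↦ s z + y` applied to a fixed vector. -/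
def lineDifferential (G : CoordRing) (z y u : Fin 6 → ℂ) : Polynomial ℂ :=
  ∑ i, restrictToLine z y (pderiv i G) * Polynomial.C (u i)

theorem eval_lineDifferential (G : CoordRing) (z y u : Fin 6 → ℂ) (s : ℂ) :
    (lineDifferential G z y u).eval s = gradientAt G (s • z + y) ⬝ᵥ u := by
  simp [lineDifferential, Polynomial.eval_finsetSum, eval_restrictToLine, dotProduct, gradientAt]

theorem lineDifferential_degree {G : CoordRing} {d : ℕ} (hG : G.IsHomogeneous (d + 1))
    (z y u : Fin 6 → ℂ) : (lineDifferential G z y u).natDegree ≤ d ∧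
      (lineDifferential G z y u).coeff d = gradientAt G z ⬝ᵥ u := by
  have h := fun i => restrictToLine_degree z y (d := d) (hG.pderiv (i := i))
  constructor
  · refine Polynomial.natDegree_sum_le_of_forall_le _ _ fun i _ => ?_
    exact (Polynomial.natDegree_mul_C_le _ _).trans (h i).1
  · simp [lineDifferential, (h _).2, dotProduct, gradientAt]

variable {G : CoordRing} {z y : Fin 6 → ℂ} (hG : ∀ s t : ℂ, eval (s • z + t • y) G = 0)

include hG

theorem gradientAt_dotProduct_of_vanishing_on_span (s t : ℂ) :
    gradientAt G (s • z + t • y) ⬝ᵥ z = 0 ∧ gradientAt G (s • z + t • y) ⬝ᵥ y = 0 := by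
  let Φ : Fin 6 → MvPolynomial (Fin 2) ℂ := fun i => X 0 * C (z i) + X 1 * C (y i)
  have hev : ∀ (p : CoordRing) (x : Fin 2 → ℂ),
      eval x (aeval Φ p) = eval (x 0 • z + x 1 • y) p := by
    intro p x
    have : (aeval x : MvPolynomial (Fin 2) ℂ →ₐ[ℂ] ℂ).comp (aeval Φ) =
        (aeval (x 0 • z + x 1 • y) : CoordRing →ₐ[ℂ] ℂ) := by
      ext i; simp [Φ]
    have h := DFunLike.congr_fun this p
    simpa [aeval_eq_eval] using h
  have h0 : aeval Φ G = 0 := MvPolynomial.funext fun x => by rw [hev, hG, map_zero]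
  have hd : ∀ k : Fin 2,
      ∑ j, gradientAt G (s • z + t • y) j * eval ![s, t] (pderiv k (Φ j)) = 0 := by
    intro k
    have h1 := congrArg (eval ![s, t]) (pderiv_aeval_eq_sum Φ k G)
    rw [h0, map_zero, map_zero, map_sum] at h1
    rw [h1]
    refine Finset.sum_congr rfl fun j _ => ?_
    rw [map_mul, hev]
    rfl
  constructor
  · have := hd 0
    simpa [Φ, dotProduct] using this
  · have := hd 1
    simpa [Φ, dotProduct] using this

/-- Apply `D` to G(sz + ty) = 0. The terms with D s and D t are tangent to the line and drop out,
leaving a section of its normal bundle annihilated by the differential of `G`. -/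
theorem gradientAt_dotProduct_derivation {k : Subfield ℂ} (D : Derivation k ℂ ℂ)
    (hk : ∀ m, coeff m G ∈ k) (s t : ℂ) :
    gradientAt G (s • z + t • y) ⬝ᵥ (s • (fun i => D (z i)) + t • fun i => D (y i)) = 0 := by
  have h1 := derivation_eval D hk (s • z + t • y)
  rw [hG, map_zero] at h1
  have h2 := gradientAt_dotProduct_of_vanishing_on_span hG s t
  have h3 : (fun i => D ((s • z + t • y) i)) =
      (s • (fun i => D (z i)) + t • fun i => D (y i)) + D s • z + D t • y := by
    ext i
    simp [mul_comm]
    ring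
  have h4 : gradientAt G (s • z + t • y) ⬝ᵥ (fun i => D ((s • z + t • y) i)) = 0 := h1.symm
  rw [h3, dotProduct_add, dotProduct_add, dotProduct_smul, dotProduct_smul, h2.1, h2.2] at h4
  simpa using h4

end Lines

/-! ### A plane that meets no line of the threefold. -/

section LinesThroughAPlane

variable {q f : MvPolynomial (Fin 6) ℂ}

/-- A line on `V` cannot be moved to first order in two independent directions. -/
theorem false_of_line_of_derivations (hq : q.IsHomogeneous 2) (hf : f.IsHomogeneous 3)
    (hsm : IsSmoothOfCodim (intersectionIdeal q f) 2) {k : Subfield ℂ} (hkq : ∀ m, coeff m q ∈ k)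
    (hkf : ∀ m, coeff m f ∈ k) {z y : Fin 6 → ℂ}
    (hVq : ∀ s t : ℂ, eval (s • z + t • y) q = 0) (hVf : ∀ s t : ℂ, eval (s • z + t • y) f = 0)
    (D₁ D₂ : Derivation k ℂ ℂ)
    (hli : LinearIndependent ℂ ![z, y, fun i => D₁ (z i), fun i => D₂ (z i)]) : False := by
  rw [smooth_intersectionIdeal_iff] at hsm
  -- The last four vectors of a basis beginning z, y, D₁z, D₂z are a frame of the normal space.
  -- There the deformations s Dᵢz + Dᵢy have the shape X eᵢ + constant, and the differentials of `q`
  -- and `f` have degrees 1 and 2.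
  obtain ⟨b, hb⟩ := exists_basis_extending (show 4 ≤ 6 by norm_num) hli
  have hb0 : b 0 = z := hb 0
  have hb1 : b 1 = y := hb 1
  have hb2 : b 2 = fun i => D₁ (z i) := hb 2
  have hb3 : b 3 = fun i => D₂ (z i) := hb 3
  have hker : ∀ w : Fin 6 → ℂ, (∀ i, w ⬝ᵥ b i = 0) → w = 0 := by
    intro w hw
    refine dotProduct_eq_zero _ fun x => ?_
    rw [← b.sum_repr x, dotProduct_sum]
    exact Finset.sum_eq_zero fun i _ => by rw [dotProduct_smul, hw i, smul_zero]
  have hzy : ∀ s t : ℂ, (s ≠ 0 ∨ t ≠ 0) → s • z + t • y ≠ 0 := by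
    intro s t hst h0
    have h2 : LinearIndependent ℂ ![z, y] := by
      have := hli.comp ![0, 1] (by decide)
      convert this using 1
      ext i
      fin_cases i <;> rfl
    obtain ⟨h3, h4⟩ := LinearIndependent.pair_iff.mp h2 s t h0
    tauto
  have hsm' : ∀ s t : ℂ, (s ≠ 0 ∨ t ≠ 0) → ∀ α β : ℂ,
      (∀ i : Fin 4, α * (gradientAt q (s • z + t • y) ⬝ᵥ b (i.natAdd 2)) +
        β * (gradientAt f (s • z + t • y) ⬝ᵥ b (i.natAdd 2)) = 0) → α = 0 ∧ β = 0 := by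
    intro s t hst α β hαβ
    refine hsm _ (hzy s t hst) (hVq s t) (hVf s t) α β (hker _ fun i => ?_)
    obtain ⟨hq1, hq2⟩ := gradientAt_dotProduct_of_vanishing_on_span hVq s t
    obtain ⟨hf1, hf2⟩ := gradientAt_dotProduct_of_vanishing_on_span hVf s t
    rw [add_dotProduct, smul_dotProduct, smul_dotProduct, smul_eq_mul, smul_eq_mul]
    fin_cases i
    · simp [hb0, hq1, hf1]
    · simp [hb1, hq2, hf2]
    · exact hαβ 0
    · exact hαβ 1
    · exact hαβ 2
    · exact hαβ 3
  have hrel : ∀ {G : MvPolynomial (Fin 6) ℂ}, (∀ s t : ℂ, eval (s • z + t • y) G = 0) →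
      (∀ m, coeff m G ∈ k) → ∀ (D : Derivation k ℂ ℂ) (j : Fin 4),
      b (j.natAdd 2) = (fun i => D (z i)) →
      lineDifferential G z y (b (j.natAdd 2)) * Polynomial.X +
        ∑ i : Fin 4, lineDifferential G z y (b (i.natAdd 2)) *
          Polynomial.C (b.repr (fun i => D (y i)) (i.natAdd 2)) = 0 := by
    intro G hG hk D j hj
    refine Polynomial.funext fun s => ?_
    have h1 := gradientAt_dotProduct_derivation hG D hk s 1
    obtain ⟨h2, h3⟩ := gradientAt_dotProduct_of_vanishing_on_span hG s 1
    rw [one_smul] at h1 h2 h3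
    rw [one_smul, dotProduct_add, dotProduct_smul, ← hj, ← b.sum_repr (fun i => D (y i)),
      dotProduct_sum, Fin.sum_univ_six] at h1
    simp only [dotProduct_smul, hb0, hb1, h2, h3, smul_eq_mul, mul_zero, zero_add] at h1
    simp only [Polynomial.eval_add, Polynomial.eval_mul, Polynomial.eval_X, Polynomial.eval_C,
      eval_lineDifferential, Polynomial.eval_zero, Fin.sum_univ_four]
    have e0 : Fin.natAdd 2 (0 : Fin 4) = 2 := rfl
    have e1 : Fin.natAdd 2 (1 : Fin 4) = 3 := rfl
    have e2 : Fin.natAdd 2 (2 : Fin 4) = 4 := rfl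
    have e3 : Fin.natAdd 2 (3 : Fin 4) = 5 := rfl
    rw [e0, e1, e2, e3]
    linear_combination h1
  refine no_independent_linear_sections
    (fun i => lineDifferential q z y (b (i.natAdd 2)))
    (fun i => lineDifferential f z y (b (i.natAdd 2)))
    (fun i => b.repr (fun i => D₁ (y i)) (i.natAdd 2))
    (fun i => b.repr (fun i => D₂ (y i)) (i.natAdd 2))
    (fun i => (lineDifferential_degree hq _ _ _).1)
    (fun i => (lineDifferential_degree hf _ _ _).1)
    (hrel hVq hkq D₁ 0 hb2) (hrel hVq hkq D₂ 1 hb3)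
    (hrel hVf hkf D₁ 0 hb2) (hrel hVf hkf D₂ 1 hb3) ?_ ?_
  · intro s
    by_contra! hall
    simp only [eval_lineDifferential] at hall
    have h1 := hsm' s 1 (Or.inr one_ne_zero)
    rw [one_smul] at h1
    have h2 : ∀ i : Fin 4, gradientAt q (s • z + y) ⬝ᵥ b (i.natAdd 2) = 0 := fun i =>
      neg_eq_zero.mp (h1 (gradientAt f (s • z + y) ⬝ᵥ b (i.natAdd 2))
        (-(gradientAt q (s • z + y) ⬝ᵥ b (i.natAdd 2)))
        fun j => by linear_combination -(hall i j)).2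
    exact one_ne_zero (h1 1 0 fun i => by rw [h2 i]; ring).1
  -- The leading condition is smoothness at `z`: both differentials kill D₁z and D₂z there, so their
  -- rank 2 must be visible on `b 4` and `b 5`.
  · rw [(lineDifferential_degree hq _ _ _).2, (lineDifferential_degree hq _ _ _).2,
      (lineDifferential_degree hf _ _ _).2, (lineDifferential_degree hf _ _ _).2]
    intro h0
    have h1 := hsm' 1 0 (Or.inl one_ne_zero)
    rw [one_smul, zero_smul, add_zero] at h1
    have hkill : ∀ {G : MvPolynomial (Fin 6) ℂ}, (∀ s t : ℂ, eval (s • z + t • y) G = 0) →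
      (∀ m, coeff m G ∈ k) → ∀ D : Derivation k ℂ ℂ,
      gradientAt G z ⬝ᵥ (fun i => D (z i)) = 0 := by
      intro G hG hk D
      have := gradientAt_dotProduct_derivation hG D hk 1 0
      rwa [one_smul, zero_smul, add_zero, one_smul, zero_smul, add_zero] at this
    have h2 : ∀ α β : ℂ,
        α * (gradientAt q z ⬝ᵥ b 4) + β * (gradientAt f z ⬝ᵥ b 4) = 0 →
        α * (gradientAt q z ⬝ᵥ b 5) + β * (gradientAt f z ⬝ᵥ b 5) = 0 → α = 0 ∧ β = 0 := by
      intro α β h4 h5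
      refine h1 α β fun i => ?_
      fin_cases i
      · change α * (gradientAt q z ⬝ᵥ b 2) + β * (gradientAt f z ⬝ᵥ b 2) = 0
        rw [hb2, hkill hVq hkq, hkill hVf hkf]; ring
      · change α * (gradientAt q z ⬝ᵥ b 3) + β * (gradientAt f z ⬝ᵥ b 3) = 0
        rw [hb3, hkill hVq hkq, hkill hVf hkf]; ring
      · exact h4
      · exact h5
    replace h0 : gradientAt q z ⬝ᵥ b 4 * gradientAt f z ⬝ᵥ b 5 -
      gradientAt q z ⬝ᵥ b 5 * gradientAt f z ⬝ᵥ b 4 = 0 := h0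
    have h4 : gradientAt q z ⬝ᵥ b 4 = 0 := neg_eq_zero.mp
      (h2 (gradientAt f z ⬝ᵥ b 4) (-(gradientAt q z ⬝ᵥ b 4)) (by ring)
        (by linear_combination -h0)).2
    have h5 : gradientAt q z ⬝ᵥ b 5 = 0 := neg_eq_zero.mp
      (h2 (gradientAt f z ⬝ᵥ b 5) (-(gradientAt q z ⬝ᵥ b 5)) (by linear_combination h0)
        (by ring)).2
    exact one_ne_zero (h2 1 0 (by rw [h4]; ring) (by rw [h5]; ring)).1

/-- There is a plane in `ℙ⁵` whose points lie on no line of the smooth threefold `V`. -/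
theorem exists_plane_without_lines (hq : q.IsHomogeneous 2) (hf : f.IsHomogeneous 3)
    (hsm : IsSmoothOfCodim (intersectionIdeal q f) 2) :
    ∃ l : Fin 3 → Fin 6 → ℂ, ∀ z y : Fin 6 → ℂ, (∀ k, l k ⬝ᵥ z = 0) →
      LinearIndependent ℂ ![z, y] →
      ¬ ∀ s t : ℂ, eval (s • z + t • y) q = 0 ∧ eval (s • z + t • y) f = 0 := by
  -- A generic plane: the 18 coefficients of its three equations are dual to derivations that are
  -- trivial on the coefficients of `q` and `f`.
  obtain ⟨k, c, D, hk, hD⟩ := exists_dual_derivations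
    (s := Set.range (fun m => coeff m q) ∪ Set.range fun m => coeff m f)
    ((Set.countable_range _).union (Set.countable_range _)) (ι := Fin 3 × Fin 6)
  have hkq : ∀ m, coeff m q ∈ k := fun m => hk (Or.inl ⟨m, rfl⟩)
  have hkf : ∀ m, coeff m f ∈ k := fun m => hk (Or.inr ⟨m, rfl⟩)
  refine ⟨fun a j => c (a, j), fun z y hz hli hV => ?_⟩
  obtain ⟨j, hj⟩ : ∃ j, z j ≠ 0 := Function.ne_iff.mp (hli.ne_zero 0)
  -- Differentiating the equations of the plane at `z` shows that `D (a, j)` moves `z` off the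
  -- `a`-th hyperplane only, at rate −z j.
  have hdot : ∀ a a' : Fin 3, (fun j => c (a', j)) ⬝ᵥ (fun i => D (a, j) (z i)) =
      if a = a' then -z j else 0 := by
    intro a a'
    have h1 := congrArg (D (a, j)) (hz a')
    simp only [dotProduct, map_sum, map_zero, Derivation.leibniz, smul_eq_mul, hD,
      Finset.sum_add_distrib, Prod.mk.injEq] at h1
    rw [dotProduct, eq_neg_of_add_eq_zero_left h1]
    split_ifs with h <;> simp [h]
  -- The vector `y` can absorb one of the three directions transverse to the plane. The index `a` is
  -- given up to it; the other two derivatives of `z` remain independent modulo the line.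
  have hmain : ∀ a a₁ a₂ : Fin 3, a ≠ a₁ → a ≠ a₂ → a₁ ≠ a₂ →
      ((fun j => c (a, j)) ⬝ᵥ y ≠ 0 ∨ ∀ a, (fun j => c (a, j)) ⬝ᵥ y = 0) → False := by
    intro a a₁ a₂ h1 h2 h12 hy
    refine false_of_line_of_derivations hq hf hsm hkq hkf (fun s t => (hV s t).1)
      (fun s t => (hV s t).2) (D (a₁, j)) (D (a₂, j)) ?_
    rw [Fintype.linearIndependent_iff]
    intro g hg
    simp only [Fin.sum_univ_four, Matrix.cons_val] at hg
    have hap : ∀ a' : Fin 3, g 1 * ((fun j => c (a', j)) ⬝ᵥ y) +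
        g 2 * (if a₁ = a' then -z j else 0) + g 3 * (if a₂ = a' then -z j else 0) = 0 := by
      intro a'
      have := congrArg (fun w => (fun j => c (a', j)) ⬝ᵥ w) hg
      simpa only [dotProduct_add, dotProduct_smul, hdot, hz a', smul_eq_mul, mul_zero, zero_add,
        dotProduct_zero] using this
    have ha := hap a
    have ha₁ := hap a₁
    have ha₂ := hap a₂
    rw [if_neg h1.symm, if_neg h2.symm] at ha
    rw [if_pos rfl, if_neg h12.symm] at ha₁
    rw [if_pos rfl, if_neg h12] at ha₂
    have hgy : ∀ a', g 1 * ((fun j => c (a', j)) ⬝ᵥ y) = 0 := by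
      intro a'
      rcases hy with hy | hy
      · have : g 1 = 0 := by simpa [hy] using ha
        rw [this, zero_mul]
      · rw [hy, mul_zero]
    have hg2 : g 2 = 0 := by simpa [hgy, hj] using ha₁
    have hg3 : g 3 = 0 := by simpa [hgy, hj] using ha₂
    rw [hg2, hg3, zero_smul, zero_smul, add_zero, add_zero] at hg
    obtain ⟨hg0, hg1⟩ := LinearIndependent.pair_iff.mp hli _ _ hg
    intro i
    fin_cases i <;> assumption
  by_cases h : ∀ a, (fun j => c (a, j)) ⬝ᵥ y = 0
  · exact hmain 0 1 2 (by decide) (by decide) (by decide) (Or.inr h)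
  · push Not at h
    obtain ⟨a, ha⟩ := h
    exact hmain a (a + 1) (a + 2) (by fin_cases a <;> decide) (by fin_cases a <;> decide)
      (by fin_cases a <;> decide) (Or.inl ha)

end LinesThroughAPlane

/-! ### The singular locus of the quadric. -/

section PolarForm

theorem pderiv_pderiv_comm {σ : Type*} (i j : σ) (p : MvPolynomial σ ℂ) :
    pderiv i (pderiv j p) = pderiv j (pderiv i p) := by
  classical
  have h : ⁅pderiv (R := ℂ) i, pderiv (R := ℂ) j⁆ = 0 := by
    refine MvPolynomial.derivation_ext fun k => ?_
    rw [Derivation.commutator_apply]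
    simp only [pderiv_X, Pi.single_apply]
    split_ifs <;> simp
  have := DFunLike.congr_fun h p
  rwa [Derivation.commutator_apply, Derivation.zero_apply, sub_eq_zero] at this

/-- The polar form of a quadratic form. -/
theorem exists_polarForm {q : CoordRing} (hq : q.IsHomogeneous 2) :
    ∃ B : LinearMap.BilinForm ℂ (Fin 6 → ℂ), (∀ x y, B x y = B y x) ∧
      (∀ x, B x x = 2 * eval x q) ∧ ∀ x y, B x y = gradientAt q x ⬝ᵥ y := by
  let H : Matrix (Fin 6) (Fin 6) ℂ := fun i j => coeff 0 (pderiv i (pderiv j q))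
  have hH : ∀ i j, pderiv i (pderiv j q) = C (H i j) := fun i j => by
    have h := (hq.pderiv (i := j)).pderiv (i := i)
    exact totalDegree_eq_zero_iff_eq_C.mp (Nat.le_zero.mp h.totalDegree_le)
  have hsymm : ∀ i j, H i j = H j i := fun i j => by
    change coeff 0 _ = coeff 0 _
    rw [pderiv_pderiv_comm]
  have hgrad : ∀ x j, gradientAt q x j = ∑ i, x i * H i j := by
    intro x j
    have h := congrArg (eval x) ((hq.pderiv (i := j)).sum_X_mul_pderiv)
    simp only [hH, map_sum, map_mul, eval_X, eval_C] at h
    rw [show 2 - 1 = 1 from rfl, one_smul] at h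
    exact h.symm
  have hB : ∀ x y, Matrix.toBilin' H x y = gradientAt q x ⬝ᵥ y := by
    intro x y
    rw [Matrix.toBilin'_apply', Matrix.dotProduct_mulVec]
    congr 1
    ext j
    rw [hgrad]
    rfl
  refine ⟨Matrix.toBilin' H, fun x y => ?_, fun x => ?_, hB⟩
  · rw [Matrix.toBilin'_apply, Matrix.toBilin'_apply, Finset.sum_comm]
    refine Finset.sum_congr rfl fun i _ => Finset.sum_congr rfl fun j _ => ?_
    rw [hsymm]; ring
  · rw [hB]
    have h := congrArg (eval x) hq.sum_X_mul_pderiv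
    simp only [map_sum, map_mul, eval_X, nsmul_eq_mul, map_natCast] at h
    rw [dotProduct]
    exact_mod_cast (Finset.sum_congr rfl fun i _ => mul_comm _ _).trans h

/-- The quadric containing a smooth threefold `V` has at most one singular point. -/
theorem not_linearIndependent_of_mem_radical {q f : CoordRing}
    (hf : f.IsHomogeneous 3) (hsm : IsSmoothOfCodim (intersectionIdeal q f) 2)
    {B : LinearMap.BilinForm ℂ (Fin 6 → ℂ)} (hBq : ∀ x, B x x = 2 * eval x q)
    (hBg : ∀ x y, B x y = gradientAt q x ⬝ᵥ y) {u w : Fin 6 → ℂ} (hu : ∀ x, B u x = 0)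
    (hw : ∀ x, B w x = 0) : ¬ LinearIndependent ℂ ![u, w] := by
  intro hli
  rw [smooth_intersectionIdeal_iff] at hsm
  let Φ : Fin 6 → MvPolynomial (Fin 2) ℂ := fun i => X 0 * C (u i) + X 1 * C (w i)
  have hev : ∀ x : Fin 2 → ℂ, eval x (aeval Φ f) = eval (x 0 • u + x 1 • w) f := by
    intro x
    have : (aeval x : MvPolynomial (Fin 2) ℂ →ₐ[ℂ] ℂ).comp (aeval Φ) =
        (aeval (x 0 • u + x 1 • w) : CoordRing →ₐ[ℂ] ℂ) := by
      ext i; simp [Φ]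
    have h := DFunLike.congr_fun this f
    simpa [aeval_eq_eval] using h
  -- The cubic has a zero on the line joining two singular points of the quadric; the gradient of
  -- `q` vanishes there, so V would be singular.
  obtain ⟨x, hx, hfx⟩ := exists_ne_zero_common_zero (show 1 < 2 by norm_num)
    (fun _ : Fin 1 => aeval Φ f) fun _ => by
      rw [hev]
      simp only [Pi.zero_apply, zero_smul, add_zero]
      rw [eval_zero]
      exact hf.coeff_eq_zero (d := 0) (by simp)
  have hfx := hfx 0
  rw [hev] at hfx
  have hrad : ∀ y, B (x 0 • u + x 1 • w) y = 0 := fun y => by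
    simp [hu y, hw y]
  have h1 : x 0 • u + x 1 • w ≠ 0 := by
    intro h0
    have := LinearIndependent.pair_iff.mp hli _ _ h0
    exact hx (by ext i; fin_cases i <;> simp [this])
  have h2 := hsm _ h1 (by
    have := hBq (x 0 • u + x 1 • w)
    rw [hrad] at this
    simpa using this.symm) hfx 1 0 (by
    have : gradientAt q (x 0 • u + x 1 • w) = 0 :=
      dotProduct_eq_zero _ fun y => by rw [← hBg, hrad]
    rw [this]; simp)
  exact one_ne_zero h2.1

end PolarForm

/-! ### The plane on which the cubic is a multiple of the quadric. -/

section Plane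

variable {q f : CoordRing}

theorem eval_aeval_linear {m n : ℕ} (M : Fin n → Fin m → ℂ) (p : MvPolynomial (Fin n) ℂ)
    (x : Fin m → ℂ) :
    eval x (aeval (fun j => ∑ i, C (M j i) * X i : Fin n → MvPolynomial (Fin m) ℂ) p) =
      eval (fun j => ∑ i, M j i * x i) p := by
  have : (aeval x : MvPolynomial (Fin m) ℂ →ₐ[ℂ] ℂ).comp
      (aeval (fun j => ∑ i, C (M j i) * X i)) =
        (aeval (fun j => ∑ i, M j i * x i) : MvPolynomial (Fin n) ℂ →ₐ[ℂ] ℂ) := by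
    ext i; simp
  have h := DFunLike.congr_fun this p
  simpa [aeval_eq_eval] using h

/-- On a smooth threefold `V` there is a plane in which `f` is a multiple of `q ≠ 0`. -/
theorem exists_plane_meeting_in_conic (hq : q.IsHomogeneous 2) (hf : f.IsHomogeneous 3)
    (hsm : IsSmoothOfCodim (intersectionIdeal q f) 2) :
    ∃ u : Fin 3 → Fin 6 → ℂ, ∃ h : Fin 3 → ℂ, LinearIndependent ℂ u ∧
      (∀ t : Fin 3 → ℂ, eval (∑ k, t k • u k) f = (∑ k, t k * h k) * eval (∑ k, t k • u k) q) ∧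
      ∃ t : Fin 3 → ℂ, eval (∑ k, t k • u k) q ≠ 0 := by
  obtain ⟨l, hl⟩ := exists_plane_without_lines hq hf hsm
  let A : (Fin 6 → ℂ) →ₗ[ℂ] (Fin 3 → ℂ) := Matrix.mulVecLin (Matrix.of l)
  have hA : ∀ z ∈ LinearMap.ker A, ∀ k, l k ⬝ᵥ z = 0 := fun z hz k => congrFun hz k
  have hdim : 3 ≤ Module.finrank ℂ (LinearMap.ker A) := by
    have h1 := A.finrank_range_add_finrank_ker
    have h2 := (LinearMap.range A).finrank_le
    simp only [Module.finrank_fin_fun] at h1 h2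
    omega
  obtain ⟨v, hv⟩ := exists_linearIndependent_of_le_finrank hdim
  have hv' : LinearIndependent ℂ fun i => (v i : Fin 6 → ℂ) :=
    hv.map' (LinearMap.ker A).subtype (LinearMap.ker A).ker_subtype
  obtain ⟨b, hb⟩ := exists_basis_extending (show 3 ≤ 6 by norm_num) hv'
  -- `T` is the projection from (0:…:0:1), written in a basis whose first three vectors lie in the
  -- plane that avoids the lines of V. On the image of a plane in the cubic f∘T − x₆·q∘T, f = h q
  -- with h given by the last coordinate.
  let M : Fin 6 → Fin 7 → ℂ := fun j => Fin.snoc (fun i => b i j) 0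
  let T : (Fin 7 → ℂ) →ₗ[ℂ] (Fin 6 → ℂ) := Matrix.mulVecLin (Matrix.of M)
  have hT : ∀ x, T x = ∑ i : Fin 6, x i.castSucc • b i := by
    intro x
    ext j
    change ∑ i, M j i * x i = _
    rw [Fin.sum_univ_castSucc]
    have hlast : M j 6 = 0 := Fin.snoc_last (α := fun _ => ℂ) _ _
    have hcast : ∀ i : Fin 6, M j i.castSucc = b i j := fun i =>
      Fin.snoc_castSucc (α := fun _ => ℂ) _ _ _
    simp [hlast, hcast, mul_comm]
  have hker : ∀ x, T x = 0 → ∀ i : Fin 6, x i.castSucc = 0 := by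
    intro x hx
    rw [hT] at hx
    exact Fintype.linearIndependent_iff.mp b.linearIndependent _ hx
  have hM : ∀ j, (∑ i, C (M j i) * X i : MvPolynomial (Fin 7) ℂ).IsHomogeneous 1 := fun j =>
    IsHomogeneous.sum _ _ _ fun i _ => isHomogeneous_C_mul_X _ _
  let F : MvPolynomial (Fin 7) ℂ := aeval (fun j => ∑ i, C (M j i) * X i) f -
    X 6 * aeval (fun j => ∑ i, C (M j i) * X i) q
  have hF : F.IsHomogeneous 3 := by
    refine IsHomogeneous.sub ?_ ((isHomogeneous_X ℂ 6).mul ?_ : IsHomogeneous _ (1 + 2))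
    · simpa using hf.aeval (fun j => ∑ i, C (M j i) * X i) hM
    · simpa using hq.aeval (fun j => ∑ i, C (M j i) * X i) hM
  have hFe : ∀ x, eval x F = eval (T x) f - x 6 * eval (T x) q := by
    intro x
    simp only [F, map_sub, map_mul, eval_X, eval_aeval_linear]
    rfl
  obtain ⟨e, he, he0, heF⟩ := exists_plane_in_cubic hF
  have heF' : ∀ t : Fin 3 → ℂ, eval (∑ k, t k • T (e k)) f =
      (∑ k, t k * e k 6) * eval (∑ k, t k • T (e k)) q := by
    intro t
    have := heF t
    rw [hFe, sub_eq_zero] at this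
    simpa using this
  have hT0 : ∀ k, l k ⬝ᵥ T (e 0) = 0 := by
    refine hA _ ?_
    rw [hT]
    refine Submodule.sum_mem _ fun i _ => ?_
    by_cases hi : (i : ℕ) < 3
    · refine Submodule.smul_mem _ _ ?_
      have := hb ⟨i, hi⟩
      rw [show Fin.castLE _ ⟨(i : ℕ), hi⟩ = i from rfl] at this
      rw [this]
      exact (v _).2
    · rw [he0 _ (by rw [Fin.le_def]; simpa using hi), zero_smul]
      exact Submodule.zero_mem _
  have hker' : ∀ t : Fin 3 → ℂ, ∑ k, t k • T (e k) = 0 → ∑ k, t k * e k 6 = 0 → t = 0 := by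
    intro t h1 h2
    have h3 : ∑ k, t k • e k = 0 := by
      ext i
      refine Fin.lastCases ?_ (fun i => ?_) i
      · simpa using h2
      · exact hker _ (by simpa using h1) i
    ext k
    exact Fintype.linearIndependent_iff.mp he _ h3 k
  have he06 : e 0 6 = 0 := he0 6 (by decide)
  -- The projected plane contains a line through `T (e 0)` even if it passes through the centre: on
  -- it the kernel of `T` has dimension at most one and does not contain `e 0`, whose last
  -- coordinate is zero.
  have hpair : ∃ k : Fin 3, k ≠ 0 ∧ LinearIndependent ℂ ![T (e 0), T (e k)] := by
    by_contra! hno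
    have hne : T (e 0) ≠ 0 := by
      intro h
      have := congrFun (hker' ![1, 0, 0] (by simp [Fin.sum_univ_three, h])
        (by simp [Fin.sum_univ_three, he06])) 0
      simp at this
    have h1 := hno 1 (by decide)
    have h2 := hno 2 (by decide)
    rw [LinearIndependent.pair_iff' hne] at h1 h2
    push Not at h1 h2
    obtain ⟨α, hα⟩ := h1
    obtain ⟨β, hβ⟩ := h2
    by_cases hz : e 1 6 = 0
    · have := congrFun (hker' ![-α, 1, 0] (by simp [Fin.sum_univ_three, ← hα])
        (by simp [Fin.sum_univ_three, he06, hz])) 1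
      simp at this
    · have := congrFun (hker' ![-(e 2 6 * α) + e 1 6 * β, e 2 6, -e 1 6] (by
          simp only [Fin.sum_univ_three, Matrix.cons_val, ← hα, ← hβ]
          module) (by
          simp only [Fin.sum_univ_three, Matrix.cons_val, he06]
          ring)) 2
      exact hz (by simpa using this)
  -- Otherwise `q`, hence `f`, vanishes on that line, which is then a line of V through a point of
  -- the avoided plane.
  have hqne : ∃ t : Fin 3 → ℂ, eval (∑ k, t k • T (e k)) q ≠ 0 := by
    by_contra! hno
    obtain ⟨k, hk, hli⟩ := hpair
    refine hl _ _ hT0 hli fun s t => ?_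
    have hst : s • T (e 0) + t • T (e k) =
        ∑ i, (Pi.single 0 s + Pi.single k t : Fin 3 → ℂ) i • T (e i) := by
      simp [add_smul, Finset.sum_add_distrib, Pi.single_apply, ite_smul]
    rw [hst]
    refine ⟨hno _, ?_⟩
    rw [heF', hno, mul_zero]
  refine ⟨fun k => T (e k), fun k => e k 6, ?_, heF', hqne⟩
  -- A kernel vector of the projection would change h without changing the point, impossible where q
  -- ≠ 0.
  rw [Fintype.linearIndependent_iff]
  intro t ht
  by_contra! hne
  obtain ⟨i, hi⟩ := hne
  have hs : ∑ k, t k * e k 6 ≠ 0 := fun hs => hi (congrFun (hker' t ht hs) i)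
  obtain ⟨t', ht'⟩ := hqne
  have h1 := heF' t'
  have h2 := heF' (t' + t)
  have h3 : ∑ k, (t' + t) k • T (e k) = ∑ k, t' k • T (e k) := by
    simp [add_smul, Finset.sum_add_distrib, ht]
  rw [h3, h1] at h2
  have h4 := mul_right_cancel₀ ht' h2
  simp only [Pi.add_apply, add_mul, Finset.sum_add_distrib] at h4
  exact hs (by linear_combination -h4)

end Plane

/-! ### A 3-space on which the quadric is irreducible. -/

section AdaptedBasis

variable {V : Type*} [AddCommGroup V] [Module ℂ V]

theorem exists_linearIndependent_pair_ker [FiniteDimensional ℂ V] {W : Type*}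
    [AddCommGroup W] [Module ℂ W] [FiniteDimensional ℂ W] (A : V →ₗ[ℂ] W)
    (h : Module.finrank ℂ W + 2 ≤ Module.finrank ℂ V) :
    ∃ x y : V, A x = 0 ∧ A y = 0 ∧ LinearIndependent ℂ ![x, y] := by
  have h1 := A.finrank_range_add_finrank_ker
  have h2 := (LinearMap.range A).finrank_le
  obtain ⟨v, hv⟩ := exists_linearIndependent_of_le_finrank
    (show 2 ≤ Module.finrank ℂ (LinearMap.ker A) by omega)
  refine ⟨v 0, v 1, (v 0).2, (v 1).2, ?_⟩
  have e : ![(v 0 : V), (v 1 : V)] = (LinearMap.ker A).subtype ∘ v := by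
    ext i
    fin_cases i <;> rfl
  rw [e]
  exact hv.map' (LinearMap.ker A).subtype (LinearMap.ker A).ker_subtype

/-- A symmetric bilinear form with a radical of dimension at most one that does not vanish
identically on `P`, `dim P = 3`, is nondegenerate on some three-dimensional space meeting `P` in
dimension at least two. -/
theorem exists_nondegenerate_triple [FiniteDimensional ℂ V] (hV : 4 ≤ Module.finrank ℂ V)
    {B : LinearMap.BilinForm ℂ V}
    (hB : ∀ x y, B x y = B y x)
    (hrad : ∀ u w : V, (∀ x, B u x = 0) → (∀ x, B w x = 0) → ¬ LinearIndependent ℂ ![u, w])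
    {P : Submodule ℂ V} (hP : 3 ≤ Module.finrank ℂ P) (hBP : ∃ x ∈ P, B x x ≠ 0) :
    ∃ p₁ ∈ P, ∃ p₂ ∈ P, ∃ v : V, ∀ α β γ : ℂ, B (α • p₁ + β • p₂ + γ • v) p₁ = 0 →
      B (α • p₁ + β • p₂ + γ • v) p₂ = 0 → B (α • p₁ + β • p₂ + γ • v) v = 0 →
      α = 0 ∧ β = 0 ∧ γ = 0 := by
  -- Take `p₁` anisotropic and `p₂` in P orthogonal to it and outside the radical. If `p₂` is
  -- isotropic, `v` is a vector orthogonal to `p₁` that pairs nontrivially with `p₂`. Otherwise `v`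
  -- is anisotropic and orthogonal to both; without such a vector the orthogonal complement, of
  -- dimension at least 2, would lie in the radical.
  obtain ⟨p₁, hp₁, h11⟩ := hBP
  obtain ⟨p₂, hp₂, h12, v₀, hv₀⟩ : ∃ p₂ ∈ P, B p₁ p₂ = 0 ∧ ∃ v₀, B p₂ v₀ ≠ 0 := by
    obtain ⟨x, y, hx, hy, hli⟩ := exists_linearIndependent_pair_ker ((B p₁).domRestrict P)
      (by simpa using hP)
    have hli' : LinearIndependent ℂ ![(x : V), (y : V)] := by
      have e : ![(x : V), (y : V)] = P.subtype ∘ ![x, y] := by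
        ext i
        fin_cases i <;> rfl
      rw [e]
      exact hli.map' P.subtype P.ker_subtype
    by_contra! hno
    exact hrad x y (hno x x.2 hx) (hno y y.2 hy) hli'
  refine ⟨p₁, hp₁, p₂, hp₂, ?_⟩
  have h21 : B p₂ p₁ = 0 := by rw [hB, h12]
  by_cases h22 : B p₂ p₂ = 0
  · set v := v₀ - (B p₁ v₀ / B p₁ p₁) • p₁ with hv
    have h1v : B p₁ v = 0 := by
      rw [hv, map_sub, map_smul, smul_eq_mul, div_mul_cancel₀ _ h11, sub_self]
    have h2v : B p₂ v ≠ 0 := by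
      rwa [hv, map_sub, map_smul, h21, smul_zero, sub_zero]
    have hv1 : B v p₁ = 0 := by rw [hB, h1v]
    have hv2 : B v p₂ = B p₂ v := hB _ _
    refine ⟨v, fun α β γ h1 h2 h3 => ?_⟩
    simp only [map_add, map_smul, LinearMap.add_apply, LinearMap.smul_apply, smul_eq_mul, h12, h21,
      h22, hv1, hv2, h1v, mul_zero, add_zero, zero_add] at h1 h2 h3
    have hα : α = 0 := by simpa [h11] using h1
    have hγ : γ = 0 := by simpa [h2v] using h2
    refine ⟨hα, ?_, hγ⟩
    simpa [hγ, h2v] using h3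
  · obtain ⟨v, h1v, h2v, hvv⟩ : ∃ v, B p₁ v = 0 ∧ B p₂ v = 0 ∧ B v v ≠ 0 := by
      by_contra! hno
      obtain ⟨x, y, hx, hy, hli⟩ := exists_linearIndependent_pair_ker ((B p₁).prod (B p₂))
        (by simpa using hV)
      have hx' : B p₁ x = 0 ∧ B p₂ x = 0 := by simpa using hx
      have hy' : B p₁ y = 0 ∧ B p₂ y = 0 := by simpa using hy
      have hall : ∀ x, B p₁ x = 0 → B p₂ x = 0 → ∀ z, B x z = 0 := by
        intro x h1 h2 z
        set z' := z - (B p₁ z / B p₁ p₁) • p₁ - (B p₂ z / B p₂ p₂) • p₂ with hz'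
        have hz1 : B p₁ z' = 0 := by
          simp only [hz', map_sub, map_smul, smul_eq_mul, h12]
          field_simp
          ring
        have hz2 : B p₂ z' = 0 := by
          simp only [hz', map_sub, map_smul, smul_eq_mul, h21]
          field_simp
          ring
        have h3 := hno (x + z') (by rw [map_add, h1, hz1, add_zero])
          (by rw [map_add, h2, hz2, add_zero])
        rw [map_add, map_add, LinearMap.add_apply, LinearMap.add_apply, hno x h1 h2,
          hno z' hz1 hz2, hB z' x] at h3
        have h4 : B x z' = 0 := by linear_combination h3 / 2
        rw [hz', map_sub, map_sub, map_smul, map_smul, hB x p₁, hB x p₂, h1, h2] at h4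
        simpa using h4
      exact hrad x y (hall x hx'.1 hx'.2) (hall y hy'.1 hy'.2) hli
    have hv1 : B v p₁ = 0 := by rw [hB, h1v]
    have hv2 : B v p₂ = 0 := by rw [hB, h2v]
    refine ⟨v, fun α β γ h1 h2 h3 => ?_⟩
    simp only [map_add, map_smul, LinearMap.add_apply, LinearMap.smul_apply, smul_eq_mul, h12, h21,
      hv1, hv2, h1v, h2v, mul_zero, add_zero, zero_add] at h1 h2 h3
    exact ⟨by simpa [h11] using h1, by simpa [h22] using h2, by simpa [hvv] using h3⟩

/-- A nondegenerate ternary quadratic form is not a product of linear forms. -/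
theorem not_product_of_nondegenerate_triple {B : LinearMap.BilinForm ℂ V} {p₁ p₂ v : V}
    (hnd : ∀ α β γ : ℂ, B (α • p₁ + β • p₂ + γ • v) p₁ = 0 →
      B (α • p₁ + β • p₂ + γ • v) p₂ = 0 → B (α • p₁ + β • p₂ + γ • v) v = 0 →
      α = 0 ∧ β = 0 ∧ γ = 0) (l₁ l₂ : V →ₗ[ℂ] ℂ) {A : Submodule ℂ V} (h1 : p₁ ∈ A)
    (h2 : p₂ ∈ A) (h3 : v ∈ A) :
    ¬ ∀ x ∈ A, ∀ y ∈ A, B x y = l₁ x * l₂ y + l₁ y * l₂ x := by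
  intro hprod
  let φ : (Fin 3 → ℂ) →ₗ[ℂ] V := Fintype.linearCombination ℂ ![p₁, p₂, v]
  have hφ : ∀ t, φ t = t 0 • p₁ + t 1 • p₂ + t 2 • v := fun t => by
    simp [φ, Fintype.linearCombination_apply, Fin.sum_univ_three]
  -- Two linear forms have a common zero in a three-dimensional space, and it is in the radical of
  -- their product.
  obtain ⟨t, ht, ht0⟩ := (Submodule.ne_bot_iff _).mp (LinearMap.ker_ne_bot_of_finrank_lt
    (f := (l₁.prod l₂).comp φ) (by simp))
  have ht' : l₁ (φ t) = 0 ∧ l₂ (φ t) = 0 := by simpa using ht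
  have hA : φ t ∈ A := by
    rw [hφ]
    exact A.add_mem (A.add_mem (A.smul_mem _ h1) (A.smul_mem _ h2)) (A.smul_mem _ h3)
  have hz : ∀ y ∈ A, B (φ t) y = 0 := fun y hy => by
    rw [hprod _ hA _ hy, ht'.1, ht'.2]; ring
  rw [hφ] at hz
  obtain ⟨ha, hb, hc⟩ := hnd _ _ _ (hz _ h1) (hz _ h2) (hz _ h3)
  exact ht0 (by ext i; fin_cases i <;> assumption)

end AdaptedBasis

variable {q f : CoordRing}

/-- A basis of `ℂ⁶` adapted to the linkage: `f` is a multiple of `q ≠ 0` on the plane of the first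
three vectors, and `q` is irreducible on the space of the first four. -/
theorem exists_adapted_basis (hq : q.IsHomogeneous 2) (hf : f.IsHomogeneous 3)
    (hsm : IsSmoothOfCodim (intersectionIdeal q f) 2) :
    ∃ (b : Module.Basis (Fin 6) ℂ (Fin 6 → ℂ)) (h : Fin 3 → ℂ),
      (∀ t : Fin 3 → ℂ, eval (∑ k, t k • b (Fin.castLE (by norm_num) k)) f =
        (∑ k, t k * h k) * eval (∑ k, t k • b (Fin.castLE (by norm_num) k)) q) ∧
      (∃ t : Fin 3 → ℂ, eval (∑ k, t k • b (Fin.castLE (by norm_num) k)) q ≠ 0) ∧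
      ∀ l₁ l₂ : (Fin 6 → ℂ) →ₗ[ℂ] ℂ,
        ¬ ∀ x ∈ Submodule.span ℂ (Set.range fun k : Fin 4 => b (Fin.castLE (by norm_num) k)),
          eval x q = l₁ x * l₂ x := by
  obtain ⟨u, h, hu, hfu, t₀, ht₀⟩ := exists_plane_meeting_in_conic hq hf hsm
  obtain ⟨B, hB, hBq, hBg⟩ := exists_polarForm hq
  obtain ⟨p₁, hp₁, p₂, hp₂, v, hnd⟩ := exists_nondegenerate_triple (by simp) hB
    (fun _ _ => not_linearIndependent_of_mem_radical hf hsm hBq hBg)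
    (P := Submodule.span ℂ (Set.range u)) (by rw [finrank_span_eq_card hu]; simp)
    ⟨∑ k, t₀ k • u k, Submodule.sum_mem _ fun k _ => Submodule.smul_mem _ _
      (Submodule.subset_span ⟨k, rfl⟩), by rw [hBq]; simpa using ht₀⟩
  obtain ⟨b, hb, hvb⟩ : ∃ b : Module.Basis (Fin 6) ℂ (Fin 6 → ℂ),
      (∀ k : Fin 3, b (Fin.castLE (by norm_num) k) = u k) ∧
      v ∈ Submodule.span ℂ (Set.range fun k : Fin 4 => b (Fin.castLE (by norm_num) k)) := by
    -- If `v` already lies in the plane, any 3-space through the plane will do.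
    by_cases hv : v ∈ Submodule.span ℂ (Set.range u)
    · obtain ⟨b, hb⟩ := exists_basis_extending (show 3 ≤ 6 by norm_num) hu
      refine ⟨b, hb, Submodule.span_mono ?_ hv⟩
      rintro _ ⟨k, rfl⟩
      exact ⟨Fin.castLE (by norm_num) k, hb k⟩
    · have hli : LinearIndependent ℂ (Fin.snoc u v : Fin 4 → Fin 6 → ℂ) :=
        linearIndependent_finSnoc.mpr ⟨hu, hv⟩
      obtain ⟨b, hb⟩ := exists_basis_extending (show 4 ≤ 6 by norm_num) hli
      refine ⟨b, fun k => ?_, Submodule.subset_span ⟨Fin.last 3, ?_⟩⟩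
      · exact (hb k.castSucc).trans (Fin.snoc_castSucc (α := fun _ => Fin 6 → ℂ) _ _ _)
      · exact (hb (Fin.last 3)).trans (Fin.snoc_last (α := fun _ => Fin 6 → ℂ) _ _)
  have hPA : Submodule.span ℂ (Set.range u) ≤
      Submodule.span ℂ (Set.range fun k : Fin 4 => b (Fin.castLE (by norm_num) k)) := by
    refine Submodule.span_mono ?_
    rintro _ ⟨k, rfl⟩
    exact ⟨Fin.castLE (by norm_num) k, hb k⟩
  refine ⟨b, h, ?_, ⟨t₀, ?_⟩, fun l₁ l₂ hl => ?_⟩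
  · simpa only [hb] using hfu
  · simpa only [hb] using ht₀
  · refine not_product_of_nondegenerate_triple hnd l₁ l₂ (hPA hp₁) (hPA hp₂) hvb
      fun x hx y hy => ?_
    have h1 := hBq (x + y)
    rw [hl _ (Submodule.add_mem _ hx hy), map_add, map_add, map_add, LinearMap.add_apply,
      LinearMap.add_apply, hBq, hBq, hB y x, hl x hx, hl y hy, map_add] at h1
    linear_combination h1 / 2

/-! ### Regular sequences and linkage in a prime ideal. -/

section RegularSequences

variable {R : Type*} [CommRing R]

theorem isRegular_iff_forall_mem (rs : List R) : RingTheory.Sequence.IsRegular R rs ↔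
    (∀ (i : ℕ) (h : i < rs.length) (x : R), rs[i] * x ∈ Ideal.ofList (rs.take i) →
      x ∈ Ideal.ofList (rs.take i)) ∧ Ideal.ofList rs ≠ ⊤ := by
  rw [RingTheory.Sequence.isRegular_iff, RingTheory.Sequence.isWeaklyRegular_iff]
  simp only [isSMulRegular_quotient_iff_mem_of_smul_mem, smul_eq_mul, Ideal.mul_top, ne_comm]

/-- A sequence whose initial segments generate prime ideals is regular. -/
theorem isRegular_of_isPrime {rs : List R}
    (h : ∀ (i : ℕ) (h : i < rs.length), (Ideal.ofList (rs.take i)).IsPrime ∧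
      rs[i] ∉ Ideal.ofList (rs.take i)) (htop : Ideal.ofList rs ≠ ⊤) :
    RingTheory.Sequence.IsRegular R rs := by
  rw [isRegular_iff_forall_mem]
  exact ⟨fun i hi x hx => ((h i hi).1.mem_or_mem hx).resolve_left (h i hi).2, htop⟩

/-- Linkage in a hypersurface section `y g` of an integral scheme. -/
theorem areLinked_sup_span_mul {Q : Ideal R} (hQ : Q.IsPrime) {y g : R} (hy : y ∉ Q) :
    Submodule.colon (Q ⊔ Ideal.span {y * g}) ((Q ⊔ Ideal.span {y} : Ideal R) : Set R) =
      Q ⊔ Ideal.span {g} := by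
  ext a
  rw [Submodule.mem_colon]
  constructor
  · intro h
    have h1 := h y (Ideal.mem_sup_right (Ideal.mem_span_singleton_self y))
    obtain ⟨u, hu, w, hw, huw⟩ := Submodule.mem_sup.mp h1
    obtain ⟨c, rfl⟩ := Ideal.mem_span_singleton.mp hw
    have h2 : y * (a - g * c) ∈ Q := by
      have : y * (a - g * c) = u := by
        rw [smul_eq_mul] at huw
        linear_combination -huw
      rwa [this]
    have h3 := (hQ.mem_or_mem h2).resolve_left hy
    rw [show a = (a - g * c) + g * c by ring]
    exact Ideal.add_mem _ (Ideal.mem_sup_left h3)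
      (Ideal.mem_sup_right (Ideal.mul_mem_right _ _ (Ideal.mem_span_singleton_self g)))
  · intro h s hs
    obtain ⟨u, hu, w, hw, rfl⟩ := Submodule.mem_sup.mp h
    obtain ⟨c, rfl⟩ := Ideal.mem_span_singleton.mp hw
    obtain ⟨u', hu', w', hw', rfl⟩ := Submodule.mem_sup.mp hs
    obtain ⟨c', rfl⟩ := Ideal.mem_span_singleton.mp hw'
    rw [smul_eq_mul, show (u + g * c) * (u' + y * c') =
      (u * (u' + y * c') + g * c * u') + y * g * (c * c') by ring]
    exact Ideal.add_mem _ (Ideal.mem_sup_left (Ideal.add_mem _ (Ideal.mul_mem_right _ _ hu)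
      (Ideal.mul_mem_left _ _ hu')))
      (Ideal.mem_sup_right (Ideal.mul_mem_right _ _ (Ideal.mem_span_singleton_self _)))

end RegularSequences

/-! ### Homogeneous components and reducible quadrics. -/

section Homogeneous

variable {σ : Type*}

theorem homogeneousComponent_mul_of_isHomogeneous {R : Type*} [CommSemiring R]
    {p : MvPolynomial σ R} {m : ℕ} (hp : p.IsHomogeneous m) (n : ℕ) (a : MvPolynomial σ R) :
    homogeneousComponent (m + n) (p * a) = p * homogeneousComponent n a := by
  conv_lhs => rw [← sum_homogeneousComponent a, Finset.mul_sum, map_sum]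
  rw [Finset.sum_congr rfl fun i _ =>
    homogeneousComponent_of_mem (hp.mul (homogeneousComponent_isHomogeneous i a))]
  simp only [Nat.add_left_cancel_iff, Finset.sum_ite_eq, Finset.mem_range]
  split_ifs with h
  · rfl
  · rw [homogeneousComponent_eq_zero _ _ (by omega), mul_zero]

/-- A reducible quadratic form is a product of linear forms. -/
theorem irreducible_of_not_product {q : MvPolynomial σ ℂ} (hq : q.IsHomogeneous 2) (h0 : q ≠ 0)
    (h : ∀ l₁ l₂ : MvPolynomial σ ℂ, l₁.IsHomogeneous 1 → l₂.IsHomogeneous 1 → q ≠ l₁ * l₂) :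
    Irreducible q := by
  have hunit : ∀ a : MvPolynomial σ ℂ, a ≠ 0 → a.totalDegree = 0 → IsUnit a := by
    intro a ha hdeg
    rw [totalDegree_eq_zero_iff_eq_C] at hdeg
    rw [hdeg] at ha ⊢
    exact (IsUnit.mk0 _ (fun h => ha (by rw [h, map_zero]))).map C
  refine ⟨fun hu => ?_, fun a b hab => ?_⟩
  · have h1 := hu.map (constantCoeff (σ := σ) (R := ℂ))
    rw [show constantCoeff q = 0 from hq.coeff_eq_zero (by simp)] at h1
    exact not_isUnit_zero h1
  · by_contra! hno
    have ha : a ≠ 0 := fun h => h0 (by rw [hab, h, zero_mul])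
    have hb : b ≠ 0 := fun h => h0 (by rw [hab, h, mul_zero])
    have hdeg := totalDegree_mul_of_isDomain ha hb
    rw [← hab, hq.totalDegree h0] at hdeg
    have ha1 : a.totalDegree ≠ 0 := fun h => hno.1 (hunit a ha h)
    have hb1 : b.totalDegree ≠ 0 := fun h => hno.2 (hunit b hb h)
    have hsum : ∀ a : MvPolynomial σ ℂ, a.totalDegree = 1 →
        a = homogeneousComponent 0 a + homogeneousComponent 1 a := by
      intro a h
      have := sum_homogeneousComponent a
      rw [h, Finset.sum_range_succ, Finset.sum_range_one] at this
      exact this.symm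
    have hc : ∀ (i : ℕ) (a : MvPolynomial σ ℂ), (homogeneousComponent i a).IsHomogeneous i :=
      fun i a => homogeneousComponent_isHomogeneous i a
    refine h _ _ (hc 1 a) (hc 1 b) ?_
    have e : q = homogeneousComponent 0 a * homogeneousComponent 0 b +
        (homogeneousComponent 0 a * homogeneousComponent 1 b +
          homogeneousComponent 1 a * homogeneousComponent 0 b) +
        homogeneousComponent 1 a * homogeneousComponent 1 b := by
      rw [hab]
      nth_rewrite 1 [hsum a (by omega)]
      nth_rewrite 1 [hsum b (by omega)]
      ring
    have e2 := congrArg (homogeneousComponent 2) e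
    rw [map_add, map_add, homogeneousComponent_of_mem hq,
      homogeneousComponent_of_mem ((hc 0 a).mul (hc 0 b)),
      homogeneousComponent_of_mem (((hc 0 a).mul (hc 1 b)).add ((hc 1 a).mul (hc 0 b))),
      homogeneousComponent_of_mem ((hc 1 a).mul (hc 1 b))] at e2
    simpa using e2

end Homogeneous

/-! ### Linear subspaces and their quadric sections in coordinates. -/

section Coordinates

variable (b : Module.Basis (Fin 6) ℂ (Fin 6 → ℂ))

/-- The coordinates with respect to a basis, as linear forms. -/
def coordForm (i : Fin 6) : CoordRing := ∑ j, C (b.repr (Pi.single j 1) i) * X j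

theorem coordForm_isHomogeneous (i : Fin 6) : (coordForm b i).IsHomogeneous 1 :=
  IsHomogeneous.sum _ _ _ fun _ _ => isHomogeneous_C_mul_X _ _

theorem eval_coordForm (i : Fin 6) (x : Fin 6 → ℂ) : eval x (coordForm b i) = b.repr x i := by
  have h : x = ∑ j, x j • (Pi.single j 1 : Fin 6 → ℂ) := by
    ext k
    simp [Pi.single_apply]
  conv_rhs => rw [h]
  simp [coordForm, mul_comm]

/-- Restriction, in the coordinates of the basis, to the linear subspace on which the coordinates
in `S` vanish. -/
def restrictCoord (S : List (Fin 6)) : CoordRing →ₐ[ℂ] CoordRing :=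
  aeval fun j => ∑ i, C (if i ∈ S then 0 else b i j) * X i

theorem eval_restrictCoord (S : List (Fin 6)) (x : Fin 6 → ℂ) (p : CoordRing) :
    eval x (restrictCoord b S p) = eval (∑ i, (if i ∈ S then 0 else x i) • b i) p := by
  rw [restrictCoord, eval_aeval_linear]
  congr 2
  ext j
  simp only [Finset.sum_apply, Pi.smul_apply, smul_eq_mul]
  refine Finset.sum_congr rfl fun i _ => ?_
  split_ifs <;> ring

theorem restrictCoord_isHomogeneous (S : List (Fin 6)) {p : CoordRing} {d : ℕ}
    (hp : p.IsHomogeneous d) : (restrictCoord b S p).IsHomogeneous d := by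
  rw [← one_mul d]
  exact hp.aeval (fun j => ∑ i, C (if i ∈ S then 0 else b i j) * X i) (n := 1) fun j =>
    IsHomogeneous.sum _ _ _ fun _ _ => isHomogeneous_C_mul_X _ _

theorem restrictCoord_coordForm (S : List (Fin 6)) (i : Fin 6) :
    restrictCoord b S (coordForm b i) = if i ∈ S then 0 else X i := by
  refine MvPolynomial.funext fun x => ?_
  rw [eval_restrictCoord, eval_coordForm]
  simp only [map_sum, map_smul, Module.Basis.repr_self, Finsupp.coe_finsetSum, Finset.sum_apply,
    Finsupp.smul_apply, Finsupp.single_apply, smul_eq_mul, mul_ite, mul_one, mul_zero,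
    Finset.sum_ite_eq', Finset.mem_univ, if_true]
  split_ifs <;> simp

theorem X_eq_sum_coordForm (j : Fin 6) :
    (X j : CoordRing) = ∑ i, C (b i j) * coordForm b i := by
  refine MvPolynomial.funext fun x => ?_
  have := congrFun (b.sum_repr x) j
  simp only [Finset.sum_apply, Pi.smul_apply, smul_eq_mul] at this
  simp only [eval_X, map_sum, map_mul, eval_C, eval_coordForm]
  rw [← this]
  exact Finset.sum_congr rfl fun i _ => by ring

theorem sub_aeval_restrictCoord_mem (S : List (Fin 6)) (p : CoordRing) :
    p - aeval (coordForm b) (restrictCoord b S p) ∈ Ideal.ofList (S.map (coordForm b)) := by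
  set I := Ideal.ofList (S.map (coordForm b)) with hI
  have h : (Ideal.Quotient.mkₐ ℂ I) =
      ((Ideal.Quotient.mkₐ ℂ I).comp (aeval (coordForm b))).comp (restrictCoord b S) := by
    refine MvPolynomial.algHom_ext fun j => ?_
    rw [AlgHom.comp_apply, AlgHom.comp_apply, ← sub_eq_zero, ← map_sub,
      Ideal.Quotient.mkₐ_eq_mk, Ideal.Quotient.eq_zero_iff_mem, restrictCoord, aeval_X, map_sum]
    nth_rewrite 1 [X_eq_sum_coordForm b j]
    rw [← Finset.sum_sub_distrib]
    refine Ideal.sum_mem _ fun i _ => ?_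
    by_cases hi : i ∈ S
    · simp only [hi, if_true, map_zero, zero_mul, sub_zero]
      exact Ideal.mul_mem_left _ _ (Ideal.subset_span (List.mem_map_of_mem hi))
    · simp [hi]
  have := DFunLike.congr_fun h p
  rwa [AlgHom.comp_apply, AlgHom.comp_apply, ← sub_eq_zero, ← map_sub,
      Ideal.Quotient.mkₐ_eq_mk, Ideal.Quotient.eq_zero_iff_mem] at this

theorem restrictCoord_of_mem (S : List (Fin 6)) {p : CoordRing}
    (hp : p ∈ Ideal.ofList (S.map (coordForm b))) : restrictCoord b S p = 0 := by
  have h : Ideal.ofList (S.map (coordForm b)) ≤ RingHom.ker (restrictCoord b S) := by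
    rw [Ideal.span_le]
    rintro r hr
    obtain ⟨i, hi, rfl⟩ := List.mem_map.mp hr
    exact (restrictCoord_coordForm b S i).trans (if_pos hi)
  exact h hp

theorem mem_ofList_coordForm_iff (S : List (Fin 6)) (p : CoordRing) :
    p ∈ Ideal.ofList (S.map (coordForm b)) ↔ restrictCoord b S p = 0 := by
  refine ⟨restrictCoord_of_mem b S, fun h => ?_⟩
  have := sub_aeval_restrictCoord_mem b S p
  rwa [h, map_zero, sub_zero] at this

theorem ofList_coordForm_isPrime (S : List (Fin 6)) :
    (Ideal.ofList (S.map (coordForm b))).IsPrime := by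
  have : Ideal.ofList (S.map (coordForm b)) = RingHom.ker (restrictCoord b S) := by
    ext p
    exact mem_ofList_coordForm_iff b S p
  rw [this]
  exact RingHom.ker_isPrime _

theorem mem_sup_span_iff (S : List (Fin 6)) (q p : CoordRing) :
    p ∈ Ideal.ofList (S.map (coordForm b)) ⊔ Ideal.span {q} ↔
      restrictCoord b S q ∣ restrictCoord b S p := by
  constructor
  · intro h
    obtain ⟨u, hu, w, hw, rfl⟩ := Submodule.mem_sup.mp h
    obtain ⟨c, rfl⟩ := Ideal.mem_span_singleton.mp hw
    rw [map_add, restrictCoord_of_mem b S hu, zero_add, map_mul]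
    exact dvd_mul_right _ _
  · rintro ⟨c, hc⟩
    have h1 := sub_aeval_restrictCoord_mem b S p
    have h2 := sub_aeval_restrictCoord_mem b S q
    rw [hc, map_mul] at h1
    set I := Ideal.ofList (S.map (coordForm b))
    rw [show p = (p - aeval (coordForm b) (restrictCoord b S q) * aeval (coordForm b) c) -
      (q - aeval (coordForm b) (restrictCoord b S q)) * aeval (coordForm b) c +
        q * aeval (coordForm b) c by ring]
    exact Ideal.add_mem _ (Ideal.mem_sup_left (Ideal.sub_mem _ h1 (Ideal.mul_mem_right _ _ h2)))
      (Ideal.mem_sup_right (Ideal.mul_mem_right _ _ (Ideal.mem_span_singleton_self q)))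

/-- The ideal is the preimage under restriction of the principal ideal of the restricted form, and
irreducible elements of a polynomial ring are prime. -/
theorem sup_span_isPrime (S : List (Fin 6)) {q : CoordRing}
    (hq : Irreducible (restrictCoord b S q)) :
    (Ideal.ofList (S.map (coordForm b)) ⊔ Ideal.span {q}).IsPrime := by
  have : Ideal.ofList (S.map (coordForm b)) ⊔ Ideal.span {q} =
      (Ideal.span {restrictCoord b S q}).comap (restrictCoord b S) := by
    ext p
    rw [mem_sup_span_iff, Ideal.mem_comap, Ideal.mem_span_singleton]
  rw [this]
  have := (Ideal.span_singleton_prime hq.ne_zero).mpr hq.prime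
  exact Ideal.comap_isPrime _ _

end Coordinates

/-! ### Regular sequences of two and four elements. -/

section

variable {R : Type*} [CommRing R]

theorem mem_ofList_cons {r x : R} {rs : List R} :
    x ∈ Ideal.ofList (r :: rs) ↔ ∃ u, ∃ y ∈ Ideal.ofList rs, x = r * u + y := by
  rw [Ideal.ofList_cons, Submodule.mem_sup]
  constructor
  · rintro ⟨v, hv, y, hy, rfl⟩
    obtain ⟨u, rfl⟩ := Ideal.mem_span_singleton.mp hv
    exact ⟨u, y, hy, rfl⟩
  · rintro ⟨u, y, hy, rfl⟩
    exact ⟨r * u, Ideal.mul_mem_right _ _ (Ideal.mem_span_singleton_self r), y, hy, rfl⟩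

theorem mem_ofList_nil {x : R} : x ∈ Ideal.ofList ([] : List R) ↔ x = 0 := by
  rw [Ideal.ofList_nil, Ideal.mem_bot]

theorem ofList_triple (a b c : R) :
    Ideal.ofList [a, b, c] = Ideal.ofList [a, b] ⊔ Ideal.span {c} := by
  rw [← Ideal.ofList_singleton, ← Ideal.ofList_append]
  rfl

theorem ofList_quadruple (a b c d : R) :
    Ideal.ofList [a, b, c, d] = Ideal.ofList [a, b, c] ⊔ Ideal.span {d} := by
  rw [← Ideal.ofList_singleton, ← Ideal.ofList_append]
  rfl

theorem isRegular_pair_of_isPrime [IsDomain R] {a b : R} (ha : a ≠ 0)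
    (h1 : (Ideal.ofList [a]).IsPrime) (hb : b ∉ Ideal.ofList [a])
    (htop : Ideal.ofList [a, b] ≠ ⊤) : RingTheory.Sequence.IsRegular R [a, b] := by
  refine isRegular_of_isPrime (fun i hi => ?_) htop
  simp only [List.length_cons, List.length_nil] at hi
  interval_cases i
  · rw [List.take_zero, Ideal.ofList_nil]
    exact ⟨Ideal.isPrime_bot, ha⟩
  · exact ⟨h1, hb⟩

theorem isRegular_quadruple_of_isPrime [IsDomain R] {a b c d : R} (ha : a ≠ 0)
    (h1 : (Ideal.ofList [a]).IsPrime) (hb : b ∉ Ideal.ofList [a])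
    (h2 : (Ideal.ofList [a, b]).IsPrime) (hc : c ∉ Ideal.ofList [a, b])
    (h3 : (Ideal.ofList [a, b, c]).IsPrime) (hd : d ∉ Ideal.ofList [a, b, c])
    (htop : Ideal.ofList [a, b, c, d] ≠ ⊤) : RingTheory.Sequence.IsRegular R [a, b, c, d] := by
  refine isRegular_of_isPrime (fun i hi => ?_) htop
  simp only [List.length_cons, List.length_nil] at hi
  interval_cases i
  · rw [List.take_zero, Ideal.ofList_nil]
    exact ⟨Ideal.isPrime_bot, ha⟩
  · exact ⟨h1, hb⟩
  · exact ⟨h2, hc⟩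
  · exact ⟨h3, hd⟩

theorem ofList_ne_top_of_constantCoeff {σ : Type*} {rs : List (MvPolynomial σ ℂ)}
    (h : ∀ r ∈ rs, constantCoeff r = 0) : Ideal.ofList rs ≠ ⊤ := by
  have hle : Ideal.ofList rs ≤ RingHom.ker (constantCoeff (σ := σ) (R := ℂ)) := by
    rw [Ideal.span_le]
    exact h
  intro htop
  rw [htop, top_le_iff] at hle
  exact RingHom.ker_ne_top _ hle

end

theorem constantCoeff_of_isHomogeneous {σ : Type*} {p : MvPolynomial σ ℂ} {d : ℕ}
    (hp : p.IsHomogeneous (d + 1)) : constantCoeff p = 0 :=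
  hp.coeff_eq_zero (by simp)

theorem exists_linearMap_eval {n : ℕ} {l : MvPolynomial (Fin n) ℂ} (hl : l.IsHomogeneous 1) :
    ∃ A : (Fin n → ℂ) →ₗ[ℂ] ℂ, ∀ x, eval x l = A x := by
  have hl' : l ∈ homogeneousSubmodule (Fin n) ℂ 1 := hl
  rw [homogeneousSubmodule_one_eq_span_X] at hl'
  induction hl' using Submodule.span_induction with
  | mem l h =>
    obtain ⟨i, rfl⟩ := h
    exact ⟨LinearMap.proj i, fun x => by simp⟩
  | zero => exact ⟨0, fun x => by simp⟩
  | add p q hp hq ihp ihq =>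
    rw [← homogeneousSubmodule_one_eq_span_X] at hp hq
    obtain ⟨A, hA⟩ := ihp hp
    obtain ⟨B, hB⟩ := ihq hq
    exact ⟨A + B, fun x => by simp [hA, hB]⟩
  | smul c p hp ih =>
    rw [← homogeneousSubmodule_one_eq_span_X] at hp
    obtain ⟨A, hA⟩ := ih hp
    exact ⟨c • A, fun x => by simp [hA]⟩

/-! ### The linked conic and quartic. -/

section

variable {q f : CoordRing}

/-- A smooth threefold `V` contains no quadric surface cut out by a 3-space. -/
theorem notMem_ofList_of_smooth (hq : q.IsHomogeneous 2) (hf : f.IsHomogeneous 3)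
    (hsm : IsSmoothOfCodim (intersectionIdeal q f) 2) {l₁ l₂ : CoordRing}
    (h₁ : l₁.IsHomogeneous 1) (h₂ : l₂.IsHomogeneous 1) : f ∉ Ideal.ofList [l₁, l₂, q] := by
  intro hmem
  rw [smooth_intersectionIdeal_iff] at hsm
  simp only [mem_ofList_cons, mem_ofList_nil] at hmem
  obtain ⟨u, y, ⟨v, z, ⟨w, o, rfl, rfl⟩, rfl⟩, hfe⟩ := hmem
  have hc : ∀ (i : ℕ) (a : CoordRing), (homogeneousComponent i a).IsHomogeneous i :=
    fun i a => homogeneousComponent_isHomogeneous i a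
  have e : f = l₁ * homogeneousComponent 2 u + l₂ * homogeneousComponent 2 v +
      q * homogeneousComponent 1 w := by
    have := congrArg (homogeneousComponent 3) hfe
    rwa [homogeneousComponent_of_mem hf, if_pos rfl, add_zero, map_add, map_add,
      homogeneousComponent_mul_of_isHomogeneous h₁ 2,
      homogeneousComponent_mul_of_isHomogeneous h₂ 2,
      homogeneousComponent_mul_of_isHomogeneous hq 1, ← add_assoc] at this
  -- With f = l₁u + l₂v + qw, the five forms l₁, l₂, u, v, q have a common zero in ℙ⁵. There ∇f = w
  -- ∇q, so V is singular.
  obtain ⟨x, hx, h0⟩ := exists_ne_zero_common_zero (show 5 < 6 by norm_num)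
    ![l₁, l₂, homogeneousComponent 2 u, homogeneousComponent 2 v, q] fun i => by
      have : ∀ {d : ℕ} {p : CoordRing}, p.IsHomogeneous (d + 1) → eval 0 p = 0 := fun hp => by
        rw [eval_zero]; exact constantCoeff_of_isHomogeneous hp
      fin_cases i
      · exact this h₁
      · exact this h₂
      · exact this (hc 2 u)
      · exact this (hc 2 v)
      · exact this hq
  have z1 : eval x l₁ = 0 := h0 0
  have z2 : eval x l₂ = 0 := h0 1
  have z3 : eval x (homogeneousComponent 2 u) = 0 := h0 2
  have z4 : eval x (homogeneousComponent 2 v) = 0 := h0 3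
  have z5 : eval x q = 0 := h0 4
  have hfx : eval x f = 0 := by rw [e]; simp [z1, z2, z5]
  have hgr : gradientAt f x = eval x (homogeneousComponent 1 w) • gradientAt q x := by
    ext i
    rw [gradientAt, e]
    simp [gradientAt, z1, z2, z3, z4, z5]
  exact one_ne_zero (hsm x hx z5 hfx (-eval x (homogeneousComponent 1 w)) 1 (by
    rw [hgr]; module)).2

theorem exists_linked_conic_and_quartic (hq : q.IsHomogeneous 2) (hf : f.IsHomogeneous 3)
    (hsm : IsSmoothOfCodim (intersectionIdeal q f) 2) :
    ∃ L K E : Ideal CoordRing, IsThreeSpace L ∧ IsConic K ∧ IsEllipticQuartic E ∧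
      L ≤ K ∧ L ≤ E ∧ intersectionIdeal q f ≤ K ∧ intersectionIdeal q f ≤ E ∧
      IsCompleteIntersection [1, 1, 2, 3] (L ⊔ intersectionIdeal q f) ∧
      AreLinkedIn (L ⊔ intersectionIdeal q f) K E := by
  obtain ⟨b, h, hfe, ⟨t, ht⟩, hirr⟩ := exists_adapted_basis hq hf hsm
  have hl := coordForm_isHomogeneous b
  -- The 3-space is x₄ = x₅ = 0 and the plane is x₄ = x₅ = x₃ = 0; the order 4, 5, 3 is that of the
  -- generators l₁, l₂, y below.
  have hplane : ∀ x : Fin 6 → ℂ, ∑ i, (if i ∈ ([4, 5, 3] : List (Fin 6)) then 0 else x i) • b i =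
      ∑ k : Fin 3, x (Fin.castLE (by norm_num) k) • b (Fin.castLE (by norm_num) k) := by
    intro x
    simp [Fin.sum_univ_six, Fin.sum_univ_three]
  have hq3 : restrictCoord b [4, 5, 3] q ≠ 0 := by
    intro h0
    have h1 := congrArg (eval ![t 0, t 1, t 2, 0, 0, 0]) h0
    rw [eval_restrictCoord, hplane, map_zero] at h1
    refine ht ?_
    rw [← h1]
    congr 2
  have hqres : Irreducible (restrictCoord b [4, 5] q) := by
    have hspan : ∀ x ∈ Submodule.span ℂ
        (Set.range fun k : Fin 4 => b (Fin.castLE (by norm_num) k)),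
        eval x q = eval (b.repr x) (restrictCoord b [4, 5] q) := by
      intro x hx
      have hz : ∀ j : Fin 6, 4 ≤ j → b.repr x j = 0 := by
        intro j hj
        have hle : Submodule.span ℂ (Set.range fun k : Fin 4 => b (Fin.castLE (by norm_num) k)) ≤
            LinearMap.ker (b.coord j) := by
          rw [Submodule.span_le]
          rintro _ ⟨k, rfl⟩
          have hne : Fin.castLE (by norm_num) k ≠ j := by
            intro h
            rw [← h, Fin.le_def, Fin.val_castLE] at hj
            have := k.2
            change 4 ≤ (k : ℕ) at hj
            omega
          simp [hne]
        exact hle hx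
      rw [eval_restrictCoord]
      congr 2
      conv_lhs => rw [← b.sum_repr x]
      refine Finset.sum_congr rfl fun i _ => ?_
      split_ifs with hi
      · rw [hz i (by fin_cases i <;> simp_all [Fin.le_def])]
      · rfl
    refine irreducible_of_not_product (restrictCoord_isHomogeneous b _ hq) ?_ ?_
    · intro h0
      exact hirr 0 0 fun x hx => by rw [hspan x hx, h0]; simp
    · intro l₁ l₂ h₁ h₂ he
      obtain ⟨A₁, hA₁⟩ := exists_linearMap_eval h₁
      obtain ⟨A₂, hA₂⟩ := exists_linearMap_eval h₂
      refine hirr (A₁ ∘ₗ b.equivFun.toLinearMap) (A₂ ∘ₗ b.equivFun.toLinearMap) fun x hx => ?_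
      rw [hspan x hx, he, map_mul, hA₁, hA₂]
      rfl
  let h' : CoordRing := ∑ k : Fin 3, C (h k) * coordForm b (Fin.castLE (by norm_num) k)
  have hh' : h'.IsHomogeneous 1 := IsHomogeneous.sum _ _ _ fun k _ => (hl _).C_mul _
  have hmem : f - h' * q ∈ Ideal.ofList ([4, 5, 3].map (coordForm b)) := by
    rw [mem_ofList_coordForm_iff]
    refine MvPolynomial.funext fun x => ?_
    rw [eval_restrictCoord, hplane, map_sub, map_mul, hfe, map_zero, sub_eq_zero]
    congr 1
    simp only [h', map_sum, map_mul, eval_C, eval_coordForm, map_smul, Module.Basis.repr_self,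
      Finsupp.coe_finsetSum, Finset.sum_apply, Finsupp.smul_apply, Finsupp.single_apply]
    refine Finset.sum_congr rfl fun k _ => ?_
    rw [Finset.sum_eq_single k (fun j _ hj => by simp [Fin.castLE_inj, hj]) (by simp)]
    simp [mul_comm]
  -- Passing to components of degree 3 makes the cofactor `g` of y a quadratic form: it is the
  -- second equation of the residual quartic.
  obtain ⟨c, d, g, hg, hfg⟩ : ∃ c d g : CoordRing, g.IsHomogeneous 2 ∧
      f = h' * q + coordForm b 4 * c + coordForm b 5 * d + coordForm b 3 * g := by
    simp only [List.map_cons, List.map_nil, mem_ofList_cons, mem_ofList_nil] at hmem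
    obtain ⟨u, y, ⟨v, z, ⟨w, o, rfl, rfl⟩, rfl⟩, he⟩ := hmem
    refine ⟨homogeneousComponent 2 u, homogeneousComponent 2 v, homogeneousComponent 2 w,
      homogeneousComponent_isHomogeneous _ _, ?_⟩
    have := congrArg (homogeneousComponent 3) he
    rw [homogeneousComponent_of_mem (hf.sub (hh'.mul hq)), if_pos rfl, add_zero, map_add, map_add,
      homogeneousComponent_mul_of_isHomogeneous (hl _) 2,
      homogeneousComponent_mul_of_isHomogeneous (hl _) 2,
      homogeneousComponent_mul_of_isHomogeneous (hl _) 2] at this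
    linear_combination this
  set y := coordForm b 3
  set l₁ := coordForm b 4
  set l₂ := coordForm b 5
  set Q := Ideal.ofList [l₁, l₂] ⊔ Ideal.span {q} with hQdef
  have hQ : Q.IsPrime := sup_span_isPrime b [4, 5] hqres
  have hfQ : f ∉ Q := by
    rw [hQdef, ← ofList_triple]
    exact notMem_ofList_of_smooth hq hf hsm (hl 4) (hl 5)
  have hqQ : q ∈ Q := Ideal.mem_sup_right (Ideal.mem_span_singleton_self q)
  have hl₁Q : l₁ ∈ Q := Ideal.mem_sup_left (Ideal.subset_span (by simp))
  have hl₂Q : l₂ ∈ Q := Ideal.mem_sup_left (Ideal.subset_span (by simp))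
  have hrest : h' * q + l₁ * c + l₂ * d ∈ Q := Ideal.add_mem _ (Ideal.add_mem _
    (Ideal.mul_mem_left _ _ hqQ) (Ideal.mul_mem_right _ _ hl₁Q)) (Ideal.mul_mem_right _ _ hl₂Q)
  -- Since `f` does not vanish on the integral quadric surface, neither y nor g does, so each can be
  -- cancelled modulo `Q`.
  have hygQ : y * g ∉ Q := by
    intro h0
    refine hfQ ?_
    rw [hfg]
    exact Ideal.add_mem _ hrest h0
  have hyQ : y ∉ Q := fun h0 => hygQ (Ideal.mul_mem_right _ _ h0)
  have hgQ : g ∉ Q := fun h0 => hygQ (Ideal.mul_mem_left _ _ h0)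
  have hJ : Ideal.ofList [l₁, l₂] ⊔ intersectionIdeal q f = Q ⊔ Ideal.span {f} := by
    rw [intersectionIdeal, Ideal.span_insert, sup_assoc]
  have hJ' : Q ⊔ Ideal.span {f} = Q ⊔ Ideal.span {y * g} := by
    refine le_antisymm (sup_le le_sup_left ?_) (sup_le le_sup_left ?_) <;>
      rw [Ideal.span_singleton_le_iff_mem]
    · rw [hfg]
      exact Ideal.add_mem _ (Ideal.mem_sup_left hrest)
        (Ideal.mem_sup_right (Ideal.mem_span_singleton_self _))
    · rw [show y * g = f - (h' * q + l₁ * c + l₂ * d) by rw [hfg]; ring]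
      exact Ideal.sub_mem _ (Ideal.mem_sup_right (Ideal.mem_span_singleton_self _))
        (Ideal.mem_sup_left hrest)
  have hK : Ideal.ofList [l₁, l₂, y, q] = Q ⊔ Ideal.span {y} := by
    rw [ofList_quadruple, ofList_triple, hQdef, sup_right_comm]
  have hE : Ideal.ofList [l₁, l₂, q, g] = Q ⊔ Ideal.span {g} := by
    rw [ofList_quadruple, ofList_triple]
  have hJlist : Ideal.ofList [l₁, l₂, q, f] = Q ⊔ Ideal.span {f} := by
    rw [ofList_quadruple, ofList_triple]
  have hl₁0 : l₁ ≠ 0 := by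
    intro h0
    have := restrictCoord_coordForm b [] 4
    rw [show coordForm b 4 = 0 from h0, map_zero] at this
    exact X_ne_zero (R := ℂ) (4 : Fin 6) (by simpa using this.symm)
  have hX : ∀ (S : List (Fin 6)) (i : Fin 6), i ∉ S →
      coordForm b i ∉ Ideal.ofList (S.map (coordForm b)) := by
    intro S i hi
    rw [mem_ofList_coordForm_iff, restrictCoord_coordForm, if_neg hi]
    exact X_ne_zero i
  have p1 : (Ideal.ofList [l₁]).IsPrime := ofList_coordForm_isPrime b [4]
  have p2 : (Ideal.ofList [l₁, l₂]).IsPrime := ofList_coordForm_isPrime b [4, 5]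
  have p3 : (Ideal.ofList [l₁, l₂, y]).IsPrime := ofList_coordForm_isPrime b [4, 5, 3]
  have hl₂' : l₂ ∉ Ideal.ofList [l₁] := hX [4] 5 (by decide)
  have hy' : y ∉ Ideal.ofList [l₁, l₂] := hX [4, 5] 3 (by decide)
  have hqy : q ∉ Ideal.ofList [l₁, l₂, y] := fun h0 =>
    hq3 ((mem_ofList_coordForm_iff b [4, 5, 3] q).mp h0)
  have hq' : q ∉ Ideal.ofList [l₁, l₂] := fun h0 =>
    hqres.ne_zero ((mem_ofList_coordForm_iff b [4, 5] q).mp h0)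
  have pQ : (Ideal.ofList [l₁, l₂, q]).IsPrime := by rwa [ofList_triple]
  have cl₁ : constantCoeff l₁ = 0 := constantCoeff_of_isHomogeneous (hl 4)
  have cl₂ : constantCoeff l₂ = 0 := constantCoeff_of_isHomogeneous (hl 5)
  have cy : constantCoeff y = 0 := constantCoeff_of_isHomogeneous (hl 3)
  have cq := constantCoeff_of_isHomogeneous hq
  have cf := constantCoeff_of_isHomogeneous hf
  have cg := constantCoeff_of_isHomogeneous hg
  have t1 : Ideal.ofList [l₁, l₂] ≠ ⊤ :=
    ofList_ne_top_of_constantCoeff (by simp [cl₁, cl₂])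
  have t2 : Ideal.ofList [l₁, l₂, y, q] ≠ ⊤ :=
    ofList_ne_top_of_constantCoeff (by simp [cl₁, cl₂, cy, cq])
  have t3 : Ideal.ofList [l₁, l₂, q, g] ≠ ⊤ :=
    ofList_ne_top_of_constantCoeff (by simp [cl₁, cl₂, cq, cg])
  have t4 : Ideal.ofList [l₁, l₂, q, f] ≠ ⊤ :=
    ofList_ne_top_of_constantCoeff (by simp [cl₁, cl₂, cq, cf])
  refine ⟨Ideal.ofList [l₁, l₂], Ideal.ofList [l₁, l₂, y, q], Ideal.ofList [l₁, l₂, q, g],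
    ⟨_, .cons (hl 4) (.cons (hl 5) .nil), isRegular_pair_of_isPrime hl₁0 p1 hl₂'
      t1, rfl⟩,
    ⟨_, .cons (hl 4) (.cons (hl 5) (.cons (hl 3) (.cons hq .nil))),
      isRegular_quadruple_of_isPrime hl₁0 p1 hl₂' p2 hy' p3 hqy
      t2, rfl⟩,
    ⟨_, .cons (hl 4) (.cons (hl 5) (.cons hq (.cons hg .nil))),
      isRegular_quadruple_of_isPrime hl₁0 p1 hl₂' p2 hq' pQ (by rwa [ofList_triple])
      t3, rfl⟩,
    ?_, ?_, ?_, ?_, ?_, ?_⟩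
  · rw [hK]
    exact le_sup_left.trans le_sup_left
  · rw [hE]
    exact le_sup_left.trans le_sup_left
  · rw [hK]
    refine le_trans le_sup_right (hJ.le.trans ?_)
    rw [hJ']
    exact sup_le_sup_left (Ideal.span_singleton_le_span_singleton.mpr (dvd_mul_right _ _)) _
  · rw [hE]
    refine le_trans le_sup_right (hJ.le.trans ?_)
    rw [hJ']
    exact sup_le_sup_left (Ideal.span_singleton_le_span_singleton.mpr (dvd_mul_left _ _)) _
  · refine ⟨[l₁, l₂, q, f], .cons (hl 4) (.cons (hl 5) (.cons hq (.cons hf .nil))),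
      isRegular_quadruple_of_isPrime hl₁0 p1 hl₂' p2 hq' pQ (by rwa [ofList_triple])
      t4, ?_⟩
    rw [hJ, hJlist]
  · rw [hJ, hJ', hK, hE]
    refine ⟨sup_le_sup_left (Ideal.span_singleton_le_span_singleton.mpr (dvd_mul_right _ _)) _,
      sup_le_sup_left (Ideal.span_singleton_le_span_singleton.mpr (dvd_mul_left _ _)) _,
      areLinked_sup_span_mul hQ hyQ, ?_⟩
    rw [mul_comm y g]
    exact areLinked_sup_span_mul hQ hgQ

end

/-! ### Polynomial functions and the Zariski topology. -/

section PolynomialFunctions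

variable {W N : Type*} [AddCommGroup W] [Module ℂ W] [AddCommGroup N] [Module ℂ N]

/-- The algebra of polynomial functions on a vector space. -/
def polyFun (W : Type*) [AddCommGroup W] [Module ℂ W] : Subalgebra ℂ (W → ℂ) :=
  Algebra.adjoin ℂ (Set.range fun (l : Module.Dual ℂ W) (w : W) => l w)

theorem dual_mem_polyFun (l : W →ₗ[ℂ] ℂ) : (fun w => l w) ∈ polyFun W :=
  Algebra.subset_adjoin ⟨l, rfl⟩

theorem const_mem_polyFun (c : ℂ) : (fun _ : W => c) ∈ polyFun W :=
  (polyFun W).algebraMap_mem c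

theorem comp_mem_polyFun {φ : W → ℂ} (hφ : φ ∈ polyFun W) (A : N →ₗ[ℂ] W) :
    (fun n => φ (A n)) ∈ polyFun N := by
  induction hφ using Algebra.adjoin_induction with
  | mem φ h =>
    obtain ⟨l, rfl⟩ := h
    exact dual_mem_polyFun (l ∘ₗ A)
  | algebraMap c => exact const_mem_polyFun c
  | add φ ψ _ _ h₁ h₂ => exact (polyFun N).add_mem h₁ h₂
  | mul φ ψ _ _ h₁ h₂ => exact (polyFun N).mul_mem h₁ h₂

theorem bilin_mem_polyFun [FiniteDimensional ℂ W] (β : W →ₗ[ℂ] W →ₗ[ℂ] ℂ) :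
    (fun w => β w w) ∈ polyFun W := by
  let b := Module.finBasis ℂ W
  have h : (fun w => β w w) = ∑ i, ∑ j, (fun w => b.coord i w) * (fun w => b.coord j w) *
      fun _ => β (b i) (b j) := by
    ext w
    conv_lhs => rw [← b.sum_repr w]
    simp only [map_sum, map_smul, LinearMap.sum_apply, LinearMap.smul_apply, smul_eq_mul,
      Finset.sum_apply, Pi.mul_apply, Module.Basis.coord_apply, Finset.mul_sum]
    rw [Finset.sum_comm]
    exact Finset.sum_congr rfl fun i _ => Finset.sum_congr rfl fun j _ => by ring
  rw [h]
  exact Subalgebra.sum_mem _ fun i _ => Subalgebra.sum_mem _ fun j _ =>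
    mul_mem (mul_mem (dual_mem_polyFun _) (dual_mem_polyFun _)) (const_mem_polyFun _)

theorem mem_polyFun_iff {n : ℕ} (b : Module.Basis (Fin n) ℂ W) {φ : W → ℂ} :
    φ ∈ polyFun W ↔ ∃ P : MvPolynomial (Fin n) ℂ, ∀ w, φ w = eval (b.equivFun w) P := by
  constructor
  · intro hφ
    induction hφ using Algebra.adjoin_induction with
    | mem φ h =>
      obtain ⟨l, rfl⟩ := h
      refine ⟨∑ i, C (l (b i)) * X i, fun w => ?_⟩
      change l w = _
      simp only [map_sum, map_mul, eval_C, eval_X]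
      conv_lhs => rw [← b.sum_equivFun w, map_sum]
      exact Finset.sum_congr rfl fun i _ => by rw [map_smul, smul_eq_mul, mul_comm]
    | algebraMap c => exact ⟨C c, fun w => by simp⟩
    | add φ ψ _ _ h₁ h₂ =>
      obtain ⟨P, hP⟩ := h₁
      obtain ⟨Q, hQ⟩ := h₂
      exact ⟨P + Q, fun w => by simp [hP, hQ]⟩
    | mul φ ψ _ _ h₁ h₂ =>
      obtain ⟨P, hP⟩ := h₁
      obtain ⟨Q, hQ⟩ := h₂
      exact ⟨P * Q, fun w => by simp [hP, hQ]⟩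
  · rintro ⟨P, hP⟩
    have hP' : φ = fun w => eval (b.equivFun w) P := funext hP
    rw [hP']
    clear hP hP' φ
    induction P using MvPolynomial.induction_on with
    | C c => simpa using const_mem_polyFun c
    | add P Q h₁ h₂ => simp only [map_add]; exact (polyFun W).add_mem h₁ h₂
    | mul_X P i h =>
      simp only [map_mul, eval_X]
      exact (polyFun W).mul_mem h (dual_mem_polyFun (b.coord i))

/-- This is irreducibility of a vector space in the Zariski topology; density of nonempty principal
open sets rests on it. -/
theorem exists_mul_ne_zero [FiniteDimensional ℂ W] {φ ψ : W → ℂ} (hφ : φ ∈ polyFun W)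
    (hψ : ψ ∈ polyFun W) (h₁ : ∃ w, φ w ≠ 0) (h₂ : ∃ w, ψ w ≠ 0) : ∃ w, φ w * ψ w ≠ 0 := by
  let b := Module.finBasis ℂ W
  obtain ⟨P, hP⟩ := (mem_polyFun_iff b).mp hφ
  obtain ⟨Q, hQ⟩ := (mem_polyFun_iff b).mp hψ
  have hP0 : P ≠ 0 := by
    rintro rfl
    obtain ⟨w, hw⟩ := h₁
    exact hw (by rw [hP, map_zero])
  have hQ0 : Q ≠ 0 := by
    rintro rfl
    obtain ⟨w, hw⟩ := h₂
    exact hw (by rw [hQ, map_zero])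
  by_contra! hno
  refine mul_ne_zero hP0 hQ0 (MvPolynomial.funext fun x => ?_)
  have := hno (b.equivFun.symm x)
  rwa [hP, hQ, LinearEquiv.apply_symm_apply, ← map_mul] at this

theorem isOpen_setOf_ne_zero {φ : W → ℂ} (hφ : φ ∈ polyFun W) :
    @IsOpen W (zariskiTopology W) {w | φ w ≠ 0} :=
  TopologicalSpace.isOpen_generateFrom_of_mem ⟨φ, hφ, rfl⟩

/-- Principal open sets form a basis of the Zariski topology. -/
theorem exists_principal_subset {O : Set W} (hO : @IsOpen W (zariskiTopology W) O) {w : W}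
    (hw : w ∈ O) : ∃ φ ∈ polyFun W, φ w ≠ 0 ∧ ∀ v, φ v ≠ 0 → v ∈ O := by
  induction hO with
  | basic O h =>
    obtain ⟨φ, hφ, rfl⟩ := h
    exact ⟨φ, hφ, hw, fun v hv => hv⟩
  | univ => exact ⟨1, (polyFun W).one_mem, one_ne_zero, fun v _ => Set.mem_univ v⟩
  | inter O₁ O₂ _ _ h₁ h₂ =>
    obtain ⟨φ, hφ, hφw, hφO⟩ := h₁ hw.1
    obtain ⟨ψ, hψ, hψw, hψO⟩ := h₂ hw.2
    refine ⟨φ * ψ, mul_mem hφ hψ, mul_ne_zero hφw hψw, fun v hv => ?_⟩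
    exact ⟨hφO v (left_ne_zero_of_mul hv), hψO v (right_ne_zero_of_mul hv)⟩
  | sUnion S _ h =>
    obtain ⟨O, hOS, hwO⟩ := hw
    obtain ⟨φ, hφ, hφw, hφO⟩ := h O hOS hwO
    exact ⟨φ, hφ, hφw, fun v hv => ⟨O, hOS, hφO v hv⟩⟩

theorem isOpen_of_forall_principal {O : Set W}
    (h : ∀ w ∈ O, ∃ φ ∈ polyFun W, φ w ≠ 0 ∧ ∀ v, φ v ≠ 0 → v ∈ O) :
    @IsOpen W (zariskiTopology W) O := by
  let _ := zariskiTopology W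
  rw [isOpen_iff_forall_mem_open]
  intro w hw
  obtain ⟨φ, hφ, hφw, hφO⟩ := h w hw
  exact ⟨{v | φ v ≠ 0}, hφO, isOpen_setOf_ne_zero hφ, hφw⟩

theorem dense_setOf_ne_zero [FiniteDimensional ℂ W] {φ : W → ℂ} (hφ : φ ∈ polyFun W)
    (h : ∃ w, φ w ≠ 0) : @Dense W (zariskiTopology W) {w | φ w ≠ 0} := by
  let _ := zariskiTopology W
  rw [dense_iff_inter_open]
  rintro O hO ⟨w, hw⟩
  obtain ⟨ψ, hψ, hψw, hψO⟩ := exists_principal_subset hO hw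
  obtain ⟨v, hv⟩ := exists_mul_ne_zero hφ hψ h ⟨w, hψw⟩
  exact ⟨v, hψO v (right_ne_zero_of_mul hv), left_ne_zero_of_mul hv⟩

end PolynomialFunctions

/-! ### Elimination theory. -/

section PolynomialFamilies

variable {W : Type*} [AddCommGroup W] [Module ℂ W] {σ : Type*}

/-- Families of polynomials whose coefficients are polynomial functions of the parameter. -/
def polyFamilies (W : Type*) [AddCommGroup W] [Module ℂ W] (σ : Type*) :
    Subalgebra ℂ (W → MvPolynomial σ ℂ) where
  carrier := {P | ∀ m, (fun w => coeff m (P w)) ∈ polyFun W}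
  mul_mem' {P Q} hP hQ m := by
    classical
    have : (fun w => coeff m ((P * Q) w)) = ∑ x ∈ Finset.HasAntidiagonal.antidiagonal m,
        (fun w => coeff x.1 (P w)) * fun w => coeff x.2 (Q w) := by
      ext w
      simp [coeff_mul]
    rw [this]
    exact Subalgebra.sum_mem _ fun x _ => mul_mem (hP _) (hQ _)
  add_mem' {P Q} hP hQ m := by
    have : (fun w => coeff m ((P + Q) w)) =
        (fun w => coeff m (P w)) + fun w => coeff m (Q w) := by
      ext w
      simp
    rw [this]
    exact add_mem (hP m) (hQ m)
  algebraMap_mem' c m := const_mem_polyFun _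

theorem const_mem_polyFamilies (p : MvPolynomial σ ℂ) : (fun _ : W => p) ∈ polyFamilies W σ :=
  fun _ => const_mem_polyFun _

theorem linearMap_mem_polyFamilies (A : W →ₗ[ℂ] MvPolynomial σ ℂ) :
    (fun w => A w) ∈ polyFamilies W σ :=
  fun m => dual_mem_polyFun (lcoeff ℂ m ∘ₗ A)

theorem det_mem_polyFamilies {c : ℕ} {M : W → Matrix (Fin c) (Fin c) (MvPolynomial σ ℂ)}
    (hM : ∀ i j, (fun w => M w i j) ∈ polyFamilies W σ) :
    (fun w => (M w).det) ∈ polyFamilies W σ := by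
  have : (fun w => (M w).det) = ∑ τ : Equiv.Perm (Fin c),
      (fun _ => ((Equiv.Perm.sign τ : ℤ) : MvPolynomial σ ℂ)) *
        ∏ i, fun w => M w (τ i) i := by
    ext1 w
    simp [Matrix.det_apply']
  rw [this]
  exact Subalgebra.sum_mem _ fun τ _ => mul_mem (const_mem_polyFamilies _)
    (Subalgebra.prod_mem _ fun i _ => hM _ _)

theorem det_mem_polyFun {ι : Type*} [Fintype ι] [DecidableEq ι] {M : W → Matrix ι ι ℂ}
    (hM : ∀ i j, (fun w => M w i j) ∈ polyFun W) : (fun w => (M w).det) ∈ polyFun W := by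
  have : (fun w => (M w).det) = ∑ τ : Equiv.Perm ι,
      (fun _ => ((Equiv.Perm.sign τ : ℤ) : ℂ)) * ∏ i, fun w => M w (τ i) i := by
    ext1 w
    simp [Matrix.det_apply']
  rw [this]
  exact Subalgebra.sum_mem _ fun τ _ => mul_mem (const_mem_polyFun _)
    (Subalgebra.prod_mem _ fun i _ => hM _ _)

/-- Elimination: the condition that a family of forms has no nontrivial common zero is open. -/
theorem exists_polyFun_of_no_common_zero {n : ℕ} {κ : Type*} {P : κ → W → MvPolynomial (Fin n) ℂ}
    (hP : ∀ k, P k ∈ polyFamilies W (Fin n)) {e : κ → ℕ} {E : ℕ} (he : ∀ k, e k ≤ E)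
    (hhom : ∀ k w, (P k w).IsHomogeneous (e k)) {w₀ : W}
    (h₀ : ∀ x ≠ 0, ∃ k, eval x (P k w₀) ≠ 0) :
    ∃ φ ∈ polyFun W, φ w₀ ≠ 0 ∧ ∀ w, φ w ≠ 0 → ∀ x ≠ 0, ∃ k, eval x (P k w) ≠ 0 := by
  classical
  set I₀ := Ideal.span (Set.range fun k => P k w₀) with hI₀
  -- By the Nullstellensatz the forms at `w₀` generate all monomials of some degree `D`, taken at
  -- least `E`. Keeping the homogeneous cofactors fixed while `w` varies gives a square matrix of
  -- coefficients that is the identity at `w₀`; its determinant is φ.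
  have hrad : idealOfVars (Fin n) ℂ ≤ I₀.radical := by
    rw [idealOfVars, Ideal.span_le]
    rintro _ ⟨i, rfl⟩
    rw [← vanishingIdeal_zeroLocus_eq_radical (K := ℂ)]
    intro x hx
    by_cases hx0 : x = 0
    · simp [hx0]
    · obtain ⟨k, hk⟩ := h₀ x hx0
      exact absurd (hx _ (Ideal.subset_span ⟨k, rfl⟩)) (by simpa [aeval_eq_eval] using hk)
  obtain ⟨D₀, hD₀⟩ := Ideal.exists_pow_le_of_le_radical_of_fg hrad
    ⟨Finset.univ.image X, by simp [idealOfVars]⟩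
  set D := max D₀ E with hD
  have hDI : idealOfVars (Fin n) ℂ ^ D ≤ I₀ := (Ideal.pow_le_pow_right (le_max_left _ _)).trans hD₀
  have heD : ∀ k, e k ≤ D := fun k => (he k).trans (le_max_right _ _)
  let S := (Finset.univ : Finset (Fin n)).finsuppAntidiag D
  have hS : ∀ α : Fin n →₀ ℕ, α ∈ S ↔ α.degree = D := fun α => by
    simp [S, Finset.mem_finsuppAntidiag, Finsupp.degree_eq_sum]
  have hmon : ∀ α : S, ∃ A : κ →₀ MvPolynomial (Fin n) ℂ,
      (A.sum fun k a => a * P k w₀) = monomial α.1 1 := by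
    intro α
    refine Finsupp.mem_ideal_span_range_iff_exists_finsupp.mp (hDI ?_)
    rw [monomial_mem_pow_idealOfVars_iff _ _ one_ne_zero, (hS α.1).mp α.2]
  choose A hA using hmon
  let R : S → W → MvPolynomial (Fin n) ℂ := fun α w =>
    ∑ k ∈ (A α).support, P k w * homogeneousComponent (D - e k) (A α k)
  have hRhom : ∀ α w, (R α w).IsHomogeneous D := fun α w =>
    IsHomogeneous.sum _ _ _ fun k _ => by
      have := (hhom k w).mul (homogeneousComponent_isHomogeneous (D - e k) (A α k))
      rwa [Nat.add_sub_cancel' (heD k)] at this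
  have hR₀ : ∀ α, R α w₀ = monomial α.1 1 := by
    intro α
    have h1 := congrArg (homogeneousComponent D) (hA α)
    rw [homogeneousComponent_of_mem (isHomogeneous_monomial 1 ((hS α.1).mp α.2)), if_pos rfl,
      Finsupp.sum, map_sum] at h1
    rw [← h1]
    refine Finset.sum_congr rfl fun k _ => ?_
    rw [mul_comm (A α k), ← homogeneousComponent_mul_of_isHomogeneous (hhom k w₀),
      Nat.add_sub_cancel' (heD k)]
  have hRpoly : ∀ α, R α ∈ polyFamilies W (Fin n) := by
    intro α
    have : R α = ∑ k ∈ (A α).support, P k * fun _ => homogeneousComponent (D - e k) (A α k) := by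
      ext1 w
      simp [R]
    rw [this]
    exact Subalgebra.sum_mem _ fun k _ => mul_mem (hP k) (const_mem_polyFamilies _)
  let M : W → Matrix S S ℂ := fun w α β => coeff β.1 (R α w)
  refine ⟨fun w => (M w).det, det_mem_polyFun fun α β => hRpoly α β.1, ?_, ?_⟩
  · have h1 : M w₀ = 1 := by
      ext α β
      simp only [M, hR₀, coeff_monomial, Matrix.one_apply, Subtype.ext_iff]
    change (M w₀).det ≠ 0
    rw [h1, Matrix.det_one]
    exact one_ne_zero
  · intro w hw x hx
    by_contra! hno
    -- At a common zero `x` the vector of all degree `D` monomials of `x` is in the kernel; if the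
    -- determinant is nonzero, every xᵢ^D vanishes.
    have hker : (M w).mulVec (fun β : S => ∏ i, x i ^ β.1 i) = 0 := by
      ext α
      have h1 : eval x (R α w) = 0 := by
        simp [R, hno]
      rw [eval_eq, Finset.sum_subset (fun β hβ => (hS β).mpr
        (by_contra fun h => (mem_support_iff.mp hβ) ((hRhom α w).coeff_eq_zero h)))
        (fun β _ hβ => by rw [notMem_support_iff.mp hβ, zero_mul]), ← Finset.sum_coe_sort] at h1
      rw [Pi.zero_apply, ← h1, Matrix.mulVec, dotProduct]
      refine Finset.sum_congr rfl fun β _ => ?_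
      congr 1
      refine (Finset.prod_subset (Finset.subset_univ _) fun i _ hi => ?_).symm
      rw [Finsupp.notMem_support_iff.mp hi, pow_zero]
    have hz := Matrix.eq_zero_of_mulVec_eq_zero hw hker
    refine hx (funext fun i => ?_)
    have h2 := congrFun hz ⟨Finsupp.single i D, (hS _).mpr (by simp)⟩
    rw [Pi.zero_apply, Finset.prod_eq_zero_iff] at h2
    obtain ⟨j, _, hj⟩ := h2
    by_cases hij : i = j
    · rw [hij]
      exact eq_zero_of_pow_eq_zero hj
    · simp [hij] at hj

end PolynomialFamilies

/-! ### Openness of smoothness. -/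

section SmoothLocus

variable {W : Type*} [AddCommGroup W] [Module ℂ W]

theorem linearIndependent_rows_iff_exists_det_ne_zero {c n : ℕ} (A : Matrix (Fin c) (Fin n) ℂ) :
    LinearIndependent ℂ (fun i => A i) ↔ ∃ T : Matrix (Fin n) (Fin c) ℂ, (A * T).det ≠ 0 := by
  constructor
  · intro h
    have hrank : A.rank = c := by simpa using LinearIndependent.rank_matrix h
    have hsurj : Function.Surjective A.mulVec := by
      have : LinearMap.range A.mulVecLin = ⊤ :=
        Submodule.eq_top_of_finrank_eq (by rw [← Matrix.rank, hrank]; simp)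
      exact LinearMap.range_eq_top.mp this
    obtain ⟨T, hT⟩ := Matrix.mulVec_surjective_iff_exists_right_inverse.mp hsurj
    exact ⟨T, by rw [hT, Matrix.det_one]; exact one_ne_zero⟩
  · rintro ⟨T, hT⟩
    rw [Fintype.linearIndependent_iff]
    intro g hg
    have h1 : Matrix.vecMul g A = 0 := by
      ext j
      have := congrFun hg j
      simpa [Matrix.vecMul, dotProduct] using this
    have h2 : Matrix.vecMul g (A * T) = 0 := by
      rw [← Matrix.vecMul_vecMul, h1, Matrix.zero_vecMul]
    exact congrFun (Matrix.eq_zero_of_vecMul_eq_zero hT h2)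

/-- In a linear family of tuples of forms, smoothness is an open condition. -/
theorem exists_polyFun_of_smooth {c : ℕ} {d : Fin c → ℕ} {F : Fin c → W →ₗ[ℂ] CoordRing}
    (hF : ∀ i w, (F i w).IsHomogeneous (d i)) {w₀ : W}
    (h₀ : IsSmoothOfCodim (Ideal.span (Set.range fun i => F i w₀)) c) :
    ∃ φ ∈ polyFun W, φ w₀ ≠ 0 ∧
      ∀ w, φ w ≠ 0 → IsSmoothOfCodim (Ideal.span (Set.range fun i => F i w)) c := by
  let M : Matrix (Fin 6) (Fin c) ℂ → W → Matrix (Fin c) (Fin c) CoordRing := fun T w =>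
    Matrix.of fun i k => ∑ j, pderiv j (F i w) * C (T j k)
  -- Singular points are the common zeros of the equations and of all det(Jacobian · T) with `T`
  -- constant. These are forms of bounded degree depending polynomially on `w`, so elimination
  -- applies.
  let P : Fin c ⊕ Matrix (Fin 6) (Fin c) ℂ → W → CoordRing :=
    Sum.elim (fun i w => F i w) fun T w => (M T w).det
  let e : Fin c ⊕ Matrix (Fin 6) (Fin c) ℂ → ℕ := Sum.elim d fun _ => ∑ i, (d i - 1)
  have hMe : ∀ T w x, eval x (M T w).det =
      ((Matrix.of fun i => gradientAt (F i w) x : Matrix (Fin c) (Fin 6) ℂ) * T).det := by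
    intro T w x
    rw [RingHom.map_det]
    congr 1
    ext i k
    simp [M, Matrix.mul_apply, gradientAt]
  have hiff : ∀ w, IsSmoothOfCodim (Ideal.span (Set.range fun i => F i w)) c ↔
      ∀ x ≠ 0, ∃ k, eval x (P k w) ≠ 0 := by
    intro w
    rw [isSmoothOfCodim_span_range_iff]
    refine forall₂_congr fun x _ => ?_
    have h1 := linearIndependent_rows_iff_exists_det_ne_zero
      (Matrix.of fun i => gradientAt (F i w) x)
    simp only [← hMe] at h1
    change LinearIndependent ℂ (fun i => gradientAt (F i w) x) ↔ _ at h1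
    rw [h1, Sum.exists]
    constructor
    · intro h
      by_cases h2 : ∀ i, eval x (F i w) = 0
      · exact Or.inr (h h2)
      · push Not at h2
        exact Or.inl h2
    · rintro (⟨i, hi⟩ | h) h2
      · exact absurd (h2 i) hi
      · exact h
  have hP : ∀ k, P k ∈ polyFamilies W (Fin 6) := by
    rintro (i | T)
    · exact linearMap_mem_polyFamilies (F i)
    · refine det_mem_polyFamilies fun i k => ?_
      have : (fun w => M T w i k) =
          ∑ j, (fun w => ((pderiv j).toLinearMap ∘ₗ F i) w) * fun _ => C (T j k) := by
        ext1 w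
        simp [M]
      rw [this]
      exact Subalgebra.sum_mem _ fun j _ => mul_mem
        (linearMap_mem_polyFamilies ((pderiv j).toLinearMap ∘ₗ F i)) (const_mem_polyFamilies _)
  have he : ∀ k, e k ≤ ∑ i, d i := by
    rintro (i | T)
    · exact Finset.single_le_sum (f := d) (fun _ _ => Nat.zero_le _) (Finset.mem_univ i)
    · exact Finset.sum_le_sum fun i _ => Nat.sub_le _ _
  have hhom : ∀ k w, (P k w).IsHomogeneous (e k) := by
    rintro (i | T) w
    · exact hF i w
    · change (M T w).det.IsHomogeneous (∑ i, (d i - 1))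
      rw [Matrix.det_apply']
      refine IsHomogeneous.sum _ _ _ fun τ _ => ?_
      rw [← Equiv.sum_comp τ fun i => d i - 1, ← map_intCast (C : ℂ →+* CoordRing)]
      refine IsHomogeneous.C_mul (IsHomogeneous.prod _ _ _ fun i _ => ?_) _
      change IsHomogeneous (∑ j, pderiv j (F (τ i) w) * C (T j i)) (d (τ i) - 1)
      refine IsHomogeneous.sum _ _ _ fun j _ => ?_
      rw [mul_comm]
      exact ((hF _ w).pderiv).C_mul _
  obtain ⟨φ, hφ, h1, h2⟩ := exists_polyFun_of_no_common_zero hP he hhom ((hiff w₀).mp h₀)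
  exact ⟨φ, hφ, h1, fun w hw => (hiff w).mpr (h2 w hw)⟩

end SmoothLocus

/-! ### Smoothness implies complete intersection. -/

section SmoothQuartics

/-- A non-unit has a zero by the Nullstellensatz. Only when the origin is one does it matter that a
single equation in more than one variable has further zeros. -/
theorem exists_ne_zero_zero_of_not_isUnit {n : ℕ} (hn : 1 < n) {d : MvPolynomial (Fin n) ℂ}
    (hd : ¬ IsUnit d) : ∃ y ≠ 0, eval y d = 0 := by
  by_cases h0 : eval 0 d = 0
  · obtain ⟨y, hy, h⟩ := exists_ne_zero_common_zero hn (fun _ : Fin 1 => d) fun _ => h0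
    exact ⟨y, hy, h 0⟩
  · by_contra! hno
    have hall : ∀ y, eval y d ≠ 0 := fun y => by
      by_cases hy : y = 0
      · rwa [hy]
      · exact hno y hy
    refine hd (Ideal.span_singleton_eq_top.mp (Ideal.radical_eq_top.mp ?_))
    rw [← vanishingIdeal_zeroLocus_eq_radical (K := ℂ), Ideal.eq_top_iff_one]
    intro y hy
    exact absurd (hy d (Ideal.mem_span_singleton_self d)) (by simpa [aeval_eq_eval] using hall y)

theorem exists_gradientAt_eq {l : CoordRing} (hl : l.IsHomogeneous 1) :
    ∃ c : Fin 6 → ℂ, (∀ x, gradientAt l x = c) ∧ ∀ x, eval x l = c ⬝ᵥ x := by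
  have hc : ∀ i, pderiv i l = C (coeff 0 (pderiv i l)) := fun i =>
    totalDegree_eq_zero_iff_eq_C.mp (Nat.le_zero.mp (hl.pderiv (i := i)).totalDegree_le)
  refine ⟨fun i => coeff 0 (pderiv i l), fun x => ?_, fun x => ?_⟩
  · ext i
    rw [gradientAt, hc, eval_C, ← hc]
  · have h := congrArg (eval x) hl.sum_X_mul_pderiv
    rw [one_smul, map_sum] at h
    rw [← h, dotProduct]
    refine Finset.sum_congr rfl fun i _ => ?_
    rw [map_mul, eval_X, hc, eval_C, ← hc, mul_comm]

theorem ofList_eq_span_range {R : Type*} [CommRing R] (a b c d : R) :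
    Ideal.ofList [a, b, c, d] = Ideal.span (Set.range ![a, b, c, d]) := by
  rw [Ideal.ofList]
  congr 1
  ext r
  simp [eq_comm]
  tauto

theorem smooth_ofList_iff (l₁ l₂ g₁ g₂ : CoordRing) :
    IsSmoothOfCodim (Ideal.ofList [l₁, l₂, g₁, g₂]) 4 ↔ ∀ x ≠ 0, eval x l₁ = 0 → eval x l₂ = 0 →
      eval x g₁ = 0 → eval x g₂ = 0 → ∀ α β γ δ : ℂ,
        α • gradientAt l₁ x + β • gradientAt l₂ x + γ • gradientAt g₁ x + δ • gradientAt g₂ x = 0 →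
          α = 0 ∧ β = 0 ∧ γ = 0 ∧ δ = 0 := by
  rw [ofList_eq_span_range, isSmoothOfCodim_span_range_iff]
  refine forall₂_congr fun x _ => ?_
  simp only [Fin.forall_fin_succ, Fintype.linearIndependent_iff, Fin.sum_univ_four,
    Matrix.cons_val_zero, Matrix.cons_val_succ, IsEmpty.forall_iff, and_true, Matrix.cons_val]
  constructor
  · intro h h1 h2 h3 h4 α β γ δ h5
    exact h ⟨h1, h2, h3, h4⟩ ![α, β, γ, δ] h5
  · rintro h ⟨h1, h2, h3, h4⟩ g h5
    exact h h1 h2 h3 h4 (g 0) (g 1) (g 2) (g 3) h5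

/-- Equations of a smooth curve of degree four form a regular sequence. -/
theorem isRegular_of_smooth {l₁ l₂ g₁ g₂ : CoordRing} (hl₁ : l₁.IsHomogeneous 1)
    (hl₂ : l₂.IsHomogeneous 1) (hg₁ : g₁.IsHomogeneous 2) (hg₂ : g₂.IsHomogeneous 2)
    (hsm : IsSmoothOfCodim (Ideal.ofList [l₁, l₂, g₁, g₂]) 4) :
    RingTheory.Sequence.IsRegular CoordRing [l₁, l₂, g₁, g₂] := by
  rw [smooth_ofList_iff] at hsm
  have z₁ := constantCoeff_of_isHomogeneous hl₁
  have z₂ := constantCoeff_of_isHomogeneous hl₂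
  have z₃ := constantCoeff_of_isHomogeneous hg₁
  have z₄ := constantCoeff_of_isHomogeneous hg₂
  obtain ⟨c₁, hc₁, he₁⟩ := exists_gradientAt_eq hl₁
  obtain ⟨c₂, hc₂, he₂⟩ := exists_gradientAt_eq hl₂
  simp only [hc₁, hc₂] at hsm
  -- The curve is nonempty because 4 < 6. Independence of the gradients at one point already gives
  -- that of `l₁`, `l₂` and that `g₁` is not in their ideal.
  obtain ⟨x₀, hx₀, hzero⟩ := exists_ne_zero_common_zero (show 4 < 6 by norm_num)
    ![l₁, l₂, g₁, g₂] fun i => by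
      rw [eval_zero]
      fin_cases i <;> assumption
  have hsm₀ := hsm x₀ hx₀ (hzero 0) (hzero 1) (hzero 2) (hzero 3)
  have hli : LinearIndependent ℂ ![c₁, c₂] := by
    rw [LinearIndependent.pair_iff]
    intro s t hst
    have := hsm₀ s t 0 0 (by rw [hst]; module)
    exact ⟨this.1, this.2.1⟩
  obtain ⟨β, hβ⟩ := exists_basis_extending (show 2 ≤ 6 by norm_num) hli
  have hβ0 : β 0 = c₁ := hβ 0
  have hβ1 : β 1 = c₂ := hβ 1
  let A : (Fin 6 → ℂ) →ₗ[ℂ] (Fin 6 → ℂ) := Matrix.mulVecLin (Matrix.of fun i => β i)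
  have hA : Function.Injective A := by
    rw [injective_iff_map_eq_zero]
    intro x hx
    have hx' : ∀ i, β i ⬝ᵥ x = 0 := fun i => congrFun hx i
    refine dotProduct_eq_zero _ fun y => ?_
    rw [← β.sum_repr y, dotProduct_sum]
    exact Finset.sum_eq_zero fun i _ => by
      rw [dotProduct_smul, dotProduct_comm, hx', smul_zero]
  let b : Module.Basis (Fin 6) ℂ (Fin 6 → ℂ) :=
    Module.Basis.ofEquivFun (LinearEquiv.ofInjectiveEndo A hA)
  have hb : ∀ x i, b.repr x i = β i ⬝ᵥ x := fun x i => rfl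
  have hf₁ : coordForm b 0 = l₁ := MvPolynomial.funext fun x => by
    rw [eval_coordForm, hb, hβ0, he₁]
  have hf₂ : coordForm b 1 = l₂ := MvPolynomial.funext fun x => by
    rw [eval_coordForm, hb, hβ1, he₂]
  have hcb : ∀ i, c₁ ⬝ᵥ b i = (if i = 0 then 1 else 0) ∧ c₂ ⬝ᵥ b i = if i = 1 then 1 else 0 := by
    intro i
    rw [← hβ0, ← hβ1, ← hb, ← hb, b.repr_self, Finsupp.single_apply, Finsupp.single_apply]
    exact ⟨rfl, rfl⟩
  have p1 : (Ideal.ofList [l₁]).IsPrime := by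
    rw [← hf₁]
    exact ofList_coordForm_isPrime b [0]
  have p2 : (Ideal.ofList [l₁, l₂]).IsPrime := by
    rw [← hf₁, ← hf₂]
    exact ofList_coordForm_isPrime b [0, 1]
  have n1 : l₁ ≠ 0 := by
    intro h
    have := hcb 0
    rw [← he₁, h, map_zero] at this
    exact zero_ne_one this.1
  have n2 : l₂ ∉ Ideal.ofList [l₁] := by
    rw [← hf₁, ← hf₂]
    intro h
    have := restrictCoord_of_mem b [0] h
    rw [restrictCoord_coordForm, if_neg (by decide)] at this
    exact X_ne_zero _ this
  have n3 : g₁ ∉ Ideal.ofList [l₁, l₂] := by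
    simp only [mem_ofList_cons, mem_ofList_nil]
    rintro ⟨u, y, ⟨v, o, rfl, rfl⟩, h⟩
    have hgr : gradientAt g₁ x₀ = eval x₀ u • gradientAt l₁ x₀ + eval x₀ v • gradientAt l₂ x₀ := by
      have e1 : eval x₀ l₁ = 0 := hzero 0
      have e2 : eval x₀ l₂ = 0 := hzero 1
      ext i
      rw [gradientAt, h]
      simp [gradientAt, e1, e2]
    rw [hc₁, hc₂] at hgr
    exact one_ne_zero (hsm₀ (-eval x₀ u) (-eval x₀ v) 1 0 (by rw [hgr]; module)).2.2.1
  let Φ : Fin 6 → MvPolynomial (Fin 4) ℂ := fun j => ∑ i, C (b (Fin.natAdd 2 i) j) * X i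
  have hΦ : ∀ (p : CoordRing) (y : Fin 4 → ℂ),
      eval y (aeval Φ p) = eval (∑ i, y i • b (Fin.natAdd 2 i)) p := by
    intro p y
    rw [eval_aeval_linear]
    congr 2
    ext j
    simp [mul_comm]
  have hinj : Function.Injective (Fin.natAdd 2 : Fin 4 → Fin 6) := Fin.natAdd_injective 4 2
  have hrename : ∀ p : CoordRing, restrictCoord b [0, 1] p = rename (Fin.natAdd 2) (aeval Φ p) := by
    intro p
    refine MvPolynomial.funext fun x => ?_
    rw [eval_restrictCoord, eval_rename, hΦ]
    congr 2
    simp only [Fin.sum_univ_six, Fin.sum_univ_four]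
    simp
  have hdvd : ∀ p q : CoordRing, restrictCoord b [0, 1] p ∣ restrictCoord b [0, 1] q ↔
      aeval Φ p ∣ aeval Φ q := by
    intro p q
    rw [hrename, hrename]
    refine ⟨fun h => ?_, map_dvd (rename (Fin.natAdd 2))⟩
    have := map_dvd (killCompl hinj) h
    rwa [killCompl_rename_app, killCompl_rename_app] at this
  -- A non-unit common factor `d` on the 3-space vanishes at some y ≠ 0, where both gradients are
  -- multiples of that of `d`, contradicting smoothness. Coprimality is regularity of the last
  -- equation.
  have hcop : IsRelPrime (aeval Φ g₁) (aeval Φ g₂) := by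
    rintro d ⟨a₁, ha₁⟩ ⟨a₂, ha₂⟩
    by_contra hd
    obtain ⟨y, hy, hyd⟩ := exists_ne_zero_zero_of_not_isUnit (by norm_num) hd
    set x := ∑ i, y i • b (Fin.natAdd 2 i) with hx
    have hxne : x ≠ 0 := by
      intro h0
      exact hy (funext (Fintype.linearIndependent_iff.mp
        (b.linearIndependent.comp _ hinj) y h0))
    have ev : ∀ p a : MvPolynomial (Fin 4) ℂ, p = d * a → eval y p = 0 := by
      rintro p a rfl
      rw [map_mul, hyd, zero_mul]
    have dv : ∀ (p a : MvPolynomial (Fin 4) ℂ) j, p = d * a →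
        eval y (pderiv j p) = eval y a * eval y (pderiv j d) := by
      rintro p a j rfl
      simp [hyd]
    have hgrad : ∀ (G : CoordRing) (j : Fin 4),
        gradientAt G x ⬝ᵥ b (Fin.natAdd 2 j) = eval y (pderiv j (aeval Φ G)) := by
      intro G j
      rw [pderiv_aeval_eq_sum, map_sum, dotProduct]
      refine Finset.sum_congr rfl fun k _ => ?_
      rw [map_mul, hΦ]
      simp [gradientAt, hx, Φ, pderiv_X, Pi.single_apply]
    have hl0 : ∀ i : Fin 6, i = 0 ∨ i = 1 → β i ⬝ᵥ x = 0 := by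
      intro i hi
      rw [← hb, hx]
      simp only [map_sum, map_smul, Module.Basis.repr_self, Finsupp.coe_finsetSum,
        Finset.sum_apply, Finsupp.smul_apply]
      refine Finset.sum_eq_zero fun k _ => ?_
      have hne : ∀ k : Fin 4, (Fin.natAdd 2 k : Fin 6) ≠ 0 ∧ (Fin.natAdd 2 k : Fin 6) ≠ 1 := by
        decide
      rw [Finsupp.single_apply, if_neg, smul_zero]
      rcases hi with rfl | rfl
      · exact (hne k).1
      · exact (hne k).2
    have hsm' := hsm x hxne (by rw [he₁, ← hβ0, hl0 0 (Or.inl rfl)])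
      (by rw [he₂, ← hβ1, hl0 1 (Or.inr rfl)]) (by rw [← hΦ]; exact ev _ _ ha₁)
      (by rw [← hΦ]; exact ev _ _ ha₂)
    have key : ∀ γ δ : ℂ, (∀ j, γ * eval y (pderiv j (aeval Φ g₁)) +
        δ * eval y (pderiv j (aeval Φ g₂)) = 0) → γ = 0 ∧ δ = 0 := by
      intro γ δ h
      set w := γ • gradientAt g₁ x + δ • gradientAt g₂ x with hw
      have h0 : -(w ⬝ᵥ b 0) • c₁ + -(w ⬝ᵥ b 1) • c₂ + γ • gradientAt g₁ x +
          δ • gradientAt g₂ x = 0 := by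
        rw [add_assoc, ← hw]
        refine dotProduct_eq_zero _ fun u => ?_
        rw [← b.sum_repr u, dotProduct_sum]
        refine Finset.sum_eq_zero fun i _ => ?_
        rw [dotProduct_smul, add_dotProduct, add_dotProduct, smul_dotProduct, smul_dotProduct,
          (hcb i).1, (hcb i).2]
        by_cases h0 : i = 0
        · simp [h0]
        by_cases h1 : i = 1
        · simp [h1]
        obtain ⟨j, rfl⟩ : ∃ j : Fin 4, i = Fin.natAdd 2 j := by
          refine ⟨⟨i - 2, by omega⟩, Fin.ext ?_⟩
          have h2 : (i : ℕ) ≠ 0 := fun h => h0 (Fin.ext h)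
          have h3 : (i : ℕ) ≠ 1 := fun h => h1 (Fin.ext h)
          simp only [Fin.val_natAdd]
          omega
        have := h j
        rw [← hgrad, ← hgrad] at this
        rw [if_neg h0, if_neg h1, smul_zero, smul_zero, zero_add, zero_add, hw, add_dotProduct,
          smul_dotProduct, smul_dotProduct, smul_eq_mul γ, smul_eq_mul δ, this, smul_zero]
      obtain ⟨-, -, h1, h2⟩ := hsm' _ _ _ _ h0
      exact ⟨h1, h2⟩
    obtain ⟨h1, h2⟩ := key (eval y a₂) (-eval y a₁) fun j => by
      rw [dv _ _ j ha₁, dv _ _ j ha₂]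
      ring
    refine one_ne_zero (key 1 0 fun j => ?_).1
    rw [dv _ _ j ha₁, neg_eq_zero.mp h2]
    ring
  rw [isRegular_iff_forall_mem]
  refine ⟨fun i hi x hx => ?_, ofList_ne_top_of_constantCoeff (by simp [z₁, z₂, z₃, z₄])⟩
  simp only [List.length_cons, List.length_nil] at hi
  interval_cases i
  · rw [List.take_zero, mem_ofList_nil] at hx ⊢
    exact (mul_eq_zero.mp hx).resolve_left n1
  · exact (p1.mem_or_mem hx).resolve_left n2
  · exact (p2.mem_or_mem hx).resolve_left n3
  · change g₂ * x ∈ Ideal.ofList [l₁, l₂, g₁] at hx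
    change x ∈ Ideal.ofList [l₁, l₂, g₁]
    rw [ofList_triple, ← hf₁, ← hf₂] at hx ⊢
    have hx' := (hdvd _ _).mp ((mem_sup_span_iff b [0, 1] g₁ _).mp hx)
    rw [map_mul] at hx'
    exact (mem_sup_span_iff b [0, 1] g₁ x).mpr ((hdvd _ _).mpr (hcop.dvd_of_dvd_mul_left hx'))

end SmoothQuartics

/-! ### Density in general fibres, without coordinates. -/

section GenericFiber

variable {N B : Type*} [AddCommGroup N] [Module ℂ N] [FiniteDimensional ℂ N]
  [AddCommGroup B] [Module ℂ B] [FiniteDimensional ℂ B]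

/-- In the general fibre of a polynomial map, a nonempty open set of the source is dense. -/
theorem exists_polyFun_generic_fiber_dense {Φ : N → B}
    (hΦ : ∀ ℓ : B →ₗ[ℂ] ℂ, (fun n => ℓ (Φ n)) ∈ polyFun N) {s : N → ℂ} (hs : s ∈ polyFun N)
    (hs₀ : ∃ n, s n ≠ 0) : ∃ g ∈ polyFun B, (∃ y, g y ≠ 0) ∧ ∀ y, g y ≠ 0 → ∀ p ∈ polyFun N,
      ∀ n, Φ n = y → p n ≠ 0 → ∃ n', Φ n' = y ∧ p n' ≠ 0 ∧ s n' ≠ 0 := by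
  let bN := Module.finBasis ℂ N
  let bB := Module.finBasis ℂ B
  choose P hP using fun j => (mem_polyFun_iff bN).mp (hΦ (bB.coord j))
  obtain ⟨S, hS⟩ := (mem_polyFun_iff bN).mp hs
  have hS0 : S ≠ 0 := by
    rintro rfl
    obtain ⟨n, hn⟩ := hs₀
    exact hn (by rw [hS, map_zero])
  obtain ⟨g, hg0, hg⟩ := exists_generic_fiber_dense P hS0
  obtain ⟨y₀, hy₀⟩ : ∃ y, eval y g ≠ 0 := by
    by_contra! hno
    exact hg0 (MvPolynomial.funext fun y => by rw [hno, map_zero])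
  refine ⟨fun y => eval (bB.equivFun y) g, (mem_polyFun_iff bB).mpr ⟨g, fun _ => rfl⟩,
    ⟨bB.equivFun.symm y₀, by simpa only [LinearEquiv.apply_symm_apply] using hy₀⟩,
    fun y hy p hp n hn hpn => ?_⟩
  obtain ⟨Q, hQ⟩ := (mem_polyFun_iff bN).mp hp
  obtain ⟨x, hx, hxQ, hxS⟩ := hg _ hy Q (bN.equivFun n) (fun j => by
    rw [← hP, hn]; rfl) (by rwa [← hQ])
  refine ⟨bN.equivFun.symm x, bB.equivFun.injective (funext fun j => ?_), ?_, ?_⟩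
  · rw [← hx, ← bN.equivFun.apply_symm_apply x, ← hP, bN.equivFun.apply_symm_apply]
    rfl
  · rwa [hQ, bN.equivFun.apply_symm_apply]
  · rwa [hS, bN.equivFun.apply_symm_apply]

theorem mul_mem_polyFun {σ : Type*} (A₁ A₂ : N →ₗ[ℂ] MvPolynomial σ ℂ)
    (ℓ : MvPolynomial σ ℂ →ₗ[ℂ] ℂ) : (fun n => ℓ (A₁ n * A₂ n)) ∈ polyFun N :=
  bilin_mem_polyFun (((LinearMap.mul ℂ (MvPolynomial σ ℂ)).compl₁₂ A₁ A₂).compr₂ ℓ)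

end GenericFiber

/-! ### One smooth threefold and one smooth quartic. -/

section Examples

/-- Fermat quadric and cubic: a gradient relation involving the cubic makes all nonzero coordinates
equal to some ρ, and then the sum of squares is a positive multiple of ρ². -/
theorem exists_smooth_threefold : ∃ v : Forms 2 × Forms 3,
    IsSmoothOfCodim (intersectionIdeal v.1 v.2) 2 := by
  have hq : (∑ i, X i ^ 2 : CoordRing).IsHomogeneous 2 :=
    IsHomogeneous.sum _ _ _ fun i _ => isHomogeneous_X_pow i 2
  have hf : (∑ i, X i ^ 3 : CoordRing).IsHomogeneous 3 :=
    IsHomogeneous.sum _ _ _ fun i _ => isHomogeneous_X_pow i 3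
  refine ⟨(⟨_, hq⟩, ⟨_, hf⟩), ?_⟩
  rw [smooth_intersectionIdeal_iff]
  intro x hx hqx _ α β hαβ
  have hrel : ∀ i, α * (2 * x i) + β * (3 * x i ^ 2) = 0 := by
    intro i
    have := congrFun hαβ i
    simpa [gradientAt, pderiv_X, Pi.single_apply, pderiv_pow] using this
  obtain ⟨j, hj⟩ := Function.ne_iff.mp hx
  rw [Pi.zero_apply] at hj
  have hβ : β = 0 := by
    by_contra hβ
    set ρ := -(2 * α) / (3 * β) with hρ
    have hxi : ∀ i, x i = if x i = 0 then 0 else ρ := by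
      intro i
      split_ifs with h
      · exact h
      · have h1 : 2 * α + 3 * β * x i = 0 :=
          (mul_eq_zero.mp (by linear_combination hrel i : x i * (2 * α + 3 * β * x i) = 0)
            ).resolve_left h
        rw [hρ]
        field_simp
        linear_combination h1
    have hρ0 : ρ ≠ 0 := by
      intro h
      have := hxi j
      rw [h] at this
      simp only [ite_self] at this
      exact hj this
    have hsum : ∑ i, x i ^ 2 = ((Finset.univ.filter fun i => x i ≠ 0).card : ℂ) * ρ ^ 2 := by
      rw [← nsmul_eq_mul, ← Finset.sum_const, Finset.sum_filter]
      refine Finset.sum_congr rfl fun i _ => ?_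
      by_cases h : x i = 0
      · simp [h]
      · have := hxi i
        rw [if_neg h] at this
        rw [if_pos h, this]
    have hq0 : ∑ i, x i ^ 2 = 0 := by simpa using hqx
    rw [hsum, mul_eq_zero, Nat.cast_eq_zero, Finset.card_eq_zero] at hq0
    rcases hq0 with h | h
    · have : j ∈ Finset.univ.filter fun i => x i ≠ 0 := by simpa using hj
      rw [h] at this
      simp at this
    · exact hρ0 (eq_zero_of_pow_eq_zero h)
  refine ⟨?_, hβ⟩
  have := hrel j
  rw [hβ] at this
  simpa [hj] using this

/-- Diagonal quadrics with distinct eigenvalue ratios 0, 1, 2, 3: a nontrivial relation γ + iδ = 0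
holds for at most one `i`, leaving one nonzero coordinate, whose square is not zero. -/
theorem exists_smooth_quartic : ∃ t : Forms 1 × Forms 1 × Forms 2 × Forms 2,
    IsSmoothOfCodim (Ideal.ofList [(t.1 : CoordRing), (t.2.1 : CoordRing), (t.2.2.1 : CoordRing),
      (t.2.2.2 : CoordRing)]) 4 := by
  have h₁ : (∑ i : Fin 4, X (i.castLE (by norm_num)) ^ 2 : CoordRing).IsHomogeneous 2 :=
    IsHomogeneous.sum _ _ _ fun i _ => isHomogeneous_X_pow _ 2
  have h₂ : (∑ i : Fin 4, C (i : ℂ) * X (i.castLE (by norm_num)) ^ 2 : CoordRing).IsHomogeneous 2 :=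
    IsHomogeneous.sum _ _ _ fun i _ => (isHomogeneous_X_pow _ 2).C_mul _
  refine ⟨(⟨X 4, isHomogeneous_X ℂ 4⟩, ⟨X 5, isHomogeneous_X ℂ 5⟩, ⟨_, h₁⟩, ⟨_, h₂⟩), ?_⟩
  rw [smooth_ofList_iff]
  intro x hx h4 h5 hg hg' α β γ δ hrel
  simp only [eval_X] at h4 h5
  have hrel' := fun i => congrFun hrel i
  simp only [gradientAt, Fin.sum_univ_four, Pi.add_apply, Pi.smul_apply, smul_eq_mul, map_add,
    pderiv_X, Pi.single_apply, pderiv_pow, map_mul, pderiv_C_mul, map_pow, eval_X, eval_C,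
    Pi.zero_apply] at hrel'
  have r0 := hrel' 0
  have r1 := hrel' 1
  have r2 := hrel' 2
  have r3 := hrel' 3
  have r4 := hrel' 4
  have r5 := hrel' 5
  simp [Fin.ext_iff] at r0 r1 r2 r3 r4 r5
  have hsq : x 0 ^ 2 + x 1 ^ 2 + x 2 ^ 2 + x 3 ^ 2 = 0 := by
    simpa [Fin.sum_univ_four] using hg
  have hne : ¬ (x 0 = 0 ∧ x 1 = 0 ∧ x 2 = 0 ∧ x 3 = 0) := by
    rintro ⟨h0, h1, h2, h3⟩
    refine hx (funext fun i => ?_)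
    fin_cases i <;> assumption
  have r1' : γ + δ = 0 ∨ x 1 = 0 := mul_eq_zero.mp (by linear_combination r1 / 2)
  have r2' : γ + 2 * δ = 0 ∨ x 2 = 0 := mul_eq_zero.mp (by linear_combination r2 / 2)
  have r3' : γ + 3 * δ = 0 ∨ x 3 = 0 := mul_eq_zero.mp (by linear_combination r3 / 2)
  refine ⟨r4, r5, ?_⟩
  clear hrel' hrel hg hg' h₁ h₂ r1 r2 r3 r4 r5
  grind

end Examples

/-! ### The incidence variety and the general quartic. -/

section GenericQuartic

instance (d : ℕ) : Module.Finite ℂ (Forms d) :=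
  Module.Finite.iff_fg.mpr (homogeneousSubmodule_fg _ _ d)

/-- Equations of an elliptic quartic. -/
abbrev QuarticTuples : Type := Forms 1 × Forms 1 × Forms 2 × Forms 2

/-- Coefficients of a quadric and a cubic in terms of the equations of an elliptic quartic. -/
abbrev QuarticCoefficients : Type :=
  (Forms 1 × Forms 1 × Forms 0 × Forms 0) × Forms 2 × Forms 2 × Forms 1 × Forms 1

/-- The ideal generated by the equations of an elliptic quartic. -/
abbrev tupleIdeal (t : QuarticTuples) : Ideal CoordRing :=
  Ideal.ofList [(t.1 : CoordRing), (t.2.1 : CoordRing), (t.2.2.1 : CoordRing),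
    (t.2.2.2 : CoordRing)]

/-- The quadric and the cubic through an elliptic quartic with given coefficients. -/
def combination (n : QuarticTuples × QuarticCoefficients) : Forms 2 × Forms 3 :=
  (⟨n.1.1 * n.2.1.1 + n.1.2.1 * n.2.1.2.1 + n.1.2.2.1 * n.2.1.2.2.1 + n.1.2.2.2 * n.2.1.2.2.2,
    (((n.1.1.2.mul n.2.1.1.2 : IsHomogeneous _ (1 + 1)).add (n.1.2.1.2.mul n.2.1.2.1.2)).add
      (n.1.2.2.1.2.mul n.2.1.2.2.1.2)).add (n.1.2.2.2.2.mul n.2.1.2.2.2.2)⟩,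
   ⟨n.1.1 * n.2.2.1 + n.1.2.1 * n.2.2.2.1 + n.1.2.2.1 * n.2.2.2.2.1 + n.1.2.2.2 * n.2.2.2.2.2,
    (((n.1.1.2.mul n.2.2.1.2 : IsHomogeneous _ (1 + 2)).add (n.1.2.1.2.mul n.2.2.2.1.2)).add
      (n.1.2.2.1.2.mul n.2.2.2.2.1.2)).add (n.1.2.2.2.2.mul n.2.2.2.2.2.2)⟩)

theorem combination_mem_polyFun (ℓ : (Forms 2 × Forms 3) →ₗ[ℂ] ℂ) :
    (fun n => ℓ (combination n)) ∈ polyFun (QuarticTuples × QuarticCoefficients) := by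
  obtain ⟨ℓ₂, hℓ₂⟩ := LinearMap.exists_extend (ℓ ∘ₗ LinearMap.inl ℂ (Forms 2) (Forms 3))
  obtain ⟨ℓ₃, hℓ₃⟩ := LinearMap.exists_extend (ℓ ∘ₗ LinearMap.inr ℂ (Forms 2) (Forms 3))
  have h : ∀ v : Forms 2 × Forms 3, ℓ v = ℓ₂ v.1 + ℓ₃ v.2 := by
    intro v
    have h2 := LinearMap.congr_fun hℓ₂ v.1
    have h3 := LinearMap.congr_fun hℓ₃ v.2
    simp only [LinearMap.comp_apply, Submodule.subtype_apply, LinearMap.inl_apply,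
      LinearMap.inr_apply] at h2 h3
    rw [h2, h3, ← map_add]
    simp
  let N := QuarticTuples × QuarticCoefficients
  let e₁ : N →ₗ[ℂ] CoordRing := ⟨⟨fun n => n.1.1, fun _ _ => rfl⟩, fun _ _ => rfl⟩
  let e₂ : N →ₗ[ℂ] CoordRing := ⟨⟨fun n => n.1.2.1, fun _ _ => rfl⟩, fun _ _ => rfl⟩
  let e₃ : N →ₗ[ℂ] CoordRing := ⟨⟨fun n => n.1.2.2.1, fun _ _ => rfl⟩, fun _ _ => rfl⟩
  let e₄ : N →ₗ[ℂ] CoordRing := ⟨⟨fun n => n.1.2.2.2, fun _ _ => rfl⟩, fun _ _ => rfl⟩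
  let a₁ : N →ₗ[ℂ] CoordRing := ⟨⟨fun n => n.2.1.1, fun _ _ => rfl⟩, fun _ _ => rfl⟩
  let a₂ : N →ₗ[ℂ] CoordRing := ⟨⟨fun n => n.2.1.2.1, fun _ _ => rfl⟩, fun _ _ => rfl⟩
  let a₃ : N →ₗ[ℂ] CoordRing := ⟨⟨fun n => n.2.1.2.2.1, fun _ _ => rfl⟩, fun _ _ => rfl⟩
  let a₄ : N →ₗ[ℂ] CoordRing := ⟨⟨fun n => n.2.1.2.2.2, fun _ _ => rfl⟩, fun _ _ => rfl⟩
  let c₁ : N →ₗ[ℂ] CoordRing := ⟨⟨fun n => n.2.2.1, fun _ _ => rfl⟩, fun _ _ => rfl⟩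
  let c₂ : N →ₗ[ℂ] CoordRing := ⟨⟨fun n => n.2.2.2.1, fun _ _ => rfl⟩, fun _ _ => rfl⟩
  let c₃ : N →ₗ[ℂ] CoordRing := ⟨⟨fun n => n.2.2.2.2.1, fun _ _ => rfl⟩, fun _ _ => rfl⟩
  let c₄ : N →ₗ[ℂ] CoordRing := ⟨⟨fun n => n.2.2.2.2.2, fun _ _ => rfl⟩, fun _ _ => rfl⟩
  have e : (fun n => ℓ (combination n)) =
      ((fun n => ℓ₂ (e₁ n * a₁ n)) + (fun n => ℓ₂ (e₂ n * a₂ n)) + (fun n => ℓ₂ (e₃ n * a₃ n)) +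
        fun n => ℓ₂ (e₄ n * a₄ n)) +
      ((fun n => ℓ₃ (e₁ n * c₁ n)) + (fun n => ℓ₃ (e₂ n * c₂ n)) + (fun n => ℓ₃ (e₃ n * c₃ n)) +
        fun n => ℓ₃ (e₄ n * c₄ n)) := by
    funext n
    rw [h]
    simp only [combination, map_add]
    rfl
  rw [e]
  exact add_mem (add_mem (add_mem (add_mem (mul_mem_polyFun _ _ _) (mul_mem_polyFun _ _ _))
    (mul_mem_polyFun _ _ _)) (mul_mem_polyFun _ _ _)) (add_mem (add_mem (add_mem
    (mul_mem_polyFun _ _ _) (mul_mem_polyFun _ _ _)) (mul_mem_polyFun _ _ _))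
    (mul_mem_polyFun _ _ _))

theorem exists_homogeneous_coefficients {l₁ l₂ g₁ g₂ p : CoordRing} (hl₁ : l₁.IsHomogeneous 1)
    (hl₂ : l₂.IsHomogeneous 1) (hg₁ : g₁.IsHomogeneous 2) (hg₂ : g₂.IsHomogeneous 2) {d : ℕ}
    (hp : p.IsHomogeneous (d + 2)) (h : p ∈ Ideal.ofList [l₁, l₂, g₁, g₂]) :
    ∃ (a₁ a₂ : Forms (d + 1)) (a₃ a₄ : Forms d),
      p = l₁ * a₁ + l₂ * a₂ + g₁ * a₃ + g₂ * a₄ := by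
  simp only [mem_ofList_cons, mem_ofList_nil] at h
  obtain ⟨u₁, y₁, ⟨u₂, y₂, ⟨u₃, y₃, ⟨u₄, o, rfl, rfl⟩, rfl⟩, rfl⟩, h⟩ := h
  have hc : ∀ (i : ℕ) (a : CoordRing), (homogeneousComponent i a).IsHomogeneous i :=
    fun i a => homogeneousComponent_isHomogeneous i a
  refine ⟨⟨_, hc (d + 1) u₁⟩, ⟨_, hc (d + 1) u₂⟩, ⟨_, hc d u₃⟩, ⟨_, hc d u₄⟩, ?_⟩
  have h1 := homogeneousComponent_mul_of_isHomogeneous hl₁ (d + 1) u₁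
  have h2 := homogeneousComponent_mul_of_isHomogeneous hl₂ (d + 1) u₂
  have h3 := homogeneousComponent_mul_of_isHomogeneous hg₁ d u₃
  have h4 := homogeneousComponent_mul_of_isHomogeneous hg₂ d u₄
  rw [show 1 + (d + 1) = d + 2 by ring] at h1 h2
  rw [add_comm 2 d] at h3 h4
  have := congrArg (homogeneousComponent (d + 2)) h
  rw [homogeneousComponent_of_mem hp, if_pos rfl, add_zero, map_add, map_add, map_add, h1, h2, h3,
    h4] at this
  rw [this]
  ring

/-- Homogeneous components give cofactors of the right degrees. Hence the equations of quartics on V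
all lift to the fibre of `combination` over the equations of V. -/
theorem intersectionIdeal_le_tupleIdeal_iff (v : Forms 2 × Forms 3) (t : QuarticTuples) :
    intersectionIdeal v.1 v.2 ≤ tupleIdeal t ↔ ∃ m, combination (t, m) = v := by
  constructor
  · intro h
    obtain ⟨a₁, a₂, a₃, a₄, ha⟩ := exists_homogeneous_coefficients (d := 0) t.1.2 t.2.1.2
      t.2.2.1.2 t.2.2.2.2 v.1.2 (h (Ideal.subset_span (by simp)))
    obtain ⟨c₁, c₂, c₃, c₄, hc⟩ := exists_homogeneous_coefficients (d := 1) t.1.2 t.2.1.2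
      t.2.2.1.2 t.2.2.2.2 v.2.2 (h (Ideal.subset_span (by simp)))
    exact ⟨((a₁, a₂, a₃, a₄), c₁, c₂, c₃, c₄), Prod.ext (Subtype.ext ha.symm) (Subtype.ext hc.symm)⟩
  · rintro ⟨m, rfl⟩
    have hmem : ∀ a₁ a₂ a₃ a₄ : CoordRing,
        t.1 * a₁ + t.2.1 * a₂ + t.2.2.1 * a₃ + t.2.2.2 * a₄ ∈ tupleIdeal t := by
      intro a₁ a₂ a₃ a₄
      simp only [tupleIdeal, mem_ofList_cons, mem_ofList_nil]
      exact ⟨a₁, _, ⟨a₂, _, ⟨a₃, _, ⟨a₄, 0, rfl, rfl⟩, rfl⟩, rfl⟩, by ring⟩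
    rw [intersectionIdeal, Ideal.span_le]
    rintro p (rfl | rfl)
    · exact hmem _ _ _ _
    · exact hmem _ _ _ _

theorem exists_polyFun_of_smooth_threefold {v₀ : Forms 2 × Forms 3}
    (h₀ : IsSmoothOfCodim (intersectionIdeal v₀.1 v₀.2) 2) :
    ∃ φ ∈ polyFun (Forms 2 × Forms 3), φ v₀ ≠ 0 ∧
      ∀ v, φ v ≠ 0 → IsSmoothOfCodim (intersectionIdeal v.1 v.2) 2 := by
  let F : Fin 2 → (Forms 2 × Forms 3) →ₗ[ℂ] CoordRing :=
    ![⟨⟨fun v => v.1, fun _ _ => rfl⟩, fun _ _ => rfl⟩,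
      ⟨⟨fun v => v.2, fun _ _ => rfl⟩, fun _ _ => rfl⟩]
  have hF : ∀ i v, (F i v).IsHomogeneous (![2, 3] i) := by
    intro i v
    fin_cases i
    · exact v.1.2
    · exact v.2.2
  have hspan : ∀ v : Forms 2 × Forms 3,
      intersectionIdeal v.1 v.2 = Ideal.span (Set.range fun i => F i v) := by
    intro v
    rw [intersectionIdeal]
    congr 1
    ext r
    simp [F, eq_comm]
  simp only [hspan] at h₀ ⊢
  exact exists_polyFun_of_smooth hF h₀

theorem exists_polyFun_of_smooth_quartic {t₀ : QuarticTuples}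
    (h₀ : IsSmoothOfCodim (tupleIdeal t₀) 4) :
    ∃ φ ∈ polyFun QuarticTuples, φ t₀ ≠ 0 ∧ ∀ t, φ t ≠ 0 → IsSmoothOfCodim (tupleIdeal t) 4 := by
  let F : Fin 4 → QuarticTuples →ₗ[ℂ] CoordRing :=
    ![⟨⟨fun t => t.1, fun _ _ => rfl⟩, fun _ _ => rfl⟩,
      ⟨⟨fun t => t.2.1, fun _ _ => rfl⟩, fun _ _ => rfl⟩,
      ⟨⟨fun t => t.2.2.1, fun _ _ => rfl⟩, fun _ _ => rfl⟩,
      ⟨⟨fun t => t.2.2.2, fun _ _ => rfl⟩, fun _ _ => rfl⟩]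
  have hF : ∀ i t, (F i t).IsHomogeneous (![1, 1, 2, 2] i) := by
    intro i t
    fin_cases i
    · exact t.1.2
    · exact t.2.1.2
    · exact t.2.2.1.2
    · exact t.2.2.2.2
  have hspan : ∀ t : QuarticTuples, tupleIdeal t = Ideal.span (Set.range fun i => F i t) := by
    intro t
    rw [tupleIdeal, ofList_eq_span_range]
    congr 2
    ext1 i
    fin_cases i <;> rfl
  simp only [hspan] at h₀ ⊢
  exact exists_polyFun_of_smooth hF h₀

theorem quarticOfEquations_surjective (I : Ideal CoordRing) :
    Function.Surjective (quarticOfEquations I) := by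
  rintro ⟨E, ⟨fs, hfs, hreg, rfl⟩, hle⟩
  obtain _ | ⟨h1, _ | ⟨h2, _ | ⟨h3, _ | ⟨h4, _ | _⟩⟩⟩⟩ := hfs
  exact ⟨⟨(⟨_, h1⟩, ⟨_, h2⟩, ⟨_, h3⟩, ⟨_, h4⟩), hreg, hle⟩, rfl⟩

theorem isOpen_smooth_quartics (I : Ideal CoordRing) :
    IsOpen {E : EllipticQuarticsOn I | IsSmoothOfCodim E.1 4} := by
  rw [isOpen_coinduced]
  refine (@isOpen_induced_iff _ _ (zariskiTopology QuarticTuples) _ _).mpr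
    ⟨{t | IsSmoothOfCodim (tupleIdeal t) 4}, isOpen_of_forall_principal fun t ht => ?_, rfl⟩
  exact exists_polyFun_of_smooth_quartic ht

/-- On a general smooth threefold the general elliptic quartic is smooth. -/
theorem exists_open_dense_smooth_quartics : ∃ U : Set (Forms 2 × Forms 3),
    @IsOpen _ (zariskiTopology (Forms 2 × Forms 3)) U ∧
    @Dense _ (zariskiTopology (Forms 2 × Forms 3)) U ∧
    ∀ v ∈ U, IsSmoothOfCodim (intersectionIdeal v.1 v.2) 2 ∧
      ∃ G : Set (EllipticQuarticsOn (intersectionIdeal v.1 v.2)),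
        IsOpen G ∧ Dense G ∧ ∀ E ∈ G, IsSmoothOfCodim E.1 4 := by
  obtain ⟨v₀, hv₀⟩ := exists_smooth_threefold
  obtain ⟨φ, hφ, hφ₀, hφs⟩ := exists_polyFun_of_smooth_threefold hv₀
  obtain ⟨t₀, ht₀⟩ := exists_smooth_quartic
  obtain ⟨s, hs, hs₀, hss⟩ := exists_polyFun_of_smooth_quartic ht₀
  let π : QuarticTuples × QuarticCoefficients →ₗ[ℂ] QuarticTuples := LinearMap.fst ℂ _ _
  -- The smoothness polynomial `s`, pulled back from the equations, is nonzero on the source, so its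
  -- nonvanishing locus is dense in every fibre over g ≠ 0.
  obtain ⟨g, hg, hg₀, hgs⟩ := exists_polyFun_generic_fiber_dense combination_mem_polyFun
    (comp_mem_polyFun hs π) ⟨(t₀, 0), hs₀⟩
  refine ⟨{v | φ v * g v ≠ 0}, isOpen_setOf_ne_zero (mul_mem hφ hg),
    dense_setOf_ne_zero (mul_mem hφ hg) (exists_mul_ne_zero hφ hg ⟨v₀, hφ₀⟩ hg₀),
    fun v hv => ⟨hφs v (left_ne_zero_of_mul hv), {E | IsSmoothOfCodim E.1 4},
      isOpen_smooth_quartics _, ?_, fun E hE => hE⟩⟩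
  rw [dense_iff_inter_open]
  rintro O hO ⟨E, hE⟩
  obtain ⟨t, rfl⟩ := quarticOfEquations_surjective _ E
  rw [isOpen_coinduced] at hO
  obtain ⟨O', hO', hOO'⟩ := (@isOpen_induced_iff _ _ (zariskiTopology QuarticTuples) _ _).mp hO
  have htO' : t.1 ∈ O' := by
    have : t ∈ Subtype.val ⁻¹' O' := by rw [hOO']; exact hE
    exact this
  obtain ⟨p, hp, hpt, hpO⟩ := exists_principal_subset hO' htO'
  -- A choice of coefficients lifts the given quartic to the fibre over `v`; there it can be moved
  -- to a smooth one without leaving the given open set.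
  obtain ⟨m, hm⟩ := (intersectionIdeal_le_tupleIdeal_iff v t.1).mp t.2.2
  obtain ⟨n, hn, hpn, hsn⟩ := hgs v (right_ne_zero_of_mul hv) _ (comp_mem_polyFun hp π) (t.1, m) hm
    hpt
  have hsmooth : IsSmoothOfCodim (tupleIdeal n.1) 4 := hss _ hsn
  -- The density statement controls only smoothness; that the new equations form a regular sequence
  -- is a consequence of it.
  let t' : quarticEquations (intersectionIdeal v.1 v.2) :=
    ⟨n.1, isRegular_of_smooth n.1.1.2 n.1.2.1.2 n.1.2.2.1.2 n.1.2.2.2.2 hsmooth,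
      (intersectionIdeal_le_tupleIdeal_iff v n.1).mpr ⟨n.2, hn⟩⟩
  refine ⟨quarticOfEquations _ t', ?_, hsmooth⟩
  have : t' ∈ Subtype.val ⁻¹' O' := hpO _ hpn
  rw [hOO'] at this
  exact this

end GenericQuartic

end FanoQuartics

end

theorem mainTheorem7 :
    (∀ q f : MvPolynomial (Fin 6) ℂ, q.IsHomogeneous 2 → f.IsHomogeneous 3 →
      FanoQuartics.IsSmoothOfCodim (FanoQuartics.intersectionIdeal q f) 2 →
      ∃ L K E : Ideal (MvPolynomial (Fin 6) ℂ),
        FanoQuartics.IsThreeSpace L ∧ FanoQuartics.IsConic K ∧ FanoQuartics.IsEllipticQuartic E ∧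
        L ≤ K ∧ L ≤ E ∧
        FanoQuartics.intersectionIdeal q f ≤ K ∧ FanoQuartics.intersectionIdeal q f ≤ E ∧
        FanoQuartics.IsCompleteIntersection [1, 1, 2, 3]
          (L ⊔ FanoQuartics.intersectionIdeal q f) ∧
        FanoQuartics.AreLinkedIn (L ⊔ FanoQuartics.intersectionIdeal q f) K E) ∧
    (∃ U : Set (FanoQuartics.Forms 2 × FanoQuartics.Forms 3),
      @IsOpen _ (FanoQuartics.zariskiTopology (FanoQuartics.Forms 2 × FanoQuartics.Forms 3)) U ∧
      @Dense _ (FanoQuartics.zariskiTopology (FanoQuartics.Forms 2 × FanoQuartics.Forms 3)) U ∧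
      ∀ v ∈ U,
        FanoQuartics.IsSmoothOfCodim (FanoQuartics.intersectionIdeal v.1 v.2) 2 ∧
        ∃ G : Set (FanoQuartics.EllipticQuarticsOn (FanoQuartics.intersectionIdeal v.1 v.2)),
          IsOpen G ∧ Dense G ∧ ∀ E ∈ G, FanoQuartics.IsSmoothOfCodim E.1 4) :=
  ⟨fun _ _ hq hf hsm => FanoQuartics.exists_linked_conic_and_quartic hq hf hsm,
    FanoQuartics.exists_open_dense_smooth_quartics⟩
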